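/- **Setting.** Let $d\ge 2$ and let $I=[l,r]\subset\mathbb R$ be a compact interval. Let $\mathfrak f\in C^1(\mathbb R;\mathbb R^d)$ with $f:=\mathfrak f'$ Lipschitz on $I$ (so $\mathfrak f\in C^{1,1}(I;\mathbb R^d)$), and let $a=\sigma^2$ on $\mathbb R$, where $\sigma:\mathbb R\to\mathbb R^{d\times d}$ is (Borel) measurable with $\sigma=\sigma^T$ pointwise, $a$ is continuous on $\mathbb R$ and Lipschitz on $I$ (so $a\in C^{0,1}(I;\mathbb R^{d\times d})$). The coefficients do not depend on the space variable $x\in\mathbb R^d$, in which a possible time variable is included. Assume that for some $\alpha,\delta_0>0$ there is a constant $C$ such that $$\sup_{\xi\in\mathbb R^d,\ |\xi|=1}\operatorname{meas}\bigl\{\lambda\in I:\ |\langle f(\lambda),\xi\rangle|^2+\langle a(\lambda)\xi,\xi\rangle\le\delta\bigr\}\le C\,\delta^{\alpha}\qquad\text{for all }\delta\in(0,\delta_0).$$ **Entropy solutions.** A function $u\in L^2(\mathbb R^d)\cap L^1(\mathbb R^d)$ is an entropy solution of $\operatorname{div}\mathfrak f(u)=\operatorname{div}(a(u)\nabla u)$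 if, with $h(x,\lambda)=\operatorname{sgn}(u(x)-\lambda)$: 1. there is a locally finite measure $\zeta\in\mathcal M_{loc}(\mathbb R^d\times\mathbb R)\cap C(\mathbb R_\lambda;\mathcal M_{loc}(\mathbb R^d))$ (continuity in the vague topology), with $\zeta\ge0$ or $-\zeta\ge 0$, such that in $\mathcal D'(\mathbb R^d\times\mathbb R)$ $$\operatorname{div}_x\bigl(f(\lambda)h\bigr)-\sum_{k,j=1}^d\partial_{x_jx_k}\bigl(a_{kj}(\lambda)h\bigr)=-\partial_\lambda\zeta ;$$ 2. for $k,s=1,\dots,d$ the functions $x\mapsto\int_0^{u(x)}\sigma_{sk}(w)\,dw$ are locally integrable, the distributions $B_k=\sum_{s=1}^d\partial_{x_s}\int_0^{u(x)}\sigma_{sk}(w)\,dw$ are locally integrable functions, the measure-valued functions $\beta_k(x,\cdot)=2B_k(x)\,\delta_{u(x)}$ belong to $L^2_{loc}(\mathbb R^d;\mathcal M_{loc}(\mathbb R))$ (that is, $B_k\mathbf 1_{\{|u|\le M\}}\in L^2_{loc}(\mathbb R^d)$ for every $M$), and in $\mathcal D'(\mathbb R^d\times\mathbb R)$ $$\sum_{k,j=1}^d\partial_{x_kx_j}\bigl(a_{kj}(\lambda)h\bigr)=\sum_{k,j=1}^d\partial_{x_j}\bigl(\sigma_{kj}(\lambda)\beta_k\bigr).$$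 **Theorem.** If $u$ is such an entropy solution, then for every $\rho\in C^1_c(I)$ (a $C^1$ function on $\mathbb R$ with support in $I$), every $q\in(1,q_*)$ and every $s\in(0,s_*)$, $$\int_I h(\cdot,\lambda)\,\rho(\lambda)\,d\lambda\in W^{s,q}_{loc}(\mathbb R^d),$$ where $$q_*=q_*(\alpha,d)=\frac{2\alpha+2(2d+6)}{2\alpha+2d+6},\qquad s_*=s_*(\alpha,d)=\frac{\alpha^2(\alpha+4)}{(3\alpha+8)\bigl((\alpha+4)(\alpha+2(d+1))+2\alpha\bigr)} .$$ -/

import Mathlib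

open MeasureTheory Set
open scoped ENNReal ContDiff

/-- Smooth compactly supported real functions. -/
def IsTestFunction {F : Type*} [NormedAddCommGroup F] [NormedSpace ℝ F] (φ : F → ℝ) : Prop :=
  ContDiff ℝ ∞ φ ∧ HasCompactSupport φ

/-- The partial derivative `∂φ/∂x_j` of a function on `ℝ^d`. -/
noncomputable def partialSpace {d : ℕ} (j : Fin d) (φ : EuclideanSpace ℝ (Fin d) → ℝ)
    (x : EuclideanSpace ℝ (Fin d)) : ℝ :=
  fderiv ℝ φ x (EuclideanSpace.single j 1)

/-- The partial derivative `∂φ/∂x_j` of a function of `(x, λ) ∈ ℝ^d × ℝ`. -/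
noncomputable def partialX {d : ℕ} (j : Fin d) (φ : EuclideanSpace ℝ (Fin d) × ℝ → ℝ)
    (p : EuclideanSpace ℝ (Fin d) × ℝ) : ℝ :=
  fderiv ℝ φ p (EuclideanSpace.single j 1, 0)

/-- The partial derivative `∂φ/∂λ` of a function of `(x, λ) ∈ ℝ^d × ℝ`. -/
noncomputable def partialLam {d : ℕ} (φ : EuclideanSpace ℝ (Fin d) × ℝ → ℝ)
    (p : EuclideanSpace ℝ (Fin d) × ℝ) : ℝ :=
  fderiv ℝ φ p (0, 1)

/-- The kinetic function `h(x, λ) = sgn (u(x) - λ)`. -/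
noncomputable def kineticFun {d : ℕ} (u : EuclideanSpace ℝ (Fin d) → ℝ)
    (p : EuclideanSpace ℝ (Fin d) × ℝ) : ℝ :=
  Real.sign (u p.1 - p.2)

/-- `ζ` is a (non-negative) locally finite measure on `ℝ^d × ℝ` which belongs to
`C(ℝ_λ; M_loc(ℝ^d))`: it is `ζ_λ(dx) dλ` for a family of locally finite measures `ζ_λ` on `ℝ^d`
depending on `λ` continuously for the vague topology. -/
def IsContinuousInLam {d : ℕ} (ζ : Measure (EuclideanSpace ℝ (Fin d) × ℝ)) : Prop :=
  IsFiniteMeasureOnCompacts ζ ∧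
  ∃ Z : ℝ → Measure (EuclideanSpace ℝ (Fin d)),
    (∀ l, IsFiniteMeasureOnCompacts (Z l)) ∧
    (∀ g : EuclideanSpace ℝ (Fin d) → ℝ, Continuous g → HasCompactSupport g →
      Continuous fun l => ∫ x, g x ∂(Z l)) ∧
    (∀ φ : EuclideanSpace ℝ (Fin d) × ℝ → ℝ, Continuous φ → HasCompactSupport φ →
      ∫ p, φ p ∂ζ = ∫ l : ℝ, ∫ x, φ (x, l) ∂(Z l))

/-- The kinetic equation
`div_x (f(λ) h) - ∑_{k,j} ∂_{x_j x_k} (a_{kj}(λ) h) = -κ ∂_λ ζ`, `f = 𝔣'`, `h = sgn (u - λ)`,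
in the sense of distributions on `ℝ^d × ℝ`. -/
def KineticEquation {d : ℕ} (𝔣 : ℝ → EuclideanSpace ℝ (Fin d))
    (a : ℝ → Matrix (Fin d) (Fin d) ℝ) (u : EuclideanSpace ℝ (Fin d) → ℝ)
    (κ : ℝ) (ζ : Measure (EuclideanSpace ℝ (Fin d) × ℝ)) : Prop :=
  ∀ φ : EuclideanSpace ℝ (Fin d) × ℝ → ℝ, IsTestFunction φ →
    - (∫ p, kineticFun u p * ∑ j, deriv 𝔣 p.2 j * partialX j φ p)
      - (∫ p, kineticFun u p * ∑ k, ∑ j, a p.2 k j * partialX j (partialX k φ) p)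
      = κ * ∫ p, partialLam φ p ∂ζ

/-- `B k = ∑_s ∂_{x_s} (∫_0^{u(x)} σ_{sk}(w) dw)` for every `k`, as weak derivatives: both the
functions that are differentiated and the `B k` are locally integrable. -/
def IsDissipationField {d : ℕ} (σ : ℝ → Matrix (Fin d) (Fin d) ℝ)
    (u : EuclideanSpace ℝ (Fin d) → ℝ) (B : Fin d → EuclideanSpace ℝ (Fin d) → ℝ) : Prop :=
  (∀ s k, LocallyIntegrable fun x => ∫ w in (0 : ℝ)..u x, σ w s k) ∧
  (∀ k, LocallyIntegrable (B k)) ∧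
  (∀ k, ∀ ψ : EuclideanSpace ℝ (Fin d) → ℝ, IsTestFunction ψ →
    ∫ x, B k x * ψ x = - ∫ x, ∑ s, (∫ w in (0 : ℝ)..u x, σ w s k) * partialSpace s ψ x)

/-- The regularity condition: the measure-valued functions
`β_k(x, ·) = 2 B_k(x) δ_{u(x)}`, `B_k = ∑_s ∂_{x_s} (∫_0^{u(x)} σ_{sk}(w) dw)`,
belong to `L²_loc(ℝ^d; M_loc(ℝ))`, which means that the total variation of `β_k(x, ·)` on any
bounded interval `[-M, M]`, that is `2 |B_k(x)|` if `|u(x)| ≤ M` and `0` otherwise, is locally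
square integrable in `x`; and
`∑_{k,j} ∂_{x_k x_j} (a_{kj}(λ) sgn (u(x) - λ)) = ∑_{k,j} ∂_{x_j} (σ_{kj}(λ) β_k(x, λ))`
in the sense of distributions on `ℝ^d × ℝ`, where
`⟨σ_{kj} β_k, g⟩ = ∫ 2 B_k(x) σ_{kj}(u(x)) g(x, u(x)) dx`. -/
def RegularityCondition {d : ℕ} (a σ : ℝ → Matrix (Fin d) (Fin d) ℝ)
    (u : EuclideanSpace ℝ (Fin d) → ℝ) : Prop :=
  ∃ B : Fin d → EuclideanSpace ℝ (Fin d) → ℝ, IsDissipationField σ u B ∧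
    (∀ k, ∀ M : ℝ, ∀ K : Set (EuclideanSpace ℝ (Fin d)), IsCompact K →
      MemLp ({x | |u x| ≤ M}.indicator (B k)) 2 (volume.restrict K)) ∧
    ∀ φ : EuclideanSpace ℝ (Fin d) × ℝ → ℝ, IsTestFunction φ →
      ∫ p, kineticFun u p * ∑ k, ∑ j, a p.2 k j * partialX k (partialX j φ) p
        = - ∫ x, ∑ k, ∑ j, 2 * B k x * (σ (u x) k j * partialX j φ (x, u x))

/-- Entropy solutions of `div_x 𝔣(u) = div_x (a(u) ∇u)` on `ℝ^d`, `a = σ²`.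

The right-hand side of the kinetic equation is `-∂_λ ζ` or `+∂_λ ζ` with a non-negative measure
`ζ`; both sign conventions for the defect measure are admitted. -/
def IsEntropySolution {d : ℕ} (𝔣 : ℝ → EuclideanSpace ℝ (Fin d))
    (a σ : ℝ → Matrix (Fin d) (Fin d) ℝ) (u : EuclideanSpace ℝ (Fin d) → ℝ) : Prop :=
  MemLp u 2 ∧ MemLp u 1 ∧
  (∃ (κ : ℝ) (ζ : Measure (EuclideanSpace ℝ (Fin d) × ℝ)), (κ = 1 ∨ κ = -1) ∧
    IsContinuousInLam ζ ∧ KineticEquation 𝔣 a u κ ζ) ∧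
  RegularityCondition a σ u

/-- The quantitative non-degeneracy condition on `I` with exponent `α`, for `0 < δ < δ₀`. Here
`ℝ^d` contains the time variable as well, so `ξ` runs over the unit sphere of `ℝ^d`. -/
def NonDegenerate {d : ℕ} (𝔣 : ℝ → EuclideanSpace ℝ (Fin d))
    (a : ℝ → Matrix (Fin d) (Fin d) ℝ) (I : Set ℝ) (α δ₀ : ℝ) : Prop :=
  ∃ C : ℝ, ∀ δ ∈ Ioo 0 δ₀, ∀ ξ : EuclideanSpace ℝ (Fin d), ‖ξ‖ = 1 →
    volume {l ∈ I | (∑ j, deriv 𝔣 l j * ξ j) ^ 2 + ∑ k, ∑ j, a l k j * ξ j * ξ k ≤ δ}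
      ≤ ENNReal.ofReal (C * δ ^ α)

/-- The local fractional Sobolev (Sobolev–Slobodeckij) space `W^{s,q}_loc(ℝ^d)`, `0 < s < 1`,
`1 ≤ q < ∞`, through the Gagliardo seminorm on compact sets. -/
def MemSobolevLoc {d : ℕ} (s q : ℝ) (g : EuclideanSpace ℝ (Fin d) → ℝ) : Prop :=
  ∀ K : Set (EuclideanSpace ℝ (Fin d)), IsCompact K →
    MemLp g (ENNReal.ofReal q) (volume.restrict K) ∧
    ∫⁻ x in K, ∫⁻ y in K, ‖g x - g y‖ₑ ^ q / edist x y ^ ((d : ℝ) + s * q) < ⊤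

/-- The integrability exponent `q_*(α, d)`. -/
noncomputable def qStar (α : ℝ) (d : ℕ) : ℝ :=
  (2 * α + 2 * (2 * d + 6)) / (2 * α + 2 * d + 6)

/-- The regularity exponent `s_*(α, d)`. -/
noncomputable def sStar (α : ℝ) (d : ℕ) : ℝ :=
  α ^ 2 * (α + 4) / ((3 * α + 8) * ((α + 4) * (α + 2 * (d + 1)) + 2 * α))

/-! Let g = ∫ h ρ dλ be the velocity average, with |h| ≤ 1. Everything rests on one decay estimate
(`IsKineticSolution.exists_pairing_decay`): if V is a superposition of plane waves with frequencies
of size J, with V, J⁻¹∂V, J⁻²∂²V at most one in the sup norm and its amplitude at most one in L²,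
then |∫ φ g V| ≤ C J^(-s') for each s' < α / (3 (1 + α)). Sup norms of test functions are the right
ones, since the defect ζ is only a measure.

Decay. Put L_λ = f(λ)·∇ + a(λ):D². First replace V by exp(T L_λ) V. The time derivative of the
pairing is a pairing of h with L_λ of a test function, which the kinetic equation turns into ζ
tested with a λ-derivative; the cost is governed by the Lipschitz constant in λ, and the commutator
with φ costs one derivative. The error is (J + T J²) T (`exists_semigroup_smoothing`). Next insert
the multiplier exp(-π t² ⟨f,ξ⟩²). Its t-derivative carries a factor f·∇ only, without the
second-order part; the regularity condition removes that part from the kinetic equation at the price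
of the sup norm of σ∇ of the test function, and exp(T L_λ) has already made this O(T^(-1/2)). The
error is (1 + tJ + TJ² + T^(-1/2)) t (`exists_transport_smoothing`).

For t² ≤ T and θ = ξ/|ξ|, the square of the remaining symbol is at most exp(-t²J²(⟨f,θ⟩² + ⟨aθ,θ⟩)).
Non-degeneracy bounds its integral over I by D δ^α + |I| exp(-t²J²δ) (`lintegral_sq_symbol_le`), and
Plancherel bounds the last pairing by the square root of such a quantity
(`exists_norm_pairing_le_of_sq`). With T = J^(-4/3), t = J^(-2/3-s'), δ = J^(-2s'/α) all errors are
O(J^(-s')), and t²J²δ is a positive power of J precisely when s' < α / (3 (1 + α)).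

From decay to regularity. Testing φg with the dyadic pieces of b(·-z) - b for |b| ≤ 1 and summing
gives, by duality, ‖φg(·+z) - φg‖_{L¹} ≤ C|z|^r for r < s' (`exists_translation_duality`,
`exists_lintegral_translation_le`). As g is bounded, the q-th power of a difference is at most a
constant times the difference, so the Gagliardo integral is finite as soon as sq < r. It remains
that s_* q_* ≤ α / (3 (1 + α)) (`sStar_mul_qStar_le`). -/

/-! ### Integrals depending on a parameter -/

section Parametric

variable {X Y : Type*} [TopologicalSpace X] [MeasurableSpace X] [OpensMeasurableSpace X]
  [TopologicalSpace Y] {ν : Measure X}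

lemma integrable_mul_of_continuous {w g : X → ℂ} (hw : Integrable w ν) {S : Set X}
    (hS : IsCompact S) (hwS : ∀ x, x ∉ S → w x = 0) (hg : Continuous g) :
    Integrable (fun x => w x * g x) ν := by
  obtain ⟨B, hB⟩ := hS.exists_bound_of_continuousOn hg.continuousOn
  refine (hw.norm.mul_const B).mono' (hw.1.mul hg.aestronglyMeasurable) (ae_of_all _ fun x => ?_)
  rw [norm_mul]
  by_cases hx : x ∈ S
  · exact mul_le_mul_of_nonneg_left (hB x hx) (norm_nonneg _)
  · simp [hwS x hx]

lemma continuous_integral_mul [FirstCountableTopology Y] [LocallyCompactSpace Y]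
    {w : X → ℂ} (hw : Integrable w ν) {S : Set X} (hS : IsCompact S) (hwS : ∀ x, x ∉ S → w x = 0)
    {g : Y → X → ℂ} (hg : Continuous (Function.uncurry g)) :
    Continuous fun y => ∫ x, w x * g y x ∂ν := by
  refine continuous_iff_continuousAt.2 fun y => ?_
  obtain ⟨K, hK, hKy⟩ := exists_compact_mem_nhds y
  obtain ⟨B, hB⟩ := (hK.prod hS).exists_bound_of_continuousOn hg.continuousOn
  refine continuousAt_of_dominated (bound := fun x => ‖w x‖ * B) ?_ ?_ (hw.norm.mul_const B) ?_
  · exact Filter.Eventually.of_forall fun z => hw.1.mul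
      (hg.comp (Continuous.prodMk_right z)).aestronglyMeasurable
  · filter_upwards [hKy] with z hz
    refine ae_of_all _ fun x => ?_
    rw [norm_mul]
    by_cases hx : x ∈ S
    · exact mul_le_mul_of_nonneg_left (hB (z, x) ⟨hz, hx⟩) (norm_nonneg _)
    · simp [hwS x hx]
  · exact ae_of_all _ fun x => (continuous_const.mul
      (hg.comp (Continuous.prodMk_left x))).continuousAt

lemma hasDerivAt_integral_mul {w : X → ℂ} (hw : Integrable w ν) {S : Set X} (hS : IsCompact S)
    (hwS : ∀ x, x ∉ S → w x = 0) {g g' : ℝ → X → ℂ} (hg : Continuous (Function.uncurry g))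
    (hg' : Continuous (Function.uncurry g'))
    (hd : ∀ s x, HasDerivAt (fun r => g r x) (g' s x) s) (s : ℝ) :
    HasDerivAt (fun r => ∫ x, w x * g r x ∂ν) (∫ x, w x * g' s x ∂ν) s := by
  obtain ⟨B, hB⟩ := ((isCompact_Icc (a := s - 1) (b := s + 1)).prod
    hS).exists_bound_of_continuousOn hg'.continuousOn
  have hs : Icc (s - 1) (s + 1) ∈ nhds s := Icc_mem_nhds (by linarith) (by linarith)
  have hc : ∀ r, Continuous (g r) := fun r => hg.comp (Continuous.prodMk_right r)
  refine (hasDerivAt_integral_of_dominated_loc_of_deriv_le (bound := fun x => ‖w x‖ * B)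
    (F' := fun r x => w x * g' r x) hs
    (Filter.Eventually.of_forall fun r => hw.1.mul (hc r).aestronglyMeasurable)
    (integrable_mul_of_continuous hw hS hwS (hc s))
    (hw.1.mul (hg'.comp (Continuous.prodMk_right s)).aestronglyMeasurable) ?_
    (hw.norm.mul_const B) ?_).2
  · refine ae_of_all _ fun x r hr => ?_
    rw [norm_mul]
    by_cases hx : x ∈ S
    · exact mul_le_mul_of_nonneg_left (hB (r, x) ⟨hr, hx⟩) (norm_nonneg _)
    · simp [hwS x hx]
  · exact ae_of_all _ fun x r _ => (hd r x).const_mul _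

end Parametric

/-! ### Superpositions of plane waves and multipliers bounded for the sup norm -/

section Waves

open scoped FourierTransform

variable {V : Type*} [NormedAddCommGroup V] [InnerProductSpace ℝ V]

/-- The plane wave `exp (2 π i ⟨x, ξ⟩)`. -/
noncomputable def wave (x ξ : V) : ℂ :=
  Complex.exp (((2 * Real.pi * inner ℝ x ξ : ℝ) : ℂ) * Complex.I)

lemma norm_wave (x ξ : V) : ‖wave x ξ‖ = 1 := Complex.norm_exp_ofReal_mul_I _

lemma wave_add (x y ξ : V) : wave (x + y) ξ = wave x ξ * wave y ξ := by
  rw [wave, wave, wave, ← Complex.exp_add, inner_add_left]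
  congr 1; push_cast; ring

lemma continuous_wave : Continuous fun p : V × V => wave p.1 p.2 := by
  unfold wave; fun_prop

lemma wave_zero (ξ : V) : wave 0 ξ = 1 := by simp [wave]

lemma fourierChar_smul (t : ℝ) (z : ℂ) :
    Real.fourierChar t • z = z * Complex.exp (((2 * Real.pi * t : ℝ) : ℂ) * Complex.I) := by
  rw [Circle.smul_def, Real.fourierChar_apply, smul_eq_mul, mul_comm]

lemma hasDerivAt_wave_smul (x v ξ : V) (t : ℝ) :
    HasDerivAt (fun t : ℝ => wave (x + t • v) ξ)
      (2 * Real.pi * Complex.I * (inner ℝ v ξ : ℝ) * wave (x + t • v) ξ) t := by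
  have h : HasDerivAt (fun t : ℝ => (2 * Real.pi * inner ℝ (x + t • v) ξ : ℝ))
      (2 * Real.pi * inner ℝ v ξ) t := by
    have : (fun t : ℝ => (2 * Real.pi * inner ℝ (x + t • v) ξ : ℝ))
        = fun t : ℝ => 2 * Real.pi * (inner ℝ x ξ + t * inner ℝ v ξ) := by
      ext t; rw [inner_add_left, real_inner_smul_left]
    rw [this]
    simpa using (((hasDerivAt_id t).mul_const (inner ℝ v ξ)).const_add (inner ℝ x ξ)).const_mul
      (2 * Real.pi)
  have := (h.ofReal_comp.mul_const Complex.I).cexp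
  unfold wave
  convert this using 1
  push_cast; ring

variable [MeasurableSpace V] [BorelSpace V] [FiniteDimensional ℝ V]

/-- The superposition of plane waves with amplitudes `μ`. -/
noncomputable def synth (μ : V → ℂ) (x : V) : ℂ := ∫ ξ, μ ξ * wave x ξ

lemma synth_eq_fourierInv (μ : V → ℂ) : synth μ = 𝓕⁻ μ := by
  ext x
  rw [Real.fourierInv_eq, synth]
  refine integral_congr_ae (ae_of_all _ fun ξ => ?_)
  simp only [fourierChar_smul, wave, real_inner_comm]

lemma integrable_mul_wave {μ : V → ℂ} (hμ : Integrable μ) (x : V) :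
    Integrable fun ξ => μ ξ * wave x ξ := by
  refine hμ.norm.mono' (hμ.1.mul ?_) (ae_of_all _ fun ξ => by simp [norm_wave])
  exact (continuous_wave.comp (Continuous.prodMk_right x)).aestronglyMeasurable

lemma synth_add {μ₁ μ₂ : V → ℂ} (h₁ : Integrable μ₁) (h₂ : Integrable μ₂) (x : V) :
    synth (fun ξ => μ₁ ξ + μ₂ ξ) x = synth μ₁ x + synth μ₂ x := by
  simp only [synth, add_mul]
  exact integral_add (integrable_mul_wave h₁ x) (integrable_mul_wave h₂ x)

lemma synth_sub {μ₁ μ₂ : V → ℂ} (h₁ : Integrable μ₁) (h₂ : Integrable μ₂) (x : V) :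
    synth (fun ξ => μ₁ ξ - μ₂ ξ) x = synth μ₁ x - synth μ₂ x := by
  simp only [synth, sub_mul]
  exact integral_sub (integrable_mul_wave h₁ x) (integrable_mul_wave h₂ x)

lemma synth_const_mul (c : ℂ) (μ : V → ℂ) (x : V) :
    synth (fun ξ => c * μ ξ) x = c * synth μ x := by
  simp only [synth, mul_assoc]
  exact integral_const_mul _ _

lemma synth_finset_sum {ι : Type*} (s : Finset ι) {μ : ι → V → ℂ} (h : ∀ i ∈ s, Integrable (μ i))
    (x : V) : synth (fun ξ => ∑ i ∈ s, μ i ξ) x = ∑ i ∈ s, synth (μ i) x := by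
  simp only [synth, Finset.sum_mul]
  exact integral_finsetSum _ fun i hi => integrable_mul_wave (h i hi) x

/-- `m` is a Fourier multiplier whose norm on bounded functions is at most `C`. -/
structure SupMult (m : V → ℂ) (C : ℝ) : Prop where
  nonneg : 0 ≤ C
  cont : Continuous m
  bdd : ∃ B, ∀ ξ, ‖m ξ‖ ≤ B
  bound : ∀ μ : V → ℂ, Integrable μ → ∀ D, (∀ x, ‖synth μ x‖ ≤ D) →
    ∀ x, ‖synth (fun ξ => m ξ * μ ξ) x‖ ≤ C * D

lemma SupMult.integrable_mul {m : V → ℂ} {C : ℝ} (h : SupMult m C) {μ : V → ℂ}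
    (hμ : Integrable μ) : Integrable fun ξ => m ξ * μ ξ := by
  obtain ⟨B, hB⟩ := h.bdd
  exact hμ.bdd_mul h.cont.aestronglyMeasurable (ae_of_all _ hB)

lemma SupMult.mul {m₁ m₂ : V → ℂ} {C₁ C₂ : ℝ} (h₁ : SupMult m₁ C₁) (h₂ : SupMult m₂ C₂) :
    SupMult (fun ξ => m₁ ξ * m₂ ξ) (C₁ * C₂) := by
  refine ⟨mul_nonneg h₁.nonneg h₂.nonneg, h₁.cont.mul h₂.cont, ?_, fun μ hμ D hD x => ?_⟩
  · obtain ⟨B₁, hB₁⟩ := h₁.bdd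
    obtain ⟨B₂, hB₂⟩ := h₂.bdd
    refine ⟨B₁ * B₂, fun ξ => ?_⟩
    rw [norm_mul]
    exact mul_le_mul (hB₁ ξ) (hB₂ ξ) (norm_nonneg _) ((norm_nonneg _).trans (hB₁ ξ))
  · simp only [mul_assoc]
    exact h₁.bound _ (h₂.integrable_mul hμ) _ (h₂.bound μ hμ D hD) x

lemma SupMult.const_mul {m : V → ℂ} {C : ℝ} (h : SupMult m C) (c : ℂ) :
    SupMult (fun ξ => c * m ξ) (‖c‖ * C) := by
  refine ⟨mul_nonneg (norm_nonneg _) h.nonneg, continuous_const.mul h.cont, ?_,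
    fun μ hμ D hD x => ?_⟩
  · obtain ⟨B, hB⟩ := h.bdd
    exact ⟨‖c‖ * B, fun ξ => by
      rw [norm_mul]; exact mul_le_mul_of_nonneg_left (hB ξ) (norm_nonneg _)⟩
  · simp only [mul_assoc]
    rw [synth_const_mul, norm_mul]
    exact mul_le_mul_of_nonneg_left (h.bound μ hμ D hD x) (norm_nonneg _)

lemma SupMult.add {m₁ m₂ : V → ℂ} {C₁ C₂ : ℝ} (h₁ : SupMult m₁ C₁) (h₂ : SupMult m₂ C₂) :
    SupMult (fun ξ => m₁ ξ + m₂ ξ) (C₁ + C₂) := by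
  refine ⟨add_nonneg h₁.nonneg h₂.nonneg, h₁.cont.add h₂.cont, ?_, fun μ hμ D hD x => ?_⟩
  · obtain ⟨B₁, hB₁⟩ := h₁.bdd
    obtain ⟨B₂, hB₂⟩ := h₂.bdd
    exact ⟨B₁ + B₂, fun ξ => (norm_add_le _ _).trans (add_le_add (hB₁ ξ) (hB₂ ξ))⟩
  · simp only [add_mul]
    rw [synth_add (h₁.integrable_mul hμ) (h₂.integrable_mul hμ)]
    exact (norm_add_le _ _).trans (add_le_add (h₁.bound μ hμ D hD x) (h₂.bound μ hμ D hD x))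

lemma SupMult.congr {m m' : V → ℂ} {C : ℝ} (h : SupMult m C) (e : ∀ ξ, m' ξ = m ξ) :
    SupMult m' C := by
  have : m' = m := funext e
  rwa [this]

/-- On the side of x this multiplier is the translation by y, an isometry for the sup norm. -/
lemma supMult_wave (y : V) : SupMult (wave y) 1 := by
  refine ⟨zero_le_one, continuous_wave.comp (Continuous.prodMk_right y),
    ⟨1, fun ξ => (norm_wave y ξ).le⟩, fun μ _ D hD x => ?_⟩
  have : synth (fun ξ => wave y ξ * μ ξ) x = synth μ (x + y) := by
    simp only [synth, wave_add]
    congr 1; ext ξ; ring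
  rw [this, one_mul]
  exact hD _

lemma supMult_one : SupMult (fun _ : V => (1 : ℂ)) 1 :=
  (supMult_wave (0 : V)).congr fun ξ => (wave_zero ξ).symm

lemma SupMult.prod {ι : Type*} (s : Finset ι) {m : ι → V → ℂ} (h : ∀ i ∈ s, SupMult (m i) 1) :
    SupMult (fun ξ => ∏ i ∈ s, m i ξ) 1 := by
  classical
  induction s using Finset.induction_on with
  | empty => simpa using supMult_one
  | insert a s ha ih =>
    have := (h a (Finset.mem_insert_self a s)).mul
      (ih fun i hi => h i (Finset.mem_insert_of_mem hi))
    simpa [Finset.prod_insert ha] using this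

/-- The Fourier transform of an integrable function of one variable, evaluated along a linear form,
is a multiplier. -/
lemma supMult_fourier_inner {c : ℝ → ℂ} (hc : Integrable c) (l : V) :
    SupMult (fun ξ => 𝓕 c (inner ℝ l ξ)) (∫ v, ‖c v‖) := by
  have hbd : ∀ t, ‖𝓕 c t‖ ≤ ∫ v, ‖c v‖ := fun t => by
    rw [Real.fourier_eq]
    refine (norm_integral_le_integral_norm _).trans (le_of_eq ?_)
    simp [Circle.norm_smul]
  have hcont : Continuous (𝓕 c) :=
    VectorFourier.fourierIntegral_continuous Real.continuous_fourierChar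
      (by exact continuous_inner) hc
  refine ⟨integral_nonneg fun _ => norm_nonneg _, by fun_prop, ⟨_, fun ξ => hbd _⟩,
    fun μ hμ D hD x => ?_⟩
  -- The multiplier averages translates along the line ℝl with weight c, whence the bound by the L¹
  -- norm of c, independent of l.
  have key : synth (fun ξ => 𝓕 c (inner ℝ l ξ) * μ ξ) x = ∫ v, c v * synth μ (x + (-v) • l) := by
    have h1 : ∀ ξ, 𝓕 c (inner ℝ l ξ) * μ ξ * wave x ξ
        = ∫ v, c v * (μ ξ * wave (x + (-v) • l) ξ) := fun ξ => by
      rw [Real.fourier_eq, mul_assoc, ← integral_mul_const]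
      refine integral_congr_ae (ae_of_all _ fun v => ?_)
      simp only [fourierChar_smul, wave_add]
      simp only [wave, inner_neg_left, real_inner_smul_left, RCLike.inner_apply, conj_trivial,
        neg_smul]
      push_cast
      ring_nf
    simp only [synth, h1]
    rw [integral_integral_swap]
    · simp only [integral_const_mul]
    · have : Integrable (fun p : V × ℝ => μ p.1 * c p.2) := hμ.mul_prod hc
      refine this.norm.mono' ?_ (ae_of_all _ fun p => ?_)
      · have hw : Continuous fun p : V × ℝ => wave (x + (-p.2) • l) p.1 :=
          continuous_wave.comp (by fun_prop : Continuous fun p : V × ℝ => (x + (-p.2) • l, p.1))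
        have := this.1.mul hw.aestronglyMeasurable
        refine this.congr (ae_of_all _ fun p => ?_)
        simp only [Function.uncurry, Pi.mul_apply]
        ring
      · simp [Function.uncurry, norm_wave, mul_comm]
  rw [key, ← integral_mul_const]
  refine norm_integral_le_of_norm_le (hc.norm.mul_const D) (ae_of_all _ fun v => ?_)
  rw [norm_mul]
  exact mul_le_mul_of_nonneg_left (hD _) (norm_nonneg _)

lemma integrable_cexp_neg_pi_sq : Integrable fun v : ℝ => Complex.exp (-Real.pi * 1 * (v : ℂ) ^ 2) := by
  have := integrable_cexp_neg_mul_sq (b := (Real.pi : ℂ)) (by simpa using Real.pi_pos)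
  simpa using this

lemma fourier_gauss (t : ℝ) :
    𝓕 (fun v : ℝ => Complex.exp (-Real.pi * 1 * (v : ℂ) ^ 2)) t
      = Complex.exp (-Real.pi * (t : ℂ) ^ 2) := by
  rw [fourier_gaussian_pi (by simp)]; simp

/-- The weight is a Gaussian probability density, so the constant is exactly 1 and products over all
rows of σ remain contractions. -/
lemma supMult_gauss (l : V) :
    SupMult (fun ξ => Complex.exp (-Real.pi * ((inner ℝ l ξ : ℝ) : ℂ) ^ 2)) 1 := by
  have h := supMult_fourier_inner integrable_cexp_neg_pi_sq l
  have hC : ∫ v : ℝ, ‖Complex.exp (-Real.pi * 1 * (v : ℂ) ^ 2)‖ = 1 := by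
    have : ∀ v : ℝ, ‖Complex.exp (-Real.pi * 1 * (v : ℂ) ^ 2)‖ = Real.exp (-Real.pi * v ^ 2) := by
      intro v
      rw [Complex.norm_exp]; congr 1
      rw [show (-Real.pi * 1 * (v : ℂ) ^ 2) = ((-Real.pi * v ^ 2 : ℝ) : ℂ) by push_cast; ring]
      exact Complex.ofReal_re _
    simp only [this, integral_gaussian]
    rw [div_self Real.pi_ne_zero, Real.sqrt_one]
  rw [hC] at h
  exact h.congr fun ξ => (fourier_gauss _).symm

/-- Up to the factor 2πi, z exp(-πz²) is the Fourier transform of the derivative of a Gaussian,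
which is integrable. The constant comes from one real variable and so is uniform in the direction
and length of `l`. -/
lemma exists_supMult_mul_gauss : ∃ C : ℝ, 0 ≤ C ∧ ∀ (V : Type*) [NormedAddCommGroup V]
    [InnerProductSpace ℝ V] [MeasurableSpace V] [BorelSpace V] [FiniteDimensional ℝ V] (l : V),
    SupMult (fun ξ => ((inner ℝ l ξ : ℝ) : ℂ) *
      Complex.exp (-Real.pi * ((inner ℝ l ξ : ℝ) : ℂ) ^ 2)) C := by
  set g : ℝ → ℂ := fun v : ℝ => Complex.exp (-Real.pi * 1 * (v : ℂ) ^ 2) with hg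
  have hd : ∀ v : ℝ, HasDerivAt g (-2 * Real.pi * ((v : ℂ) * Complex.exp (-Real.pi * (v : ℂ) ^ 2))) v := by
    intro v
    have h1 : HasDerivAt (fun v : ℝ => -Real.pi * 1 * (v : ℂ) ^ 2) (-Real.pi * 1 * (2 * (v : ℂ))) v := by
      have := ((hasDerivAt_id v).ofReal_comp.pow 2).const_mul (-(Real.pi : ℂ) * 1)
      simpa using this
    convert h1.cexp using 1
    simp only [mul_one]; ring
  have hderiv : deriv g = fun v : ℝ => -2 * Real.pi * ((v : ℂ) * Complex.exp (-Real.pi * (v : ℂ) ^ 2)) :=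
    funext fun v => (hd v).deriv
  have hi : Integrable (deriv g) := by
    rw [hderiv]
    refine Integrable.const_mul ?_ _
    exact integrable_mul_cexp_neg_mul_sq (b := (Real.pi : ℂ)) (by simpa using Real.pi_pos)
  have hF := Real.fourier_deriv integrable_cexp_neg_pi_sq
    (fun v => (hd v).differentiableAt) hi
  refine ⟨‖(2 * Real.pi * Complex.I : ℂ)⁻¹‖ * ∫ v, ‖deriv g v‖,
    mul_nonneg (norm_nonneg _) (integral_nonneg fun _ => norm_nonneg _), ?_⟩
  intro V _ _ _ _ _ l
  refine ((supMult_fourier_inner hi l).const_mul (2 * Real.pi * Complex.I : ℂ)⁻¹).congr fun ξ => ?_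
  rw [hF]
  simp only [smul_eq_mul]
  rw [fourier_gauss]
  have : (2 * Real.pi * Complex.I : ℂ) ≠ 0 := by
    simp [Real.pi_ne_zero]
  field_simp

end Waves

/-! ### Mean value inequality along families of symbols -/

section MeanValue

variable {V : Type*} [NormedAddCommGroup V] [InnerProductSpace ℝ V]
  [MeasurableSpace V] [BorelSpace V] [FiniteDimensional ℝ V]

/-- Mean value inequality for superpositions of plane waves. -/
lemma norm_synth_sub_le {μ : V → ℂ} (hμ : Integrable μ) {R : ℝ} (hR : ∀ ξ, R < ‖ξ‖ → μ ξ = 0)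
    {m m' : ℝ → V → ℂ} (hm : Continuous (Function.uncurry m))
    (hm' : Continuous (Function.uncurry m'))
    (hd : ∀ s ξ, HasDerivAt (fun r => m r ξ) (m' s ξ) s) {D : ℝ} (x : V)
    (hD : ∀ s ∈ Icc (0 : ℝ) 1, ‖synth (fun ξ => m' s ξ * μ ξ) x‖ ≤ D) :
    ‖synth (fun ξ => (m 1 ξ - m 0 ξ) * μ ξ) x‖ ≤ D := by
  have hS : IsCompact (Metric.closedBall (0 : V) R) := isCompact_closedBall _ _
  have hμS : ∀ ξ, ξ ∉ Metric.closedBall (0 : V) R → μ ξ = 0 := fun ξ hξ =>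
    hR ξ (by simpa using hξ)
  have hw : Continuous fun p : ℝ × V => wave x p.2 :=
    continuous_wave.comp (by fun_prop : Continuous fun p : ℝ × V => (x, p.2))
  have key := hasDerivAt_integral_mul hμ hS hμS (g := fun s ξ => m s ξ * wave x ξ)
    (g' := fun s ξ => m' s ξ * wave x ξ) (hm.mul hw) (hm'.mul hw)
    (fun s ξ => (hd s ξ).mul_const _)
  have e : ∀ s, ∫ ξ, μ ξ * (m' s ξ * wave x ξ) = synth (fun ξ => m' s ξ * μ ξ) x := fun s => by
    simp only [synth]; congr 1; ext ξ; ring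
  have mv := Convex.norm_image_sub_le_of_norm_hasDerivWithin_le
    (s := Icc (0 : ℝ) 1) (x := 0) (y := 1) (C := D)
    (fun s _ => (key s).hasDerivWithinAt) (fun s hs => by rw [e]; exact hD s hs)
    (convex_Icc _ _) (by simp) (by simp)
  have hc : ∀ s, Integrable fun ξ => m s ξ * μ ξ := fun s => by
    have := integrable_mul_of_continuous hμ hS hμS (hm.comp (Continuous.prodMk_right s))
    simpa [mul_comm, Function.comp_def] using this
  have e2 : synth (fun ξ => (m 1 ξ - m 0 ξ) * μ ξ) x
      = (∫ ξ, μ ξ * (m 1 ξ * wave x ξ)) - ∫ ξ, μ ξ * (m 0 ξ * wave x ξ) := by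
    simp only [sub_mul]
    rw [synth_sub (hc 1) (hc 0)]
    simp only [synth]
    congr 1 <;> (congr 1; ext ξ; ring)
  rw [e2]
  simpa using mv

end MeanValue

/-! ### Symbols of transport–diffusion operators, their semigroups, and frequency bands -/

section Symbols

variable {d : ℕ}

/-- The quadratic form of a matrix. -/
noncomputable def quadForm (A : Matrix (Fin d) (Fin d) ℝ) (ξ : EuclideanSpace ℝ (Fin d)) : ℝ :=
  ∑ k, ∑ j, A k j * ξ j * ξ k

/-- The `k`-th row of a matrix as a Euclidean vector. -/
noncomputable def rowVec (S : Matrix (Fin d) (Fin d) ℝ) (k : Fin d) : EuclideanSpace ℝ (Fin d) :=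
  WithLp.toLp 2 (S k)

/-- The symbol of `v · ∇ + A : D²`. -/
noncomputable def opSymbol (v : EuclideanSpace ℝ (Fin d)) (A : Matrix (Fin d) (Fin d) ℝ)
    (ξ : EuclideanSpace ℝ (Fin d)) : ℂ :=
  2 * Real.pi * Complex.I * ((inner ℝ v ξ : ℝ) : ℂ) - 4 * Real.pi ^ 2 * (quadForm A ξ : ℂ)

/-- The symbol of the semigroup generated by `v · ∇ + A : D²`. -/
noncomputable def semigroupSymbol (v : EuclideanSpace ℝ (Fin d)) (A : Matrix (Fin d) (Fin d) ℝ)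
    (s : ℝ) (ξ : EuclideanSpace ℝ (Fin d)) : ℂ :=
  Complex.exp (s * opSymbol v A ξ)

/-- `z exp (-π z²)` along the direction `l`. -/
noncomputable def oddGauss (l ξ : EuclideanSpace ℝ (Fin d)) : ℂ :=
  ((inner ℝ l ξ : ℝ) : ℂ) * Complex.exp (-Real.pi * ((inner ℝ l ξ : ℝ) : ℂ) ^ 2)

lemma inner_rowVec (S : Matrix (Fin d) (Fin d) ℝ) (k : Fin d) (ξ : EuclideanSpace ℝ (Fin d)) :
    inner ℝ (rowVec S k) ξ = ∑ j, S k j * ξ j := by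
  simp [rowVec, PiLp.inner_apply, mul_comm]

lemma inner_eq_sum (v ξ : EuclideanSpace ℝ (Fin d)) : inner ℝ v ξ = ∑ j, v j * ξ j := by
  simp [PiLp.inner_apply, mul_comm]

/-- A sum of squares of linear forms lets the diffusion semigroup factor into one-dimensional
Gaussians along the rows of σ. -/
lemma quadForm_sq {S : Matrix (Fin d) (Fin d) ℝ} (hS : S.IsSymm) (ξ : EuclideanSpace ℝ (Fin d)) :
    quadForm (S * S) ξ = ∑ k, (inner ℝ (rowVec S k) ξ) ^ 2 := by
  simp only [quadForm, inner_rowVec, sq, Finset.sum_mul_sum]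
  rw [Finset.sum_comm, Finset.sum_congr rfl fun k _ => Finset.sum_congr rfl fun j _ => by
    rw [Matrix.mul_apply, Finset.sum_mul, Finset.sum_mul]]
  rw [Finset.sum_congr rfl fun k _ => Finset.sum_comm, Finset.sum_comm]
  refine Finset.sum_congr rfl fun i _ => Finset.sum_congr rfl fun k _ =>
    Finset.sum_congr rfl fun j _ => ?_
  rw [hS.apply i j]; ring

lemma quadForm_sq_nonneg {S : Matrix (Fin d) (Fin d) ℝ} (hS : S.IsSymm)
    (ξ : EuclideanSpace ℝ (Fin d)) : 0 ≤ quadForm (S * S) ξ := by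
  rw [quadForm_sq hS]; positivity

lemma continuous_quadForm (A : Matrix (Fin d) (Fin d) ℝ) : Continuous (quadForm A) := by
  unfold quadForm; fun_prop

lemma continuous_opSymbol (v : EuclideanSpace ℝ (Fin d)) (A : Matrix (Fin d) (Fin d) ℝ) :
    Continuous (opSymbol v A) := by
  have := continuous_quadForm A
  unfold opSymbol; fun_prop

/-- The scaling of the rows is forced by π (√(4πs) z)² = 4π² s z². -/
lemma semigroupSymbol_eq_prod (v : EuclideanSpace ℝ (Fin d)) {S : Matrix (Fin d) (Fin d) ℝ}
    (hS : S.IsSymm) {s : ℝ} (hs : 0 ≤ s) (ξ : EuclideanSpace ℝ (Fin d)) :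
    semigroupSymbol v (S * S) s ξ = wave (s • v) ξ * ∏ k, Complex.exp (-Real.pi *
      ((inner ℝ (Real.sqrt (4 * Real.pi * s) • rowVec S k) ξ : ℝ) : ℂ) ^ 2) := by
  rw [semigroupSymbol, ← Complex.exp_sum, wave, ← Complex.exp_add, opSymbol, quadForm_sq hS]
  congr 1
  have h : ((Real.sqrt (4 * Real.pi * s) : ℝ) : ℂ) ^ 2 = 4 * Real.pi * s := by
    rw [← Complex.ofReal_pow, Real.sq_sqrt (by positivity)]; push_cast; ring
  simp only [real_inner_smul_left, Complex.ofReal_mul, mul_pow, h]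
  push_cast
  rw [mul_sub, Finset.mul_sum, Finset.mul_sum, sub_eq_add_neg, ← Finset.sum_neg_distrib]
  congr 1
  · ring
  · exact Finset.sum_congr rfl fun k _ => by ring

lemma supMult_semigroupSymbol (v : EuclideanSpace ℝ (Fin d)) {S : Matrix (Fin d) (Fin d) ℝ}
    (hS : S.IsSymm) {s : ℝ} (hs : 0 ≤ s) : SupMult (semigroupSymbol v (S * S) s) 1 := by
  have := (supMult_wave (s • v)).mul (SupMult.prod Finset.univ fun k (_ : k ∈ Finset.univ) =>
    supMult_gauss (Real.sqrt (4 * Real.pi * s) • rowVec S k))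
  rw [one_mul] at this
  exact this.congr (semigroupSymbol_eq_prod v hS hs)

/-- Parabolic smoothing in the direction of a row of σ: the `k`-th Gaussian factor absorbs the
derivative along row `k` at the cost s^(-1/2), and the other factors stay contractions. No
ellipticity is needed because only σ-directional derivatives are controlled. -/
lemma supMult_inner_mul_semigroupSymbol {C : ℝ}
    (hC : ∀ l : EuclideanSpace ℝ (Fin d), SupMult (oddGauss l) C)
    (v : EuclideanSpace ℝ (Fin d)) {S : Matrix (Fin d) (Fin d) ℝ}
    (hS : S.IsSymm) {s : ℝ} (hs : 0 < s) (k : Fin d) :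
    SupMult (fun ξ => ((inner ℝ (rowVec S k) ξ : ℝ) : ℂ) * semigroupSymbol v (S * S) s ξ)
      ((Real.sqrt (4 * Real.pi * s))⁻¹ * C) := by
  classical
  set r := Real.sqrt (4 * Real.pi * s) with hr
  have hr0 : 0 < r := Real.sqrt_pos.2 (by positivity)
  have h1 := ((supMult_wave (s • v)).mul (SupMult.prod (Finset.univ.erase k)
    fun i (_ : i ∈ Finset.univ.erase k) => supMult_gauss (r • rowVec S i))).mul (hC (r • rowVec S k))
  have h2 := h1.const_mul ((r⁻¹ : ℝ) : ℂ)
  have e : ‖((r⁻¹ : ℝ) : ℂ)‖ * (1 * 1 * C) = r⁻¹ * C := by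
    rw [Complex.norm_real, Real.norm_of_nonneg (by positivity)]; ring
  rw [e] at h2
  refine h2.congr fun ξ => ?_
  rw [semigroupSymbol_eq_prod v hS hs.le, ← Finset.mul_prod_erase _ _ (Finset.mem_univ k), oddGauss,
    ← hr]
  have hr1 : (r : ℂ) ≠ 0 := by exact_mod_cast hr0.ne'
  have hl : ((inner ℝ (r • rowVec S k) ξ : ℝ) : ℂ) = r * ((inner ℝ (rowVec S k) ξ : ℝ) : ℂ) := by
    rw [real_inner_smul_left]; push_cast; ring
  generalize (∏ x ∈ Finset.univ.erase k,
    Complex.exp (-Real.pi * ((inner ℝ (r • rowVec S x) ξ : ℝ) : ℂ) ^ 2)) = q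
  rw [hl]
  push_cast
  field_simp

lemma exists_supMult_oddGauss (d : ℕ) :
    ∃ C : ℝ, 0 ≤ C ∧ ∀ l : EuclideanSpace ℝ (Fin d), SupMult (oddGauss l) C := by
  obtain ⟨C, hC, h⟩ := exists_supMult_mul_gauss.{0}
  exact ⟨C, hC, fun l => h _ l⟩

/-- Here the symbol is the derivative of z exp(-πz²). It equals exp(-πz²) - 4π (w exp(-πw²))² with w
= z/√2, so products of known multipliers suffice. -/
lemma supMult_deriv_oddGauss {C : ℝ}
    (hC : ∀ l : EuclideanSpace ℝ (Fin d), SupMult (oddGauss l) C) (l : EuclideanSpace ℝ (Fin d)) :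
    SupMult (fun ξ => (1 - 2 * Real.pi * ((inner ℝ l ξ : ℝ) : ℂ) ^ 2) *
      Complex.exp (-Real.pi * ((inner ℝ l ξ : ℝ) : ℂ) ^ 2)) (1 + 4 * Real.pi * (C * C)) := by
  have h := (supMult_gauss l).add
    (((hC ((Real.sqrt 2)⁻¹ • l)).mul (hC ((Real.sqrt 2)⁻¹ • l))).const_mul (-4 * Real.pi : ℂ))
  have e : ‖(-4 * Real.pi : ℂ)‖ = 4 * Real.pi := by
    simp [Real.pi_pos.le]
  rw [e] at h
  refine h.congr fun ξ => ?_
  have h2 : (((Real.sqrt 2)⁻¹ : ℝ) : ℂ) ^ 2 = 1 / 2 := by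
    rw [← Complex.ofReal_pow, inv_pow, Real.sq_sqrt (by norm_num)]; push_cast; ring
  have h3 : ((inner ℝ ((Real.sqrt 2)⁻¹ • l) ξ : ℝ) : ℂ) ^ 2 = ((inner ℝ l ξ : ℝ) : ℂ) ^ 2 / 2 := by
    rw [real_inner_smul_left, Complex.ofReal_mul, mul_pow, h2]; ring
  have h4 : oddGauss ((Real.sqrt 2)⁻¹ • l) ξ * oddGauss ((Real.sqrt 2)⁻¹ • l) ξ
      = ((inner ℝ l ξ : ℝ) : ℂ) ^ 2 / 2 * Complex.exp (-Real.pi * ((inner ℝ l ξ : ℝ) : ℂ) ^ 2) := by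
    rw [oddGauss, mul_mul_mul_comm, ← sq, h3, ← Complex.exp_add]
    congr 2; ring
  rw [h4]; ring

/-- Mean value inequality on the segment from `l'` to `l`; the multiplier bound of the derivative
does not depend on the point of the segment. -/
lemma norm_synth_oddGauss_sub_le {C : ℝ}
    (hC : ∀ l : EuclideanSpace ℝ (Fin d), SupMult (oddGauss l) C)
    {μ : EuclideanSpace ℝ (Fin d) → ℂ} (hμ : Integrable μ) {R : ℝ}
    (hR : ∀ ξ, R < ‖ξ‖ → μ ξ = 0) (l l' : EuclideanSpace ℝ (Fin d)) {D : ℝ}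
    (hD : ∀ x, ‖synth (fun ξ => ((inner ℝ (l - l') ξ : ℝ) : ℂ) * μ ξ) x‖ ≤ D)
    (x : EuclideanSpace ℝ (Fin d)) :
    ‖synth (fun ξ => (oddGauss l ξ - oddGauss l' ξ) * μ ξ) x‖ ≤ (1 + 4 * Real.pi * (C * C)) * D := by
  have hi : Integrable fun ξ => ((inner ℝ (l - l') ξ : ℝ) : ℂ) * μ ξ := by
    have := integrable_mul_of_continuous hμ (isCompact_closedBall (0 : EuclideanSpace ℝ (Fin d)) R)
      (fun ξ hξ => hR ξ (by simpa using hξ))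
      (by fun_prop : Continuous fun ξ => ((inner ℝ (l - l') ξ : ℝ) : ℂ))
    simpa [mul_comm] using this
  have key := norm_synth_sub_le hμ hR (m := fun s ξ => oddGauss (l' + s • (l - l')) ξ)
    (m' := fun s ξ => ((1 - 2 * Real.pi * ((inner ℝ (l' + s • (l - l')) ξ : ℝ) : ℂ) ^ 2) *
      Complex.exp (-Real.pi * ((inner ℝ (l' + s • (l - l')) ξ : ℝ) : ℂ) ^ 2)) *
      ((inner ℝ (l - l') ξ : ℝ) : ℂ)) (by unfold oddGauss Function.uncurry; fun_prop)
    (by unfold Function.uncurry; fun_prop) (fun s ξ => ?_) (D := (1 + 4 * Real.pi * (C * C)) * D) x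
    (fun s _ => ?_)
  · simpa using key
  · have h1 : HasDerivAt (fun r : ℝ => ((inner ℝ (l' + r • (l - l')) ξ : ℝ) : ℂ))
        ((inner ℝ (l - l') ξ : ℝ) : ℂ) s := by
      have : (fun r : ℝ => inner ℝ (l' + r • (l - l')) ξ)
          = fun r : ℝ => inner ℝ l' ξ + r * inner ℝ (l - l') ξ := by
        ext r; rw [inner_add_left, real_inner_smul_left]
      have h := ((hasDerivAt_id s).mul_const (inner ℝ (l - l') ξ)).const_add (inner ℝ l' ξ)
      simp only [id, one_mul] at h
      rw [← this] at h
      exact h.ofReal_comp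
    have h2 := h1.mul (((h1.pow 2).const_mul (-Real.pi : ℂ)).cexp)
    refine h2.congr_deriv ?_
    simp only [Pi.pow_apply]
    ring
  · simp only [mul_assoc _ ((inner ℝ (l - l') _ : ℝ) : ℂ)]
    exact (supMult_deriv_oddGauss hC _).bound _ hi _ hD x

/-- The interpolation is between generators, not between square roots. Thus only differences of f
and a appear, which are Lipschitz in λ, while σ is merely measurable. -/
lemma norm_synth_semigroupSymbol_sub_le {μ : EuclideanSpace ℝ (Fin d) → ℂ} (hμ : Integrable μ)
    {R : ℝ} (hR : ∀ ξ, R < ‖ξ‖ → μ ξ = 0) (v v' : EuclideanSpace ℝ (Fin d))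
    {S S' : Matrix (Fin d) (Fin d) ℝ} (hS : S.IsSymm) (hS' : S'.IsSymm) {s : ℝ} (hs : 0 ≤ s)
    {D : ℝ} (hD : ∀ x, ‖synth (fun ξ => (opSymbol v (S * S) ξ - opSymbol v' (S' * S') ξ) * μ ξ) x‖
      ≤ D) (x : EuclideanSpace ℝ (Fin d)) :
    ‖synth (fun ξ => (semigroupSymbol v (S * S) s ξ - semigroupSymbol v' (S' * S') s ξ) * μ ξ) x‖
      ≤ s * D := by
  set p := opSymbol v (S * S) with hp
  set p' := opSymbol v' (S' * S') with hp'
  have hpc : Continuous p := continuous_opSymbol _ _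
  have hpc' : Continuous p' := continuous_opSymbol _ _
  have hi : Integrable fun ξ => (p ξ - p' ξ) * μ ξ := by
    have := integrable_mul_of_continuous hμ (isCompact_closedBall (0 : EuclideanSpace ℝ (Fin d)) R)
      (fun ξ hξ => hR ξ (by simpa using hξ)) (hpc.sub hpc')
    simpa [mul_comm] using this
  have key := norm_synth_sub_le hμ hR
    (m := fun r ξ => Complex.exp (s * (p' ξ + r * (p ξ - p' ξ))))
    (m' := fun r ξ => s * (Complex.exp (s * (p' ξ + r * (p ξ - p' ξ))) * (p ξ - p' ξ)))
    (by unfold Function.uncurry; fun_prop)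
    (by unfold Function.uncurry; fun_prop) (fun r ξ => ?_) (D := s * D) x (fun r hr => ?_)
  · simpa [semigroupSymbol] using key
  · have h1 : HasDerivAt (fun r : ℝ => (s : ℂ) * (p' ξ + r * (p ξ - p' ξ)))
        (s * (p ξ - p' ξ)) r := by
      have := ((((hasDerivAt_id r).ofReal_comp).mul_const (p ξ - p' ξ)).const_add (p' ξ)).const_mul
        (s : ℂ)
      simpa using this
    convert h1.cexp using 1
    ring
  -- An intermediate symbol is the product of the two semigroups at the times s r and s (1 - r),
  -- both nonnegative, hence still a contraction.
  · have hm : SupMult (fun ξ => Complex.exp (s * (p' ξ + r * (p ξ - p' ξ)))) 1 := by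
      have h := (supMult_semigroupSymbol v hS (mul_nonneg hs hr.1)).mul
        (supMult_semigroupSymbol v' hS' (mul_nonneg hs (sub_nonneg.2 hr.2)))
      rw [one_mul] at h
      refine h.congr fun ξ => ?_
      rw [semigroupSymbol, semigroupSymbol, ← Complex.exp_add, ← hp, ← hp']
      congr 1; push_cast; ring
    have e : (fun ξ => (s : ℂ) * (Complex.exp (s * (p' ξ + r * (p ξ - p' ξ))) * (p ξ - p' ξ)) * μ ξ)
        = fun ξ => (s : ℂ) * (Complex.exp (s * (p' ξ + r * (p ξ - p' ξ))) * ((p ξ - p' ξ) * μ ξ)) := by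
      ext ξ; ring
    rw [e, synth_const_mul, norm_mul, Complex.norm_real, Real.norm_of_nonneg hs]
    refine mul_le_mul_of_nonneg_left ?_ hs
    simpa using hm.bound _ hi _ hD x

/-- Amplitudes localised in the frequency shell `J ≤ ‖ξ‖ ≤ 4 J`, normalised in the sup norm together
with their derivatives up to order two, and in `L²`. -/
structure IsBand (μ : EuclideanSpace ℝ (Fin d) → ℂ) (J : ℝ) : Prop where
  int : Integrable μ
  supp : ∀ ξ, 4 * J < ‖ξ‖ → μ ξ = 0
  low : ∀ ξ, ‖ξ‖ < J → μ ξ = 0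
  sup_le : ∀ x, ‖synth μ x‖ ≤ 1
  sup_one_le : ∀ j x, ‖synth (fun ξ => (ξ j : ℂ) * μ ξ) x‖ ≤ J
  sup_two_le : ∀ i j x, ‖synth (fun ξ => (ξ i : ℂ) * ((ξ j : ℂ) * μ ξ)) x‖ ≤ J ^ 2
  sq_le : ∫⁻ ξ, ‖μ ξ‖ₑ ^ 2 ≤ 1

lemma IsBand.integrable_mul {μ : EuclideanSpace ℝ (Fin d) → ℂ} {J : ℝ} (h : IsBand μ J)
    {g : EuclideanSpace ℝ (Fin d) → ℂ} (hg : Continuous g) : Integrable fun ξ => g ξ * μ ξ := by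
  have := integrable_mul_of_continuous h.int
    (isCompact_closedBall (0 : EuclideanSpace ℝ (Fin d)) (4 * J))
    (fun ξ hξ => h.supp ξ (by simpa using hξ)) hg
  simpa [mul_comm] using this

lemma IsBand.norm_synth_inner_le {μ : EuclideanSpace ℝ (Fin d) → ℂ} {J : ℝ} (h : IsBand μ J)
    (v : EuclideanSpace ℝ (Fin d)) (x : EuclideanSpace ℝ (Fin d)) :
    ‖synth (fun ξ => ((inner ℝ v ξ : ℝ) : ℂ) * μ ξ) x‖ ≤ (∑ j, |v j|) * J := by
  have e : (fun ξ => ((inner ℝ v ξ : ℝ) : ℂ) * μ ξ)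
      = fun ξ => ∑ j, (v j : ℂ) * ((ξ j : ℂ) * μ ξ) := by
    ext ξ
    rw [inner_eq_sum]; push_cast; rw [Finset.sum_mul]
    exact Finset.sum_congr rfl fun j _ => by ring
  rw [e, synth_finset_sum _ fun j _ => (h.integrable_mul (by fun_prop)).const_mul _, Finset.sum_mul]
  refine (norm_sum_le _ _).trans (Finset.sum_le_sum fun j _ => ?_)
  rw [synth_const_mul, norm_mul, Complex.norm_real]
  exact mul_le_mul_of_nonneg_left (h.sup_one_le j x) (norm_nonneg _)

lemma IsBand.norm_synth_quadForm_le {μ : EuclideanSpace ℝ (Fin d) → ℂ} {J : ℝ} (h : IsBand μ J)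
    (A : Matrix (Fin d) (Fin d) ℝ) (x : EuclideanSpace ℝ (Fin d)) :
    ‖synth (fun ξ => (quadForm A ξ : ℂ) * μ ξ) x‖ ≤ (∑ k, ∑ j, |A k j|) * J ^ 2 := by
  have hi : ∀ j k : Fin d, Integrable fun ξ => (A k j : ℂ) * ((ξ j : ℂ) * ((ξ k : ℂ) * μ ξ)) := by
    intro j k
    have := (h.integrable_mul (g := fun ξ => (ξ j : ℂ) * (ξ k : ℂ)) (by fun_prop)).const_mul
      (A k j : ℂ)
    simpa only [mul_assoc] using this
  have e : (fun ξ => (quadForm A ξ : ℂ) * μ ξ)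
      = fun ξ => ∑ k, ∑ j, (A k j : ℂ) * ((ξ j : ℂ) * ((ξ k : ℂ) * μ ξ)) := by
    ext ξ
    rw [quadForm]; push_cast; rw [Finset.sum_mul]
    refine Finset.sum_congr rfl fun k _ => ?_
    rw [Finset.sum_mul]
    exact Finset.sum_congr rfl fun j _ => by ring
  rw [e, synth_finset_sum _ fun k _ => integrable_finsetSum _ fun j _ => hi j k, Finset.sum_mul]
  refine (norm_sum_le _ _).trans (Finset.sum_le_sum fun k _ => ?_)
  rw [synth_finset_sum _ fun j _ => hi j k, Finset.sum_mul]
  refine (norm_sum_le _ _).trans (Finset.sum_le_sum fun j _ => ?_)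
  rw [synth_const_mul, norm_mul, Complex.norm_real]
  exact mul_le_mul_of_nonneg_left (h.sup_two_le j k x) (norm_nonneg _)

lemma IsBand.norm_synth_opSymbol_sub_le {μ : EuclideanSpace ℝ (Fin d) → ℂ} {J : ℝ}
    (h : IsBand μ J) (v v' : EuclideanSpace ℝ (Fin d)) (A A' : Matrix (Fin d) (Fin d) ℝ)
    (x : EuclideanSpace ℝ (Fin d)) :
    ‖synth (fun ξ => (opSymbol v A ξ - opSymbol v' A' ξ) * μ ξ) x‖
      ≤ 2 * Real.pi * ((∑ j, |v j - v' j|) * J)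
        + 4 * Real.pi ^ 2 * ((∑ k, ∑ j, |A k j - A' k j|) * J ^ 2) := by
  have e : (fun ξ => (opSymbol v A ξ - opSymbol v' A' ξ) * μ ξ)
      = fun ξ => (2 * Real.pi * Complex.I) * (((inner ℝ (v - v') ξ : ℝ) : ℂ) * μ ξ)
        + (-(4 * Real.pi ^ 2 : ℂ)) * ((quadForm (A - A') ξ : ℂ) * μ ξ) := by
    ext ξ
    have : quadForm (A - A') ξ = quadForm A ξ - quadForm A' ξ := by
      simp only [quadForm, Matrix.sub_apply, sub_mul, Finset.sum_sub_distrib]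
    rw [this, inner_sub_left, opSymbol, opSymbol]; push_cast; ring
  have hi1 := (h.integrable_mul (g := fun ξ => ((inner ℝ (v - v') ξ : ℝ) : ℂ))
    (by fun_prop)).const_mul (2 * Real.pi * Complex.I)
  have hi2 := (h.integrable_mul (g := fun ξ => (quadForm (A - A') ξ : ℂ))
    (Complex.continuous_ofReal.comp (continuous_quadForm _))).const_mul (-(4 * Real.pi ^ 2 : ℂ))
  rw [e, synth_add hi1 hi2, synth_const_mul, synth_const_mul]
  refine (norm_add_le _ _).trans (add_le_add ?_ ?_)
  · rw [norm_mul]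
    have : ‖(2 * Real.pi * Complex.I : ℂ)‖ = 2 * Real.pi := by simp [Real.pi_pos.le]
    rw [this]
    exact mul_le_mul_of_nonneg_left (h.norm_synth_inner_le (v - v') x) (by positivity)
  · rw [norm_mul]
    have : ‖(-(4 * Real.pi ^ 2) : ℂ)‖ = 4 * Real.pi ^ 2 := by simp
    rw [this]
    exact mul_le_mul_of_nonneg_left (h.norm_synth_quadForm_le (A - A') x) (by positivity)

end Symbols

/-! ### Mollification of test functions -/

section Mollify

lemma isAddHaarMeasure_volume_prod (d : ℕ) :
    (volume : Measure (EuclideanSpace ℝ (Fin d) × ℝ)).IsAddHaarMeasure := by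
  rw [Measure.volume_eq_prod]; infer_instance

attribute [instance] isAddHaarMeasure_volume_prod

variable {G : Type*} [NormedAddCommGroup G] [NormedSpace ℝ G] [FiniteDimensional ℝ G]
  [MeasureSpace G] [BorelSpace G] [(volume : Measure G).IsAddHaarMeasure]

/-- Regularisation of `g` by convolution with a smooth bump. -/
noncomputable def mollify (k : ContDiffBump (0 : G)) (g : G → ℝ) (p : G) : ℝ :=
  ∫ w, k.normed volume w * g (p - w)

omit [BorelSpace G] [(volume : Measure G).IsAddHaarMeasure] in
lemma mollify_eq_convolution (k : ContDiffBump (0 : G)) (g : G → ℝ) :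
    mollify k g = convolution (k.normed volume) g (ContinuousLinearMap.lsmul ℝ ℝ) volume := by
  ext p; simp [mollify, convolution]

lemma integrable_mollify (k : ContDiffBump (0 : G)) {g : G → ℝ} (hg : Continuous g) {B : ℝ}
    (hB : ∀ p, |g p| ≤ B) (p : G) : Integrable fun w => k.normed volume w * g (p - w) :=
  k.integrable_normed.mul_bdd (c := B) (by fun_prop) (ae_of_all _ fun w => hB _)

lemma abs_mollify_le (k : ContDiffBump (0 : G)) {g : G → ℝ} {B : ℝ}
    (hB : ∀ p, |g p| ≤ B) (p : G) : |mollify k g p| ≤ B := by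
  have h : ∫ w, k.normed volume w * B = B := by
    rw [integral_mul_const, k.integral_normed, one_mul]
  rw [← h]
  refine norm_integral_le_of_norm_le (f := fun w => k.normed volume w * g (p - w))
    (k.integrable_normed.mul_const B) (ae_of_all _ fun w => ?_)
  rw [norm_mul, Real.norm_of_nonneg (k.nonneg_normed w)]
  exact mul_le_mul_of_nonneg_left (hB _) (k.nonneg_normed w)

/-- Averaging against a probability density preserves increments; this carries the Lipschitz
constant in λ over to the smooth approximations. -/
lemma abs_mollify_sub_le (k : ContDiffBump (0 : G)) {g : G → ℝ} (hg : Continuous g) {B : ℝ}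
    (hB : ∀ p, |g p| ≤ B) (v : G) {D : ℝ} (hD : ∀ p, |g (p + v) - g p| ≤ D) (p : G) :
    |mollify k g (p + v) - mollify k g p| ≤ D := by
  have : mollify k g (p + v) - mollify k g p = mollify k (fun q => g (q + v) - g q) p := by
    rw [mollify, mollify, ← integral_sub (integrable_mollify k hg hB _)
      (integrable_mollify k hg hB _), mollify]
    congr 1; ext w
    rw [← mul_sub, add_sub_right_comm]
  rw [this]
  exact abs_mollify_le k hD p

lemma mollify_eq_zero (k : ContDiffBump (0 : G)) (hk : k.rOut ≤ 1) {g : G → ℝ} {S : Set G}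
    (hg : ∀ p, p ∉ S → g p = 0) {p : G} (hp : p ∉ Metric.cthickening 1 S) :
    mollify k g p = 0 := by
  rw [mollify]
  refine integral_eq_zero_of_ae (ae_of_all _ fun w => ?_)
  by_cases hw : w ∈ Metric.closedBall (0 : G) 1
  · have : p - w ∉ S := fun h => hp (Metric.mem_cthickening_of_dist_le p (p - w) 1 S h (by
      simpa [dist_eq_norm] using hw))
    simp [hg _ this]
  · have : w ∉ Function.support (k.normed volume) := by
      rw [k.support_normed_eq]
      exact fun h => hw (Metric.ball_subset_closedBall (Metric.ball_subset_ball hk h))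
    simp [Function.notMem_support.1 this]

lemma contDiff_mollify (k : ContDiffBump (0 : G)) {g : G → ℝ} (hg : Continuous g) :
    ContDiff ℝ ∞ (mollify k g) := by
  rw [mollify_eq_convolution]
  exact k.hasCompactSupport_normed.contDiff_convolution_left _ k.contDiff_normed
    hg.locallyIntegrable

lemma hasDerivAt_mollify (k : ContDiffBump (0 : G)) {g g' : G → ℝ} (hg : Continuous g)
    (hg' : Continuous g') {B B' : ℝ} (hB : ∀ p, |g p| ≤ B) (hB' : ∀ p, |g' p| ≤ B') {v : G}
    (hd : ∀ p, HasDerivAt (fun t : ℝ => g (p + t • v)) (g' p) 0) (p : G) :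
    HasDerivAt (fun t : ℝ => mollify k g (p + t • v)) (mollify k g' p) 0 := by
  have hd' : ∀ p (t : ℝ), HasDerivAt (fun t : ℝ => g (p + t • v)) (g' (p + t • v)) t := by
    intro p t
    have h := hd (p + t • v)
    have h2 : HasDerivAt (fun r : ℝ => r - t) 1 t := (hasDerivAt_id t).sub_const t
    have h3 := HasDerivAt.comp (h := fun r : ℝ => r - t) (h₂ := fun r : ℝ => g (p + t • v + r • v))
      t (h₂' := g' (p + t • v)) (by simpa using h) h2
    rw [mul_one] at h3
    refine h3.congr_of_eventuallyEq (Filter.Eventually.of_forall fun r => ?_)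
    simp only [Function.comp]
    congr 1; module
  have key := (hasDerivAt_integral_of_dominated_loc_of_deriv_le (μ := volume)
    (F := fun (t : ℝ) w => k.normed volume w * g (p + t • v - w))
    (F' := fun (t : ℝ) w => k.normed volume w * g' (p + t • v - w)) (x₀ := 0)
    (bound := fun w => k.normed volume w * B') (s := univ) Filter.univ_mem
    (Filter.Eventually.of_forall fun t => (integrable_mollify k hg hB _).1)
    (integrable_mollify k hg hB _) (integrable_mollify k hg' hB' _).1
    (ae_of_all _ fun w t _ => ?_) (k.integrable_normed.mul_const B')
    (ae_of_all _ fun w t _ => ?_)).2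
  · simpa [mollify] using key
  · rw [norm_mul, Real.norm_of_nonneg (k.nonneg_normed w)]
    exact mul_le_mul_of_nonneg_left (hB' _) (k.nonneg_normed w)
  · have := (hd' (p - w) t).const_mul (k.normed volume w)
    simpa only [add_sub_right_comm] using this

/-- Differentiability of `g` is needed along `v` alone: the test functions are differentiable in x
but only Lipschitz in λ. -/
lemma fderiv_mollify (k : ContDiffBump (0 : G)) {g g' : G → ℝ} (hg : Continuous g)
    (hg' : Continuous g') {B B' : ℝ} (hB : ∀ p, |g p| ≤ B) (hB' : ∀ p, |g' p| ≤ B') {v : G}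
    (hd : ∀ p, HasDerivAt (fun t : ℝ => g (p + t • v)) (g' p) 0) (p : G) :
    fderiv ℝ (mollify k g) p v = mollify k g' p := by
  have h1 : DifferentiableAt ℝ (mollify k g) p :=
    (contDiff_mollify k hg).differentiable (by simp) p
  have h2 : HasLineDerivAt ℝ (mollify k g) (fderiv ℝ (mollify k g) p v) p v :=
    h1.hasFDerivAt.hasLineDerivAt v
  exact HasDerivAt.unique h2 (hasDerivAt_mollify k hg hg' hB hB' hd p)

lemma exists_mollifiers (G : Type*) [NormedAddCommGroup G] [NormedSpace ℝ G] :
    ∃ k : ℕ → ContDiffBump (0 : G), (∀ n, (k n).rOut ≤ 1) ∧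
      Filter.Tendsto (fun n => (k n).rOut) Filter.atTop (nhds 0) := by
  refine ⟨fun n => ⟨1 / (2 * ((n : ℝ) + 1)), 1 / ((n : ℝ) + 1), by positivity, ?_⟩, fun n => ?_, ?_⟩
  · exact one_div_lt_one_div_of_lt (by positivity) (by linarith [n.cast_nonneg (α := ℝ)])
  · simp only
    rw [div_le_one (by positivity)]
    linarith [n.cast_nonneg (α := ℝ)]
  · exact tendsto_one_div_add_atTop_nhds_zero_nat

lemma tendsto_mollify {k : ℕ → ContDiffBump (0 : G)}
    (hk : Filter.Tendsto (fun n => (k n).rOut) Filter.atTop (nhds 0)) {g : G → ℝ}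
    (hg : Continuous g) (p : G) :
    Filter.Tendsto (fun n => mollify (k n) g p) Filter.atTop (nhds (g p)) := by
  simp only [mollify_eq_convolution]
  exact ContDiffBump.convolution_tendsto_right_of_continuous hk hg p

lemma tendsto_integral_mul_mollify {k : ℕ → ContDiffBump (0 : G)} (hk1 : ∀ n, (k n).rOut ≤ 1)
    (hk : Filter.Tendsto (fun n => (k n).rOut) Filter.atTop (nhds 0)) {g : G → ℝ}
    (hg : Continuous g) {S : Set G} (hS : IsCompact S) (hgS : ∀ p, p ∉ S → g p = 0)
    {B : ℝ} (hB : ∀ p, |g p| ≤ B) {H : G → ℝ} (hH : LocallyIntegrable H) :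
    Filter.Tendsto (fun n => ∫ p, H p * mollify (k n) g p) Filter.atTop (nhds (∫ p, H p * g p)) := by
  have hS' : IsCompact (Metric.cthickening 1 S) := hS.cthickening
  refine tendsto_integral_of_dominated_convergence
    ((Metric.cthickening 1 S).indicator fun p => ‖H p‖ * B) (fun n => ?_) ?_ (fun n => ?_)
    (ae_of_all _ fun p => (tendsto_mollify hk hg p).const_mul _)
  · exact hH.aestronglyMeasurable.mul (contDiff_mollify _ hg).continuous.aestronglyMeasurable
  · exact (integrable_indicator_iff hS'.isClosed.measurableSet).2
      ((hH.integrableOn_isCompact hS').norm.mul_const B)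
  · refine ae_of_all _ fun p => ?_
    by_cases hp : p ∈ Metric.cthickening 1 S
    · rw [indicator_of_mem hp, norm_mul]
      exact mul_le_mul_of_nonneg_left (abs_mollify_le _ hB p) (norm_nonneg _)
    · rw [indicator_of_notMem hp, mollify_eq_zero _ (hk1 n) hgS hp]
      simp

end Mollify

/-! ### The kinetic equation and the regularity condition for test functions Lipschitz in λ -/

section KineticTest

variable {d : ℕ}

/-- A test function on `ℝ^d × ℝ` which is twice continuously differentiable in `x` only; `Ψ₁` and
`Ψ₂` are its partial derivatives in `x`, and everything vanishes outside `S`. -/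
structure IsKineticTest (S : Set (EuclideanSpace ℝ (Fin d) × ℝ))
    (Ψ : EuclideanSpace ℝ (Fin d) × ℝ → ℝ) (Ψ₁ : Fin d → EuclideanSpace ℝ (Fin d) × ℝ → ℝ)
    (Ψ₂ : Fin d → Fin d → EuclideanSpace ℝ (Fin d) × ℝ → ℝ) : Prop where
  cont : Continuous Ψ
  cont₁ : ∀ j, Continuous (Ψ₁ j)
  cont₂ : ∀ k j, Continuous (Ψ₂ k j)
  zero : ∀ p, p ∉ S → Ψ p = 0
  zero₁ : ∀ j p, p ∉ S → Ψ₁ j p = 0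
  zero₂ : ∀ k j p, p ∉ S → Ψ₂ k j p = 0
  deriv₁ : ∀ j p, HasDerivAt
    (fun t : ℝ => Ψ (p + t • ((EuclideanSpace.single j 1, 0) : EuclideanSpace ℝ (Fin d) × ℝ)))
    (Ψ₁ j p) 0
  deriv₂ : ∀ k j p, HasDerivAt
    (fun t : ℝ => Ψ₁ j (p + t • ((EuclideanSpace.single k 1, 0) : EuclideanSpace ℝ (Fin d) × ℝ)))
    (Ψ₂ k j p) 0

lemma exists_bound_of_zero {X : Type*} [TopologicalSpace X] {S : Set X} (hS : IsCompact S)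
    {g : X → ℝ} (hg : Continuous g) (h0 : ∀ p, p ∉ S → g p = 0) : ∃ B, ∀ p, |g p| ≤ B := by
  obtain ⟨B, hB⟩ := hS.exists_bound_of_continuousOn hg.continuousOn
  refine ⟨max B 0, fun p => ?_⟩
  by_cases hp : p ∈ S
  · exact (hB p hp).trans (le_max_left _ _)
  · rw [h0 p hp, abs_zero]; exact le_max_right _ _

variable {S : Set (EuclideanSpace ℝ (Fin d) × ℝ)} {Ψ : EuclideanSpace ℝ (Fin d) × ℝ → ℝ}
  {Ψ₁ : Fin d → EuclideanSpace ℝ (Fin d) × ℝ → ℝ}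
  {Ψ₂ : Fin d → Fin d → EuclideanSpace ℝ (Fin d) × ℝ → ℝ}

lemma IsKineticTest.partialX_mollify (h : IsKineticTest S Ψ Ψ₁ Ψ₂) (hS : IsCompact S)
    (k : ContDiffBump (0 : EuclideanSpace ℝ (Fin d) × ℝ)) (j : Fin d) :
    partialX j (mollify k Ψ) = mollify k (Ψ₁ j) := by
  obtain ⟨B, hB⟩ := exists_bound_of_zero hS h.cont h.zero
  obtain ⟨B', hB'⟩ := exists_bound_of_zero hS (h.cont₁ j) (h.zero₁ j)
  ext p
  exact fderiv_mollify k h.cont (h.cont₁ j) hB hB' (h.deriv₁ j) p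

lemma IsKineticTest.partialX_partialX_mollify (h : IsKineticTest S Ψ Ψ₁ Ψ₂) (hS : IsCompact S)
    (k : ContDiffBump (0 : EuclideanSpace ℝ (Fin d) × ℝ)) (i j : Fin d) :
    partialX i (partialX j (mollify k Ψ)) = mollify k (Ψ₂ i j) := by
  obtain ⟨B, hB⟩ := exists_bound_of_zero hS (h.cont₁ j) (h.zero₁ j)
  obtain ⟨B', hB'⟩ := exists_bound_of_zero hS (h.cont₂ i j) (h.zero₂ i j)
  rw [h.partialX_mollify hS]
  ext p
  exact fderiv_mollify k (h.cont₁ j) (h.cont₂ i j) hB hB' (h.deriv₂ i j) p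

lemma IsKineticTest.isTestFunction_mollify (h : IsKineticTest S Ψ Ψ₁ Ψ₂) (hS : IsCompact S)
    {k : ContDiffBump (0 : EuclideanSpace ℝ (Fin d) × ℝ)} (hk : k.rOut ≤ 1) :
    IsTestFunction (mollify k Ψ) :=
  ⟨contDiff_mollify k h.cont, HasCompactSupport.intro hS.cthickening
    fun _ hp => mollify_eq_zero k hk h.zero hp⟩

lemma measurable_sign : Measurable Real.sign := by
  have : Real.sign = fun r : ℝ => if r < 0 then -1 else if 0 < r then 1 else 0 := by
    ext r; rfl
  rw [this]
  exact Measurable.ite measurableSet_Iio measurable_const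
    (Measurable.ite measurableSet_Ioi measurable_const measurable_const)

lemma abs_kineticFun_le (u : EuclideanSpace ℝ (Fin d) → ℝ) (p : EuclideanSpace ℝ (Fin d) × ℝ) :
    |kineticFun u p| ≤ 1 := by
  unfold kineticFun
  rcases Real.sign_apply_eq (u p.1 - p.2) with h | h | h <;> rw [h] <;> norm_num

lemma aestronglyMeasurable_kineticFun {u : EuclideanSpace ℝ (Fin d) → ℝ}
    (hu : AEStronglyMeasurable u) : AEStronglyMeasurable (kineticFun u) := by
  have h1 : AEMeasurable (fun p : EuclideanSpace ℝ (Fin d) × ℝ => u p.1 - p.2) := by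
    have : AEStronglyMeasurable (fun p : EuclideanSpace ℝ (Fin d) × ℝ => u p.1)
        (volume.prod volume) := hu.comp_fst
    rw [Measure.volume_eq_prod]
    exact this.aemeasurable.sub measurable_snd.aemeasurable
  exact (measurable_sign.comp_aemeasurable h1).aestronglyMeasurable

lemma locallyIntegrable_kineticFun_mul {u : EuclideanSpace ℝ (Fin d) → ℝ}
    (hu : AEStronglyMeasurable u) {g : ℝ → ℝ} (hg : Continuous g) :
    LocallyIntegrable fun p => kineticFun u p * g p.2 := by
  have h : LocallyIntegrable (fun p : EuclideanSpace ℝ (Fin d) × ℝ => g p.2) :=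
    (hg.comp continuous_snd).locallyIntegrable
  refine h.mono ((aestronglyMeasurable_kineticFun hu).mul h.aestronglyMeasurable)
    (ae_of_all _ fun p => ?_)
  rw [norm_mul]
  exact mul_le_of_le_one_left (norm_nonneg _) (abs_kineticFun_le u p)

lemma integrable_kineticFun_mul {u : EuclideanSpace ℝ (Fin d) → ℝ}
    (hu : AEStronglyMeasurable u) {Φ : EuclideanSpace ℝ (Fin d) × ℝ → ℝ} (hΦ : Continuous Φ)
    (hS : IsCompact S) (h0 : ∀ p, p ∉ S → Φ p = 0) :
    Integrable fun p => kineticFun u p * Φ p :=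
  (hΦ.integrable_of_hasCompactSupport (HasCompactSupport.intro hS h0)).bdd_mul
    (aestronglyMeasurable_kineticFun hu) (ae_of_all _ fun p => abs_kineticFun_le u p)

lemma tendsto_integral_kineticFun_mollify {u : EuclideanSpace ℝ (Fin d) → ℝ}
    (hu : AEStronglyMeasurable u) (hS : IsCompact S)
    {k : ℕ → ContDiffBump (0 : EuclideanSpace ℝ (Fin d) × ℝ)} (hk1 : ∀ n, (k n).rOut ≤ 1)
    (hk : Filter.Tendsto (fun n => (k n).rOut) Filter.atTop (nhds 0))
    {ι : Type*} [Fintype ι] {c : ι → ℝ → ℝ} (hc : ∀ i, Continuous (c i))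
    {g : ι → EuclideanSpace ℝ (Fin d) × ℝ → ℝ} (hg : ∀ i, Continuous (g i))
    (h0 : ∀ i p, p ∉ S → g i p = 0) :
    Filter.Tendsto (fun n => ∫ p, kineticFun u p * ∑ i, c i p.2 * mollify (k n) (g i) p)
      Filter.atTop (nhds (∫ p, kineticFun u p * ∑ i, c i p.2 * g i p)) := by
  have hS' : IsCompact (Metric.cthickening 1 S) := hS.cthickening
  have e1 : ∫ p, kineticFun u p * ∑ i, c i p.2 * g i p
      = ∑ i, ∫ p, kineticFun u p * c i p.2 * g i p := by
    rw [← integral_finsetSum]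
    · congr 1; ext p; rw [Finset.mul_sum]; exact Finset.sum_congr rfl fun i _ => by ring
    · intro i _
      have := integrable_kineticFun_mul hu (((hc i).comp continuous_snd).mul (hg i)) hS
        (fun p hp => by simp [h0 i p hp])
      simpa [mul_assoc] using this
  have e2 : ∀ n, ∫ p, kineticFun u p * ∑ i, c i p.2 * mollify (k n) (g i) p
      = ∑ i, ∫ p, kineticFun u p * c i p.2 * mollify (k n) (g i) p := by
    intro n
    rw [← integral_finsetSum]
    · congr 1; ext p; rw [Finset.mul_sum]; exact Finset.sum_congr rfl fun i _ => by ring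
    · intro i _
      have := integrable_kineticFun_mul hu (((hc i).comp continuous_snd).mul
        (contDiff_mollify (k n) (hg i)).continuous) hS'
        (fun p hp => by simp [mollify_eq_zero (k n) (hk1 n) (h0 i) hp])
      simpa [mul_assoc] using this
  rw [e1]
  simp only [e2]
  refine tendsto_finsetSum _ fun i _ => ?_
  obtain ⟨B, hB⟩ := exists_bound_of_zero hS (hg i) (h0 i)
  exact tendsto_integral_mul_mollify hk1 hk (hg i) hS (h0 i) hB
    (locallyIntegrable_kineticFun_mul hu (hc i))

/-- The mollified test functions are admissible in the kinetic equation. Their λ-derivatives are at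
most Λ and supported in the 1-neighbourhood of `S`, so their integral against ζ is bounded
independently of the mollification, while the terms with h converge. -/
lemma IsKineticTest.abs_integral_le (h : IsKineticTest S Ψ Ψ₁ Ψ₂) (hS : IsCompact S)
    {𝔣 : ℝ → EuclideanSpace ℝ (Fin d)} {a : ℝ → Matrix (Fin d) (Fin d) ℝ}
    {u : EuclideanSpace ℝ (Fin d) → ℝ} (hu : AEStronglyMeasurable u)
    (h𝔣 : Continuous (deriv 𝔣)) (ha : ∀ i j, Continuous fun l => a l i j)
    {κ : ℝ} (hκ : κ = 1 ∨ κ = -1) {ζ : Measure (EuclideanSpace ℝ (Fin d) × ℝ)}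
    (hζ : IsFiniteMeasureOnCompacts ζ) (hkin : KineticEquation 𝔣 a u κ ζ)
    {Λ : ℝ} (hΛ0 : 0 ≤ Λ) (hΛ : ∀ x l l', |Ψ (x, l) - Ψ (x, l')| ≤ Λ * |l - l'|) :
    |(∫ p, kineticFun u p * ∑ j, deriv 𝔣 p.2 j * Ψ₁ j p)
      + ∫ p, kineticFun u p * ∑ k, ∑ j, a p.2 k j * Ψ₂ j k p|
      ≤ ζ.real (Metric.cthickening 1 S) * Λ := by
  have hS' : IsCompact (Metric.cthickening 1 S) := hS.cthickening
  obtain ⟨k, hk1, hk⟩ := exists_mollifiers (EuclideanSpace ℝ (Fin d) × ℝ)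
  have t1 := tendsto_integral_kineticFun_mollify hu hS hk1 hk
    (c := fun j l => deriv 𝔣 l j) (fun j => by fun_prop) h.cont₁ h.zero₁
  have t2 := tendsto_integral_kineticFun_mollify hu hS hk1 hk (ι := Fin d × Fin d)
    (c := fun i l => a l i.1 i.2) (fun i => ha _ _) (g := fun i => Ψ₂ i.2 i.1)
    (fun i => h.cont₂ _ _) (fun i => h.zero₂ _ _)
  simp only [Fintype.sum_prod_type] at t2
  refine le_of_tendsto (t1.add t2).abs (Filter.Eventually.of_forall fun n => ?_)
  have e := hkin _ (h.isTestFunction_mollify hS (hk1 n))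
  simp only [h.partialX_mollify hS, ← h.partialX_partialX_mollify hS] at e ⊢
  have e' : (∫ p, kineticFun u p * ∑ j, deriv 𝔣 p.2 j * mollify (k n) (Ψ₁ j) p)
      + ∫ p, kineticFun u p * ∑ k_1, ∑ j, a p.2 k_1 j * partialX j (mollify (k n) (Ψ₁ k_1)) p
      = -(κ * ∫ p, partialLam (mollify (k n) Ψ) p ∂ζ) := by
    linarith
  rw [e', abs_neg, abs_mul, show |κ| = 1 by rcases hκ with h | h <;> simp [h], one_mul]
  obtain ⟨B, hB⟩ := exists_bound_of_zero hS h.cont h.zero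
  have hlip : ∀ p, |partialLam (mollify (k n) Ψ) p| ≤ Λ := by
    intro p
    have h1 : HasFDerivAt (mollify (k n) Ψ) (fderiv ℝ (mollify (k n) Ψ) p) p :=
      ((contDiff_mollify (k n) h.cont).differentiable (by simp) p).hasFDerivAt
    have h2 : HasDerivAt (fun t : ℝ => mollify (k n) Ψ
        (p + t • ((0, 1) : EuclideanSpace ℝ (Fin d) × ℝ))) (partialLam (mollify (k n) Ψ) p) 0 :=
      h1.hasLineDerivAt _
    refine HasDerivAt.le_of_lip' h2 hΛ0 (Filter.Eventually.of_forall fun t => ?_)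
    simp only [zero_smul, add_zero, sub_zero, Real.norm_eq_abs]
    refine abs_mollify_sub_le (k n) h.cont hB _ (fun q => ?_) p
    have e : q + t • ((0, 1) : EuclideanSpace ℝ (Fin d) × ℝ) = (q.1, q.2 + t) :=
      Prod.ext (by simp) (by simp)
    rw [e]
    simpa [add_sub_cancel_left] using hΛ q.1 (q.2 + t) q.2
  have h0 : ∀ p, p ∉ Metric.cthickening 1 S → partialLam (mollify (k n) Ψ) p = 0 := by
    intro p hp
    have : mollify (k n) Ψ =ᶠ[nhds p] fun _ => 0 := by
      filter_upwards [hS'.isClosed.isOpen_compl.mem_nhds hp] with q hq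
      exact mollify_eq_zero (k n) (hk1 n) h.zero hq
    rw [partialLam, this.fderiv_eq]
    simp
  have hm := hS'.isClosed.measurableSet
  have hb : ∀ p, ‖partialLam (mollify (k n) Ψ) p‖
      ≤ (Metric.cthickening 1 S).indicator (fun _ => Λ) p := by
    intro p
    by_cases hp : p ∈ Metric.cthickening 1 S
    · rw [indicator_of_mem hp]; exact hlip p
    · rw [indicator_of_notMem hp, h0 p hp, norm_zero]
  refine (norm_integral_le_of_norm_le ?_ (ae_of_all _ hb)).trans (le_of_eq ?_)
  · exact (integrable_indicator_iff hm).2 (integrableOn_const hS'.measure_lt_top.ne)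
  · rw [integral_indicator hm, setIntegral_const, smul_eq_mul]

/-- Dominated convergence along mollifications. Only the test function is regularised; σ(u(x)) stays
as a measurable weight and needs a bound on compact sets. -/
lemma IsKineticTest.integral_regularity (h : IsKineticTest S Ψ Ψ₁ Ψ₂) (hS : IsCompact S)
    {a σ : ℝ → Matrix (Fin d) (Fin d) ℝ}
    {u : EuclideanSpace ℝ (Fin d) → ℝ} (hu : AEStronglyMeasurable u)
    (ha : ∀ i j, Continuous fun l => a l i j) (hσ : ∀ i j, Measurable fun l => σ l i j)
    (hσsymm : ∀ l, (σ l).IsSymm) (haσ : ∀ l, a l = σ l * σ l)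
    {B : Fin d → EuclideanSpace ℝ (Fin d) → ℝ} (hB : ∀ k, LocallyIntegrable (B k))
    (hreg : ∀ φ : EuclideanSpace ℝ (Fin d) × ℝ → ℝ, IsTestFunction φ →
      ∫ p, kineticFun u p * ∑ k, ∑ j, a p.2 k j * partialX k (partialX j φ) p
        = - ∫ x, ∑ k, ∑ j, 2 * B k x * (σ (u x) k j * partialX j φ (x, u x))) :
    ∫ p, kineticFun u p * ∑ k, ∑ j, a p.2 k j * Ψ₂ k j p
        = - ∫ x, ∑ k, ∑ j, 2 * B k x * (σ (u x) k j * Ψ₁ j (x, u x)) := by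
  have hS' : IsCompact (Metric.cthickening 1 S) := hS.cthickening
  set S' := Metric.cthickening 1 S with hS'def
  obtain ⟨k, hk1, hk⟩ := exists_mollifiers (EuclideanSpace ℝ (Fin d) × ℝ)
  have t2 := tendsto_integral_kineticFun_mollify hu hS hk1 hk (ι := Fin d × Fin d)
    (c := fun i l => a l i.1 i.2) (fun i => ha _ _) (g := fun i => Ψ₂ i.1 i.2)
    (fun i => h.cont₂ _ _) (fun i => h.zero₂ _ _)
  simp only [Fintype.sum_prod_type] at t2
  refine tendsto_nhds_unique t2 ?_
  have e : ∀ n, ∫ p, kineticFun u p * ∑ i, ∑ j, a p.2 i j * mollify (k n) (Ψ₂ i j) p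
      = - ∫ x, ∑ i, ∑ j, 2 * B i x * (σ (u x) i j * mollify (k n) (Ψ₁ j) (x, u x)) := by
    intro n
    have := hreg _ (h.isTestFunction_mollify hS (hk1 n))
    simp only [← h.partialX_partialX_mollify hS, ← h.partialX_mollify hS]
    exact this
  simp only [e]
  refine Filter.Tendsto.neg ?_
  choose Q hQ using fun j => exists_bound_of_zero hS (h.cont₁ j) (h.zero₁ j)
  -- By symmetry a_ii = ∑_r σ_ir² dominates σ_ij², so the continuity of a bounds σ locally.
  have hσb : ∀ i j, ∃ M, ∀ p ∈ S', |σ p.2 i j| ≤ M := by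
    intro i j
    obtain ⟨M, hM⟩ := hS'.exists_bound_of_continuousOn ((ha i i).comp continuous_snd).continuousOn
    refine ⟨Real.sqrt M, fun p hp => Real.abs_le_sqrt ?_⟩
    refine le_trans ?_ ((le_abs_self _).trans (hM p hp))
    simp only [Function.comp, haσ, Matrix.mul_apply]
    have : ∀ r, 0 ≤ σ p.2 i r * σ p.2 r i := fun r => by
      rw [(hσsymm p.2).apply i r]; exact mul_self_nonneg _
    refine le_trans (le_of_eq ?_) (Finset.single_le_sum (fun r _ => this r) (Finset.mem_univ j))
    rw [(hσsymm p.2).apply i j, sq]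
  choose M hM using hσb
  set P : Set (EuclideanSpace ℝ (Fin d)) := Prod.fst '' S' with hP
  have hPc : IsCompact P := hS'.image continuous_fst
  have hum : AEMeasurable u := hu.aemeasurable
  have hmeas : ∀ g : EuclideanSpace ℝ (Fin d) × ℝ → ℝ, Continuous g →
      AEStronglyMeasurable (fun x => g (x, u x)) := fun g hg =>
    (hg.measurable.comp_aemeasurable (measurable_id.aemeasurable.prodMk hum)).aestronglyMeasurable
  have hmσ : ∀ i j, AEStronglyMeasurable (fun x => σ (u x) i j) := fun i j =>
    ((hσ i j).comp_aemeasurable hum).aestronglyMeasurable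
  refine tendsto_integral_of_dominated_convergence
    (P.indicator fun x => ∑ i, ∑ j, 2 * ‖B i x‖ * (M i j * Q j)) (fun n => ?_) ?_ (fun n => ?_) ?_
  · refine Finset.aestronglyMeasurable_fun_sum _ fun i _ =>
      Finset.aestronglyMeasurable_fun_sum _ fun j _ => ?_
    exact ((hB i).aestronglyMeasurable.const_mul 2).mul ((hmσ i j).mul
      (hmeas _ (contDiff_mollify _ (h.cont₁ j)).continuous))
  · refine (integrable_indicator_iff hPc.isClosed.measurableSet).2 ?_
    refine integrable_finsetSum _ fun i _ => integrable_finsetSum _ fun j _ => ?_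
    exact (((hB i).integrableOn_isCompact hPc).norm.const_mul 2).mul_const _
  · refine ae_of_all _ fun x => ?_
    by_cases hx : (x, u x) ∈ S'
    · rw [indicator_of_mem (mem_image_of_mem _ hx)]
      refine (norm_sum_le _ _).trans (Finset.sum_le_sum fun i _ => (norm_sum_le _ _).trans
        (Finset.sum_le_sum fun j _ => ?_))
      rw [norm_mul, norm_mul, norm_mul, Real.norm_of_nonneg (zero_le_two)]
      refine mul_le_mul_of_nonneg_left ?_ (by positivity)
      have h1 := hM i j _ hx
      exact mul_le_mul h1 (abs_mollify_le _ (hQ j) _) (norm_nonneg _) ((abs_nonneg _).trans h1)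
    · have : ∀ j, mollify (k n) (Ψ₁ j) (x, u x) = 0 := fun j =>
        mollify_eq_zero (k n) (hk1 n) (h.zero₁ j) hx
      simp only [this, mul_zero, Finset.sum_const_zero, norm_zero]
      refine indicator_nonneg (fun y hy => ?_) x
      obtain ⟨p, hp, rfl⟩ := hy
      refine Finset.sum_nonneg fun i _ => Finset.sum_nonneg fun j _ => ?_
      exact mul_nonneg (by positivity) (mul_nonneg ((abs_nonneg _).trans (hM i j p hp))
        ((abs_nonneg _).trans (hQ j p)))
  · refine ae_of_all _ fun x => tendsto_finsetSum _ fun i _ => tendsto_finsetSum _ fun j _ => ?_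
    exact ((tendsto_mollify hk (h.cont₁ j) _).const_mul _).const_mul _

/-- The two estimates which the kinetic equation and the regularity condition give for test
functions that are merely Lipschitz in `λ`. -/
lemma IsEntropySolution.exists_kinetic_bound {𝔣 : ℝ → EuclideanSpace ℝ (Fin d)}
    {a σ : ℝ → Matrix (Fin d) (Fin d) ℝ} {u : EuclideanSpace ℝ (Fin d) → ℝ}
    (hu : IsEntropySolution 𝔣 a σ u)
    (h𝔣 : Continuous (deriv 𝔣)) (ha : ∀ i j, Continuous fun l => a l i j)
    (hσ : ∀ i j, Measurable fun l => σ l i j)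
    (hσsymm : ∀ l, (σ l).IsSymm) (haσ : ∀ l, a l = σ l * σ l)
    (S : Set (EuclideanSpace ℝ (Fin d) × ℝ)) (hS : IsCompact S) :
    ∃ C : ℝ, 0 ≤ C ∧ ∀ Ψ Ψ₁ Ψ₂, IsKineticTest S Ψ Ψ₁ Ψ₂ → ∀ Λ : ℝ, 0 ≤ Λ →
      (∀ x l l', |Ψ (x, l) - Ψ (x, l')| ≤ Λ * |l - l'|) →
      |∫ p, kineticFun u p * (∑ j, deriv 𝔣 p.2 j * Ψ₁ j p + ∑ k, ∑ j, a p.2 k j * Ψ₂ k j p)|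
        ≤ C * Λ ∧
      ∀ Q : ℝ, 0 ≤ Q → (∀ x l k, |∑ j, σ l k j * Ψ₁ j (x, l)| ≤ Q) →
        |∫ p, kineticFun u p * ∑ j, deriv 𝔣 p.2 j * Ψ₁ j p| ≤ C * (Λ + Q) := by
  obtain ⟨hu2, -, ⟨κ, ζ, hκ, hζ, hkin⟩, B, hB, -, hreg⟩ := hu
  have hS' : IsCompact (Metric.cthickening 1 S) := hS.cthickening
  set P : Set (EuclideanSpace ℝ (Fin d)) := Prod.fst '' S with hP
  have hPc : IsCompact P := hS.image continuous_fst
  set N : ℝ := ∑ k, ∫ x in P, 2 * ‖B k x‖ with hN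
  have hN0 : 0 ≤ N := Finset.sum_nonneg fun k _ => integral_nonneg fun x => by positivity
  have hζ0 : 0 ≤ ζ.real (Metric.cthickening 1 S) := measureReal_nonneg
  refine ⟨ζ.real (Metric.cthickening 1 S) + N, by positivity, fun Ψ Ψ₁ Ψ₂ h Λ hΛ0 hΛ => ?_⟩
  have k1 := h.abs_integral_le hS hu2.1 h𝔣 ha hκ hζ.1 hkin hΛ0 hΛ
  have hsymm : ∀ l i j, a l i j = a l j i := fun l i j => by
    rw [haσ, Matrix.mul_apply, Matrix.mul_apply]
    exact Finset.sum_congr rfl fun r _ => by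
      rw [← (hσsymm l).apply i r, ← (hσsymm l).apply r j]; ring
  -- The kinetic equation and the regularity condition take the second derivatives in opposite
  -- orders; the symmetry of a reconciles them.
  have e1 : ∀ p, ∑ k, ∑ j, a p.2 k j * Ψ₂ j k p = ∑ k, ∑ j, a p.2 k j * Ψ₂ k j p := fun p => by
    rw [Finset.sum_comm]
    exact Finset.sum_congr rfl fun i _ => Finset.sum_congr rfl fun j _ => by rw [hsymm]
  simp only [e1] at k1
  have i1 : Integrable fun p => kineticFun u p * ∑ j, deriv 𝔣 p.2 j * Ψ₁ j p :=
    integrable_kineticFun_mul hu2.1 (continuous_finsetSum _ fun j _ =>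
      (by fun_prop : Continuous fun p : EuclideanSpace ℝ (Fin d) × ℝ => deriv 𝔣 p.2 j).mul
        (h.cont₁ j)) hS (fun p hp => by simp [h.zero₁ _ p hp])
  have i2 : Integrable fun p => kineticFun u p * ∑ k, ∑ j, a p.2 k j * Ψ₂ k j p :=
    integrable_kineticFun_mul hu2.1 (continuous_finsetSum _ fun i _ =>
      continuous_finsetSum _ fun j _ => ((ha i j).comp continuous_snd).mul
        (h.cont₂ i j)) hS (fun p hp => by simp [h.zero₂ _ _ p hp])
  refine ⟨?_, fun Q hQ0 hQ => ?_⟩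
  · simp only [mul_add]
    rw [integral_add i1 i2]
    exact k1.trans (mul_le_mul_of_nonneg_right (by linarith) hΛ0)
  · have k2 := h.integral_regularity hS hu2.1 ha hσ hσsymm haσ hB.2.1 hreg
    have k3 : |∫ x, ∑ k, ∑ j, 2 * B k x * (σ (u x) k j * Ψ₁ j (x, u x))| ≤ N * Q := by
      have hle : ∀ x, ‖∑ k, ∑ j, 2 * B k x * (σ (u x) k j * Ψ₁ j (x, u x))‖
          ≤ P.indicator (fun x => ∑ k, 2 * ‖B k x‖ * Q) x := by
        intro x
        by_cases hx : x ∈ P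
        · rw [indicator_of_mem hx]
          refine (norm_sum_le _ _).trans (Finset.sum_le_sum fun k _ => ?_)
          rw [← Finset.mul_sum, norm_mul, norm_mul, Real.norm_of_nonneg zero_le_two]
          exact mul_le_mul_of_nonneg_left (hQ x (u x) k) (by positivity)
        · rw [indicator_of_notMem hx]
          have : ∀ j, Ψ₁ j (x, u x) = 0 := fun j =>
            h.zero₁ j _ fun hm => hx (mem_image_of_mem _ hm)
          simp [this]
      have hint : ∀ k, IntegrableOn (fun x => 2 * ‖B k x‖ * Q) P := fun k =>
        (((hB.2.1 k).integrableOn_isCompact hPc).norm.const_mul 2).mul_const _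
      refine (norm_integral_le_of_norm_le ((integrable_indicator_iff
        hPc.isClosed.measurableSet).2 (integrable_finsetSum _ fun k _ => hint k))
        (ae_of_all _ hle)).trans (le_of_eq ?_)
      rw [integral_indicator hPc.isClosed.measurableSet, integral_finsetSum _ fun k _ => hint k,
        hN, Finset.sum_mul]
      exact Finset.sum_congr rfl fun k _ => integral_mul_const _ _
    -- The transport term alone is the full kinetic operator minus its second-order part, and the
    -- latter is an integral of B against σ∇Ψ.
    have k4 : ∫ p, kineticFun u p * ∑ j, deriv 𝔣 p.2 j * Ψ₁ j p
        = ((∫ p, kineticFun u p * ∑ j, deriv 𝔣 p.2 j * Ψ₁ j p)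
          + ∫ p, kineticFun u p * ∑ k, ∑ j, a p.2 k j * Ψ₂ k j p)
          + ∫ x, ∑ k, ∑ j, 2 * B k x * (σ (u x) k j * Ψ₁ j (x, u x)) := by
      rw [k2]; ring
    rw [k4]
    refine (abs_add_le _ _).trans ((add_le_add k1 k3).trans ?_)
    nlinarith [mul_nonneg hζ0 hQ0, mul_nonneg hN0 hΛ0]

end KineticTest

/-! ### Derivatives of plane-wave superpositions and of spatial cut-offs -/

section Spatial

variable {d : ℕ}

lemma hasDerivAt_synth_line {ν : EuclideanSpace ℝ (Fin d) → ℂ} (hν : Integrable ν) {R : ℝ}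
    (hR : ∀ ξ, R < ‖ξ‖ → ν ξ = 0) (x : EuclideanSpace ℝ (Fin d)) (j : Fin d) :
    HasDerivAt (fun t : ℝ => synth ν (x + t • EuclideanSpace.single j 1))
      (synth (fun ξ => 2 * Real.pi * Complex.I * ((ξ j : ℂ) * ν ξ)) x) 0 := by
  have hw : Continuous fun p : ℝ × EuclideanSpace ℝ (Fin d) =>
      wave (x + p.1 • EuclideanSpace.single j (1 : ℝ)) p.2 :=
    continuous_wave.comp (by fun_prop : Continuous fun p : ℝ × EuclideanSpace ℝ (Fin d) =>
      (x + p.1 • EuclideanSpace.single j (1 : ℝ), p.2))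
  have key := hasDerivAt_integral_mul hν
    (isCompact_closedBall (0 : EuclideanSpace ℝ (Fin d)) R)
    (fun ξ hξ => hR ξ (by simpa using hξ))
    (g := fun t ξ => wave (x + t • EuclideanSpace.single j 1) ξ)
    (g' := fun t ξ => 2 * Real.pi * Complex.I * (inner ℝ (EuclideanSpace.single j (1 : ℝ)) ξ : ℝ) *
      wave (x + t • EuclideanSpace.single j 1) ξ) hw
    ((by fun_prop : Continuous fun p : ℝ × EuclideanSpace ℝ (Fin d) => (2 * Real.pi * Complex.I *
      (inner ℝ (EuclideanSpace.single j (1 : ℝ)) p.2 : ℝ) : ℂ)).mul hw)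
    (fun t ξ => hasDerivAt_wave_smul x _ ξ t) 0
  refine key.congr_deriv ?_
  simp only [synth, zero_smul, add_zero, EuclideanSpace.inner_single_left, map_one, one_mul]
  congr 1; ext ξ; ring

variable {φ : EuclideanSpace ℝ (Fin d) → ℝ}

lemma contDiff_partialSpace (hφ : ContDiff ℝ ∞ φ) (j : Fin d) : ContDiff ℝ ∞ (partialSpace j φ) :=
  (hφ.fderiv_right (m := ∞) (by simp)).clm_apply contDiff_const

lemma tsupport_partialSpace_subset (j : Fin d) : tsupport (partialSpace j φ) ⊆ tsupport φ := by
  refine closure_minimal (fun x hx => ?_) (isClosed_tsupport _)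
  by_contra h
  refine hx ?_
  have : fderiv ℝ φ x = 0 := image_eq_zero_of_notMem_tsupport
    fun h' => h (tsupport_fderiv_subset ℝ h')
  simp [partialSpace, this]

lemma hasDerivAt_line (hφ : ContDiff ℝ ∞ φ) (j : Fin d) (x : EuclideanSpace ℝ (Fin d)) :
    HasDerivAt (fun t : ℝ => φ (x + t • EuclideanSpace.single j 1)) (partialSpace j φ x) 0 :=
  ((hφ.differentiable (by simp) x).hasFDerivAt).hasLineDerivAt _

lemma exists_abs_le (hφ : ContDiff ℝ ∞ φ) (hφc : HasCompactSupport φ) :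
    ∃ M : ℝ, 0 ≤ M ∧ (∀ x, |φ x| ≤ M) ∧ (∀ j x, |partialSpace j φ x| ≤ M) ∧
      ∀ k j x, |partialSpace k (partialSpace j φ) x| ≤ M := by
  have hz : ∀ g : EuclideanSpace ℝ (Fin d) → ℝ, tsupport g ⊆ tsupport φ →
      ∀ x, x ∉ tsupport φ → g x = 0 := fun g hg x hx =>
    image_eq_zero_of_notMem_tsupport fun h => hx (hg h)
  obtain ⟨M0, h0⟩ := exists_bound_of_zero hφc hφ.continuous (hz φ le_rfl)
  choose M1 h1 using fun j => exists_bound_of_zero hφc (contDiff_partialSpace hφ j).continuous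
    (hz _ (tsupport_partialSpace_subset j))
  choose M2 h2 using fun k j => exists_bound_of_zero hφc
    (contDiff_partialSpace (contDiff_partialSpace hφ j) k).continuous
    (hz _ ((tsupport_partialSpace_subset k).trans (tsupport_partialSpace_subset j)))
  have p0 : 0 ≤ M0 := (abs_nonneg _).trans (h0 0)
  have p1 : ∀ j, 0 ≤ M1 j := fun j => (abs_nonneg _).trans (h1 j 0)
  have p2 : ∀ k j, 0 ≤ M2 k j := fun k j => (abs_nonneg _).trans (h2 k j 0)
  have q1 : 0 ≤ ∑ j, M1 j := Finset.sum_nonneg fun j _ => p1 j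
  have q2 : 0 ≤ ∑ k, ∑ j, M2 k j := Finset.sum_nonneg fun k _ => Finset.sum_nonneg fun j _ => p2 k j
  refine ⟨M0 + ∑ j, M1 j + ∑ k, ∑ j, M2 k j, by positivity, fun x => ?_, fun j x => ?_,
    fun k j x => ?_⟩
  · linarith [h0 x]
  · linarith [h1 j x, Finset.single_le_sum (fun i _ => p1 i) (Finset.mem_univ j)]
  · have a1 := Finset.single_le_sum (f := fun k => ∑ j, M2 k j)
      (fun i _ => Finset.sum_nonneg fun j _ => p2 i j) (Finset.mem_univ k)
    have a2 := Finset.single_le_sum (fun i _ => p2 k i) (Finset.mem_univ j)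
    linarith [h2 k j x]

end Spatial

/-! ### The facts about the kinetic function that the estimates use -/

section KineticSolution

variable {d : ℕ}

/-- The properties of the kinetic function used below: it is bounded and satisfies the two estimates
coming from the kinetic equation and the regularity condition. -/
structure IsKineticSolution (lo hi : ℝ) (f : ℝ → EuclideanSpace ℝ (Fin d))
    (a σ : ℝ → Matrix (Fin d) (Fin d) ℝ) (H : EuclideanSpace ℝ (Fin d) × ℝ → ℝ) : Prop where
  f_cont : Continuous f
  a_cont : ∀ i j, Continuous fun l => a l i j
  f_lip : ∃ L : ℝ, 0 ≤ L ∧ ∀ l ∈ Icc lo hi, ∀ l' ∈ Icc lo hi, ∀ j, |f l j - f l' j| ≤ L * |l - l'|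
  a_lip : ∃ L : ℝ, 0 ≤ L ∧ ∀ l ∈ Icc lo hi, ∀ l' ∈ Icc lo hi, ∀ i j,
    |a l i j - a l' i j| ≤ L * |l - l'|
  symm : ∀ l, (σ l).IsSymm
  sq : ∀ l, a l = σ l * σ l
  meas : AEStronglyMeasurable H
  bdd : ∀ p, |H p| ≤ 1
  kinetic : ∀ S : Set (EuclideanSpace ℝ (Fin d) × ℝ), IsCompact S →
    ∃ C : ℝ, 0 ≤ C ∧ ∀ Ψ Ψ₁ Ψ₂, IsKineticTest S Ψ Ψ₁ Ψ₂ → ∀ Λ : ℝ, 0 ≤ Λ →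
      (∀ x l l', |Ψ (x, l) - Ψ (x, l')| ≤ Λ * |l - l'|) →
      |∫ p, H p * (∑ j, f p.2 j * Ψ₁ j p + ∑ k, ∑ j, a p.2 k j * Ψ₂ k j p)| ≤ C * Λ ∧
      ∀ Q : ℝ, 0 ≤ Q → (∀ x l k, |∑ j, σ l k j * Ψ₁ j (x, l)| ≤ Q) →
        |∫ p, H p * ∑ j, f p.2 j * Ψ₁ j p| ≤ C * (Λ + Q)

lemma IsEntropySolution.isKineticSolution {lo hi : ℝ} {𝔣 : ℝ → EuclideanSpace ℝ (Fin d)}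
    {a σ : ℝ → Matrix (Fin d) (Fin d) ℝ} {u : EuclideanSpace ℝ (Fin d) → ℝ}
    (hu : IsEntropySolution 𝔣 a σ u) (h𝔣 : ContDiff ℝ 1 𝔣)
    (h𝔣I : ∃ L, LipschitzOnWith L (deriv 𝔣) (Icc lo hi))
    (ha : ∀ i j, Continuous fun l => a l i j)
    (haI : ∀ i j, ∃ L, LipschitzOnWith L (fun l => a l i j) (Icc lo hi))
    (hσ : ∀ i j, Measurable fun l => σ l i j) (hσsymm : ∀ l, (σ l).IsSymm)
    (haσ : ∀ l, a l = σ l * σ l) :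
    IsKineticSolution lo hi (deriv 𝔣) a σ (kineticFun u) where
  f_cont := h𝔣.continuous_deriv le_rfl
  a_cont := ha
  f_lip := by
    obtain ⟨L, hL⟩ := h𝔣I
    refine ⟨L, L.2, fun l hl l' hl' j => ?_⟩
    have h := hL.dist_le_mul l hl l' hl'
    rw [dist_eq_norm, Real.dist_eq] at h
    exact (PiLp.norm_apply_le (deriv 𝔣 l - deriv 𝔣 l') j).trans h
  a_lip := by
    choose L hL using haI
    refine ⟨∑ i, ∑ j, L i j, Finset.sum_nonneg fun i _ => Finset.sum_nonneg fun j _ => (L i j).2,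
      fun l hl l' hl' i j => ?_⟩
    have h := (hL i j).dist_le_mul l hl l' hl'
    rw [Real.dist_eq, Real.dist_eq] at h
    refine h.trans (mul_le_mul_of_nonneg_right ?_ (abs_nonneg _))
    have a1 := Finset.single_le_sum (f := fun i => ∑ j, (L i j : ℝ))
      (fun i _ => Finset.sum_nonneg fun j _ => (L i j).2) (Finset.mem_univ i)
    have a2 := Finset.single_le_sum (f := fun j => (L i j : ℝ)) (fun j _ => (L i j).2)
      (Finset.mem_univ j)
    exact a2.trans a1
  symm := hσsymm
  sq := haσ
  meas := aestronglyMeasurable_kineticFun hu.1.1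
  bdd := abs_kineticFun_le u
  kinetic := hu.exists_kinetic_bound (h𝔣.continuous_deriv le_rfl) ha hσ hσsymm haσ

end KineticSolution

/-! ### Test functions built from λ-dependent symbols -/

section TestFunctions

variable {d : ℕ}

lemma integrable_symbol_mul {μ : EuclideanSpace ℝ (Fin d) → ℂ} (hμ : Integrable μ) {R : ℝ}
    (hR : ∀ ξ, R < ‖ξ‖ → μ ξ = 0) {g : EuclideanSpace ℝ (Fin d) → ℂ} (hg : Continuous g) :
    Integrable fun ξ => g ξ * μ ξ := by
  have := integrable_mul_of_continuous hμ (isCompact_closedBall (0 : EuclideanSpace ℝ (Fin d)) R)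
    (fun ξ hξ => hR ξ (by simpa using hξ)) hg
  simpa [mul_comm] using this

lemma continuous_synth_param {Y : Type*} [TopologicalSpace Y] [FirstCountableTopology Y]
    [LocallyCompactSpace Y] {μ : EuclideanSpace ℝ (Fin d) → ℂ} (hμ : Integrable μ) {R : ℝ}
    (hR : ∀ ξ, R < ‖ξ‖ → μ ξ = 0) {g : Y → EuclideanSpace ℝ (Fin d) → ℂ}
    (hg : Continuous (Function.uncurry g)) {x : Y → EuclideanSpace ℝ (Fin d)} (hx : Continuous x) :
    Continuous fun y => synth (fun ξ => g y ξ * μ ξ) (x y) := by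
  have hc : Continuous (Function.uncurry fun (y : Y) (ξ : EuclideanSpace ℝ (Fin d)) =>
      g y ξ * wave (x y) ξ) :=
    hg.mul (continuous_wave.comp ((hx.comp continuous_fst).prodMk continuous_snd))
  have := continuous_integral_mul hμ (isCompact_closedBall (0 : EuclideanSpace ℝ (Fin d)) R)
    (fun ξ hξ => hR ξ (by simpa using hξ)) hc
  refine this.congr fun y => ?_
  simp only [synth]; congr 1; ext ξ; ring

/-- The smooth function of `x` with amplitude `m_λ μ`, for every `λ`. -/
noncomputable def synthFamily (m : ℝ → EuclideanSpace ℝ (Fin d) → ℂ)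
    (μ : EuclideanSpace ℝ (Fin d) → ℂ) (p : EuclideanSpace ℝ (Fin d) × ℝ) : ℂ :=
  synth (fun ξ => m p.2 ξ * μ ξ) p.1

/-- The symbol of `∂_j` applied to a family of symbols. -/
noncomputable def derivSymbol (j : Fin d) (m : ℝ → EuclideanSpace ℝ (Fin d) → ℂ) (l : ℝ)
    (ξ : EuclideanSpace ℝ (Fin d)) : ℂ :=
  2 * Real.pi * Complex.I * (ξ j : ℂ) * m l ξ

variable {m : ℝ → EuclideanSpace ℝ (Fin d) → ℂ} {μ : EuclideanSpace ℝ (Fin d) → ℂ}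

lemma continuous_derivSymbol (hm : Continuous (Function.uncurry m)) (j : Fin d) :
    Continuous (Function.uncurry (derivSymbol j m)) :=
  (by fun_prop : Continuous fun p : ℝ × EuclideanSpace ℝ (Fin d) =>
    (2 * Real.pi * Complex.I * (p.2 j : ℂ) : ℂ)).mul hm

lemma continuous_synthFamily (hμ : Integrable μ) {R : ℝ} (hR : ∀ ξ, R < ‖ξ‖ → μ ξ = 0)
    (hm : Continuous (Function.uncurry m)) : Continuous (synthFamily m μ) :=
  continuous_synth_param hμ hR (g := fun p : EuclideanSpace ℝ (Fin d) × ℝ => m p.2)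
    (hm.comp (by fun_prop : Continuous fun q : (EuclideanSpace ℝ (Fin d) × ℝ) ×
      EuclideanSpace ℝ (Fin d) => (q.1.2, q.2))) continuous_fst

lemma hasDerivAt_synthFamily (hμ : Integrable μ) {R : ℝ} (hR : ∀ ξ, R < ‖ξ‖ → μ ξ = 0)
    (hm : Continuous (Function.uncurry m)) (j : Fin d) (p : EuclideanSpace ℝ (Fin d) × ℝ) :
    HasDerivAt (fun t : ℝ => synthFamily m μ
      (p + t • ((EuclideanSpace.single j 1, 0) : EuclideanSpace ℝ (Fin d) × ℝ)))
      (synthFamily (derivSymbol j m) μ p) 0 := by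
  have h := hasDerivAt_synth_line (integrable_symbol_mul hμ hR
    (hm.comp (Continuous.prodMk_right p.2))) (R := R) (fun ξ hξ => by simp [hR ξ hξ]) p.1 j
  have e1 : (fun t : ℝ => synthFamily m μ
      (p + t • ((EuclideanSpace.single j 1, 0) : EuclideanSpace ℝ (Fin d) × ℝ)))
      = fun t : ℝ => synth (fun ξ => m p.2 ξ * μ ξ) (p.1 + t • EuclideanSpace.single j 1) := by
    ext t; simp [synthFamily]
  rw [e1]
  refine h.congr_deriv ?_
  simp only [synthFamily, derivSymbol]
  congr 1; ext ξ; simp only [Function.comp, Function.uncurry]; ring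

variable {φ : EuclideanSpace ℝ (Fin d) → ℝ} {ρ : ℝ → ℝ} {lo hi : ℝ}

lemma hasDerivAt_re {F : ℝ → ℂ} {F' : ℂ} {t : ℝ} (h : HasDerivAt F F' t) :
    HasDerivAt (fun s => (F s).re) F'.re t := by
  have := (Complex.reCLM.hasFDerivAt (x := F t)).comp_hasDerivAt t h
  simpa [Function.comp_def] using this

/-- The equations accept real test functions only. The constant `c` is a phase, chosen later so that
the pairing to be estimated is real and nonnegative. -/
lemma isKineticTest_re (hμ : Integrable μ) {R : ℝ} (hR : ∀ ξ, R < ‖ξ‖ → μ ξ = 0)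
    (hm : Continuous (Function.uncurry m)) (hφ : ContDiff ℝ ∞ φ) (hρ : Continuous ρ)
    (hρI : tsupport ρ ⊆ Icc lo hi) (c : ℂ) :
    IsKineticTest (tsupport φ ×ˢ Icc lo hi)
      (fun p => (c * ρ p.2 * (φ p.1 * synthFamily m μ p)).re)
      (fun j p => (c * ρ p.2 * (partialSpace j φ p.1 * synthFamily m μ p
        + φ p.1 * synthFamily (derivSymbol j m) μ p)).re)
      (fun k j p => (c * ρ p.2 * ((partialSpace k (partialSpace j φ) p.1 * synthFamily m μ p
        + partialSpace j φ p.1 * synthFamily (derivSymbol k m) μ p)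
        + (partialSpace k φ p.1 * synthFamily (derivSymbol j m) μ p
        + φ p.1 * synthFamily (derivSymbol k (derivSymbol j m)) μ p))).re) := by
  have cφ := hφ.continuous
  have cφ1 := fun j => (contDiff_partialSpace hφ j).continuous
  have cφ2 := fun k j => (contDiff_partialSpace (contDiff_partialSpace hφ j) k).continuous
  have cV := continuous_synthFamily hμ hR hm
  have cV1 := fun j => continuous_synthFamily hμ hR (continuous_derivSymbol hm j)
  have cV2 := fun k j => continuous_synthFamily hμ hR
    (continuous_derivSymbol (continuous_derivSymbol hm j) k)
  have zφ : ∀ x, x ∉ tsupport φ → φ x = 0 := fun x hx => image_eq_zero_of_notMem_tsupport hx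
  have zφ1 : ∀ j x, x ∉ tsupport φ → partialSpace j φ x = 0 := fun j x hx =>
    image_eq_zero_of_notMem_tsupport fun h => hx (tsupport_partialSpace_subset j h)
  have zφ2 : ∀ k j x, x ∉ tsupport φ → partialSpace k (partialSpace j φ) x = 0 := fun k j x hx =>
    image_eq_zero_of_notMem_tsupport fun h =>
      hx (tsupport_partialSpace_subset j (tsupport_partialSpace_subset k h))
  have zρ : ∀ l, l ∉ Icc lo hi → ρ l = 0 := fun l hl =>
    image_eq_zero_of_notMem_tsupport fun h => hl (hρI h)
  have line : ∀ (p : EuclideanSpace ℝ (Fin d) × ℝ) (k : Fin d) (t : ℝ),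
      (p + t • ((EuclideanSpace.single k 1, 0) : EuclideanSpace ℝ (Fin d) × ℝ)).2 = p.2 := by
    intro p k t; simp
  have line1 : ∀ (p : EuclideanSpace ℝ (Fin d) × ℝ) (k : Fin d) (t : ℝ),
      (p + t • ((EuclideanSpace.single k 1, 0) : EuclideanSpace ℝ (Fin d) × ℝ)).1
        = p.1 + t • EuclideanSpace.single k 1 := by
    intro p k t; simp
  have dprod : ∀ (g : EuclideanSpace ℝ (Fin d) → ℝ) (_ : ContDiff ℝ ∞ g)
      (m' : ℝ → EuclideanSpace ℝ (Fin d) → ℂ) (_ : Continuous (Function.uncurry m')) (k : Fin d)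
      (p : EuclideanSpace ℝ (Fin d) × ℝ), HasDerivAt (fun t : ℝ =>
        (g (p.1 + t • EuclideanSpace.single k 1) : ℂ) * synthFamily m' μ
          (p + t • ((EuclideanSpace.single k 1, 0) : EuclideanSpace ℝ (Fin d) × ℝ)))
        (partialSpace k g p.1 * synthFamily m' μ p
          + g p.1 * synthFamily (derivSymbol k m') μ p) 0 := by
    intro g hg m' hm' k p
    refine (((hasDerivAt_line hg k p.1).ofReal_comp).mul
      (hasDerivAt_synthFamily hμ hR hm' k p)).congr_deriv ?_
    simp
  have cre : ∀ {F : EuclideanSpace ℝ (Fin d) × ℝ → ℂ}, Continuous F →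
      Continuous fun p => (c * ρ p.2 * F p).re := fun hF =>
    Complex.continuous_re.comp ((continuous_const.mul (Complex.continuous_ofReal.comp
      (hρ.comp continuous_snd))).mul hF)
  have cmul : ∀ {g : EuclideanSpace ℝ (Fin d) → ℝ} {F : EuclideanSpace ℝ (Fin d) × ℝ → ℂ},
      Continuous g → Continuous F → Continuous fun p => (g p.1 : ℂ) * F p := fun hg hF =>
    (Complex.continuous_ofReal.comp (hg.comp continuous_fst)).mul hF
  refine ⟨cre (cmul cφ cV), fun j => cre ((cmul (cφ1 j) cV).add (cmul cφ (cV1 j))),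
    fun k j => cre (((cmul (cφ2 k j) cV).add (cmul (cφ1 j) (cV1 k))).add
      ((cmul (cφ1 k) (cV1 j)).add (cmul cφ (cV2 k j)))), ?_, ?_, ?_, ?_, ?_⟩
  · intro p hp
    by_cases h1 : p.1 ∈ tsupport φ
    · simp [zρ p.2 fun h => hp ⟨h1, h⟩]
    · simp [zφ _ h1]
  · intro j p hp
    by_cases h1 : p.1 ∈ tsupport φ
    · simp [zρ p.2 fun h => hp ⟨h1, h⟩]
    · simp [zφ _ h1, zφ1 _ _ h1]
  · intro k j p hp
    by_cases h1 : p.1 ∈ tsupport φ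
    · simp [zρ p.2 fun h => hp ⟨h1, h⟩]
    · simp [zφ _ h1, zφ1 _ _ h1, zφ2 _ _ _ h1]
  · intro j p
    simp only [line, line1]
    exact hasDerivAt_re ((dprod φ hφ m hm j p).const_mul _)
  · intro k j p
    simp only [line, line1]
    exact hasDerivAt_re (((dprod _ (contDiff_partialSpace hφ j) m hm k p).add
      (dprod φ hφ _ (continuous_derivSymbol hm j) k p)).const_mul _)

/-- Dictionary between the multiplier `opSymbol` and the differential operator v·∇ + A:D² that
occurs in the kinetic equation. -/
lemma synthFamily_opSymbol (hμ : Integrable μ) {R : ℝ} (hR : ∀ ξ, R < ‖ξ‖ → μ ξ = 0)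
    (hm : Continuous (Function.uncurry m)) (v : EuclideanSpace ℝ (Fin d))
    (A : Matrix (Fin d) (Fin d) ℝ) (p : EuclideanSpace ℝ (Fin d) × ℝ) :
    synth (fun ξ => opSymbol v A ξ * (m p.2 ξ * μ ξ)) p.1
      = ∑ j, (v j : ℂ) * synthFamily (derivSymbol j m) μ p
        + ∑ k, ∑ j, (A k j : ℂ) * synthFamily (derivSymbol j (derivSymbol k m)) μ p := by
  have hi : ∀ g : ℝ → EuclideanSpace ℝ (Fin d) → ℂ, Continuous (Function.uncurry g) → ∀ c : ℂ,
      Integrable fun ξ => c * (g p.2 ξ * μ ξ) := fun g hg c =>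
    (integrable_symbol_mul hμ hR (hg.comp (Continuous.prodMk_right p.2))).const_mul c
  have h1 := fun j => hi _ (continuous_derivSymbol hm j) (v j)
  have h2 := fun k j => hi _ (continuous_derivSymbol (continuous_derivSymbol hm k) j) (A k j)
  simp only [synthFamily, ← synth_const_mul]
  rw [← synth_finset_sum _ fun j _ => h1 j, Finset.sum_congr rfl fun k _ =>
    (synth_finset_sum Finset.univ (fun j _ => h2 k j) p.1).symm,
    ← synth_finset_sum _ fun k _ => integrable_finsetSum _ fun j _ => h2 k j,
    ← synth_add (integrable_finsetSum _ fun j _ => h1 j)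
      (integrable_finsetSum _ fun k _ => integrable_finsetSum _ fun j _ => h2 k j)]
  congr 1; ext ξ
  simp only [opSymbol, derivSymbol, quadForm, inner_eq_sum, Complex.ofReal_sum, Complex.ofReal_mul,
    Finset.mul_sum, sub_mul, Finset.sum_mul]
  rw [sub_eq_add_neg, ← Finset.sum_neg_distrib]
  congr 1
  · exact Finset.sum_congr rfl fun j _ => by ring
  · refine Finset.sum_congr rfl fun k _ => ?_
    rw [← Finset.sum_neg_distrib]
    refine Finset.sum_congr rfl fun j _ => ?_
    linear_combination (-4 * Real.pi ^ 2 * A k j * ξ j * ξ k * m p.2 ξ * μ ξ : ℂ) * Complex.I_sq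

lemma synthFamily_inner (hμ : Integrable μ) {R : ℝ} (hR : ∀ ξ, R < ‖ξ‖ → μ ξ = 0)
    (hm : Continuous (Function.uncurry m)) (v : EuclideanSpace ℝ (Fin d))
    (p : EuclideanSpace ℝ (Fin d) × ℝ) :
    ∑ j, (v j : ℂ) * synthFamily (derivSymbol j m) μ p
      = 2 * Real.pi * Complex.I *
        synth (fun ξ => ((inner ℝ v ξ : ℝ) : ℂ) * (m p.2 ξ * μ ξ)) p.1 := by
  have h := synthFamily_opSymbol hμ hR hm v 0 p
  simp only [Matrix.zero_apply, Complex.ofReal_zero, zero_mul, Finset.sum_const_zero,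
    add_zero] at h
  rw [← h, ← synth_const_mul]
  congr 1; ext ξ
  simp [opSymbol, quadForm]; ring

lemma norm_synthFamily_derivSymbol (j : Fin d) (p : EuclideanSpace ℝ (Fin d) × ℝ) :
    ‖synthFamily (derivSymbol j m) μ p‖
      = 2 * Real.pi * ‖synth (fun ξ => (ξ j : ℂ) * (m p.2 ξ * μ ξ)) p.1‖ := by
  have : synthFamily (derivSymbol j m) μ p
      = 2 * Real.pi * Complex.I * synth (fun ξ => (ξ j : ℂ) * (m p.2 ξ * μ ξ)) p.1 := by
    rw [← synth_const_mul, synthFamily]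
    congr 1; ext ξ; simp only [derivSymbol]; ring
  rw [this, norm_mul]; simp [Real.pi_pos.le]

/-- Product rule for Lipschitz constants. Control of the family is available on the interval only,
so the vanishing of ρ outside it has to serve for the other values of λ. -/
lemma abs_test_sub_le {M Mρ Lρ A₀ Λ : ℝ}
    (hρ0 : ∀ l, |ρ l| ≤ Mρ) (hρL : ∀ l l', |ρ l - ρ l'| ≤ Lρ * |l - l'|)
    (hρI : tsupport ρ ⊆ Icc lo hi) (hφM : ∀ x, |φ x| ≤ M) (hA₀ : 0 ≤ A₀) (hΛ0 : 0 ≤ Λ)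
    (h0 : ∀ l ∈ Icc lo hi, ∀ x, ‖synthFamily m μ (x, l)‖ ≤ A₀)
    (hΛ : ∀ l ∈ Icc lo hi, ∀ l' ∈ Icc lo hi, ∀ x,
      ‖synthFamily m μ (x, l) - synthFamily m μ (x, l')‖ ≤ Λ * |l - l'|)
    {c : ℂ} (hc : ‖c‖ = 1) (x : EuclideanSpace ℝ (Fin d)) (l l' : ℝ) :
    |(c * ρ l * (φ x * synthFamily m μ (x, l))).re - (c * ρ l' * (φ x * synthFamily m μ (x, l'))).re|
      ≤ M * (Lρ * A₀ + Mρ * Λ) * |l - l'| := by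
  have zρ : ∀ l, l ∉ Icc lo hi → ρ l = 0 := fun l hl =>
    image_eq_zero_of_notMem_tsupport fun h => hl (hρI h)
  have hMρ : 0 ≤ Mρ := (abs_nonneg _).trans (hρ0 0)
  have hM : 0 ≤ M := (abs_nonneg _).trans (hφM 0)
  have hLρ : 0 ≤ Lρ := by simpa using (abs_nonneg _).trans (hρL 1 0)
  have key : ‖(ρ l : ℂ) * synthFamily m μ (x, l) - ρ l' * synthFamily m μ (x, l')‖
      ≤ (Lρ * A₀ + Mρ * Λ) * |l - l'| := by
    have n1 : ∀ l l', ‖(ρ l : ℂ) - ρ l'‖ ≤ Lρ * |l - l'| := fun l l' => by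
      rw [← Complex.ofReal_sub, Complex.norm_real]; exact hρL l l'
    -- When ρ(l') = 0 the factor at `l'` may be replaced by the one at `l`, and only the increment
    -- of ρ remains.
    have step : ∀ l ∈ Icc lo hi, ∀ l', l' ∉ Icc lo hi →
        ‖(ρ l : ℂ) * synthFamily m μ (x, l) - ρ l' * synthFamily m μ (x, l')‖
          ≤ (Lρ * A₀ + Mρ * Λ) * |l - l'| := by
      intro l hl l' hl'
      have e : (ρ l : ℂ) * synthFamily m μ (x, l) - ρ l' * synthFamily m μ (x, l')
          = ((ρ l : ℂ) - ρ l') * synthFamily m μ (x, l) := by rw [zρ l' hl']; simp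
      rw [e, norm_mul]
      have := mul_le_mul (n1 l l') (h0 l hl x) (norm_nonneg _) (by positivity)
      nlinarith [mul_nonneg (mul_nonneg hMρ hΛ0) (abs_nonneg (l - l'))]
    by_cases hl : l ∈ Icc lo hi <;> by_cases hl' : l' ∈ Icc lo hi
    · have e : (ρ l : ℂ) * synthFamily m μ (x, l) - ρ l' * synthFamily m μ (x, l')
          = ((ρ l : ℂ) - ρ l') * synthFamily m μ (x, l)
            + ρ l' * (synthFamily m μ (x, l) - synthFamily m μ (x, l')) := by ring
      rw [e]
      refine (norm_add_le _ _).trans ?_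
      rw [norm_mul, norm_mul, Complex.norm_real]
      have a1 := mul_le_mul (n1 l l') (h0 l hl x) (norm_nonneg _) (by positivity)
      have a2 := mul_le_mul (hρ0 l') (hΛ l hl l' hl' x) (norm_nonneg _) hMρ
      rw [Real.norm_eq_abs]
      nlinarith
    · exact step l hl l' hl'
    · rw [norm_sub_rev, abs_sub_comm]; exact step l' hl' l hl
    · rw [zρ l hl, zρ l' hl']; simp; positivity
  rw [← Complex.sub_re]
  refine (Complex.abs_re_le_norm _).trans ?_
  have e : c * ρ l * (φ x * synthFamily m μ (x, l)) - c * ρ l' * (φ x * synthFamily m μ (x, l'))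
      = c * φ x * ((ρ l : ℂ) * synthFamily m μ (x, l) - ρ l' * synthFamily m μ (x, l')) := by ring
  rw [e, norm_mul, norm_mul, hc, one_mul, Complex.norm_real, mul_assoc]
  exact mul_le_mul (hφM x) key (norm_nonneg _) hM

end TestFunctions

/-! ### Pairings of the kinetic function; bound for the full kinetic operator -/

section Pairing

variable {d : ℕ}

/-- The pairing `∫∫ H(x, λ) ρ(λ) φ(x) G(x, λ) dx dλ`. -/
noncomputable def pairing (H : EuclideanSpace ℝ (Fin d) × ℝ → ℝ) (ρ : ℝ → ℝ)
    (φ : EuclideanSpace ℝ (Fin d) → ℝ) (G : EuclideanSpace ℝ (Fin d) × ℝ → ℂ) : ℂ :=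
  ∫ p, ((H p * (ρ p.2 * φ p.1) : ℝ) : ℂ) * G p

variable {H : EuclideanSpace ℝ (Fin d) × ℝ → ℝ} {φ : EuclideanSpace ℝ (Fin d) → ℝ} {ρ : ℝ → ℝ}
  {lo hi : ℝ}

lemma integrable_bdd_mul_of_zero (hH : AEStronglyMeasurable H) (hH1 : ∀ p, |H p| ≤ 1)
    {S : Set (EuclideanSpace ℝ (Fin d) × ℝ)} (hS : IsCompact S)
    {Φ : EuclideanSpace ℝ (Fin d) × ℝ → ℝ} (hΦ : Continuous Φ) (h0 : ∀ p, p ∉ S → Φ p = 0) :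
    Integrable fun p => H p * Φ p :=
  (hΦ.integrable_of_hasCompactSupport (HasCompactSupport.intro hS h0)).bdd_mul hH
    (ae_of_all _ hH1)

lemma weight_eq_zero (hρI : tsupport ρ ⊆ Icc lo hi) {p : EuclideanSpace ℝ (Fin d) × ℝ}
    (hp : p ∉ tsupport φ ×ˢ Icc lo hi) : ρ p.2 * φ p.1 = 0 := by
  by_cases h1 : p.1 ∈ tsupport φ
  · rw [image_eq_zero_of_notMem_tsupport fun h => hp ⟨h1, hρI h⟩, zero_mul]
  · rw [image_eq_zero_of_notMem_tsupport h1, mul_zero]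

lemma integrable_weight (hH : AEStronglyMeasurable H) (hH1 : ∀ p, |H p| ≤ 1)
    (hφ : Continuous φ) (hφc : HasCompactSupport φ) (hρ : Continuous ρ)
    (hρI : tsupport ρ ⊆ Icc lo hi) :
    Integrable fun p : EuclideanSpace ℝ (Fin d) × ℝ => ((H p * (ρ p.2 * φ p.1) : ℝ) : ℂ) :=
  (integrable_bdd_mul_of_zero hH hH1 (hφc.isCompact.prod (isCompact_Icc (a := lo) (b := hi)))
    (by fun_prop)
    fun _ hp => weight_eq_zero hρI hp).ofReal

lemma integrable_pairing (hH : AEStronglyMeasurable H) (hH1 : ∀ p, |H p| ≤ 1)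
    (hφ : Continuous φ) (hφc : HasCompactSupport φ) (hρ : Continuous ρ)
    (hρI : tsupport ρ ⊆ Icc lo hi) {G : EuclideanSpace ℝ (Fin d) × ℝ → ℂ} (hG : Continuous G) :
    Integrable fun p => ((H p * (ρ p.2 * φ p.1) : ℝ) : ℂ) * G p :=
  integrable_mul_of_continuous (integrable_weight hH hH1 hφ hφc hρ hρI)
    (hφc.isCompact.prod (isCompact_Icc (a := lo) (b := hi)))
    (fun p hp => by simp [weight_eq_zero hρI hp]) hG

lemma exists_norm_pairing_eq (hH : AEStronglyMeasurable H) (hH1 : ∀ p, |H p| ≤ 1)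
    (hφ : Continuous φ) (hφc : HasCompactSupport φ) (hρ : Continuous ρ)
    (hρI : tsupport ρ ⊆ Icc lo hi) {G : EuclideanSpace ℝ (Fin d) × ℝ → ℂ} (hG : Continuous G) :
    ∃ c : ℂ, ‖c‖ = 1 ∧ ‖pairing H ρ φ G‖ = ∫ p, H p * (c * ρ p.2 * (φ p.1 * G p)).re := by
  obtain ⟨c, hc, h⟩ := RCLike.exists_norm_eq_mul_self (pairing H ρ φ G)
  refine ⟨c, hc, ?_⟩
  have h2 : ‖pairing H ρ φ G‖ = (c * pairing H ρ φ G).re := by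
    rw [← h]; exact (Complex.ofReal_re _).symm
  rw [h2, pairing, ← integral_const_mul, ← Complex.reCLM_apply,
    ← ContinuousLinearMap.integral_comp_comm _
      ((integrable_pairing hH hH1 hφ hφc hρ hρI hG).const_mul c)]
  refine integral_congr_ae (ae_of_all _ fun p => ?_)
  simp only [Complex.reCLM_apply]
  rw [← Complex.re_ofReal_mul]
  congr 1; push_cast; ring

lemma abs_integral_bdd_mul_le (hH1 : ∀ p, |H p| ≤ 1)
    {S : Set (EuclideanSpace ℝ (Fin d) × ℝ)} (hS : IsCompact S)
    {Φ : EuclideanSpace ℝ (Fin d) × ℝ → ℝ} (h0 : ∀ p, p ∉ S → Φ p = 0) {D : ℝ}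
    (hD : ∀ p ∈ S, |Φ p| ≤ D) : |∫ p, H p * Φ p| ≤ volume.real S * D := by
  have hm := hS.isClosed.measurableSet
  refine (norm_integral_le_of_norm_le (f := fun p => H p * Φ p)
    (g := S.indicator fun _ => D)
    ((integrable_indicator_iff hm).2 (integrableOn_const (hS.measure_lt_top (μ := volume)).ne))
    (ae_of_all _ fun p => ?_)).trans (le_of_eq ?_)
  · by_cases hp : p ∈ S
    · rw [indicator_of_mem hp, norm_mul]
      exact (mul_le_of_le_one_left (norm_nonneg _) (hH1 p)).trans (hD p hp)
    · rw [indicator_of_notMem hp, h0 p hp]; simp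
  · rw [integral_indicator hm, setIntegral_const, smul_eq_mul]

lemma derivSymbol_comm (m : ℝ → EuclideanSpace ℝ (Fin d) → ℂ) (j k : Fin d) :
    derivSymbol j (derivSymbol k m) = derivSymbol k (derivSymbol j m) := by
  ext l ξ; simp only [derivSymbol]; ring

lemma norm_sum_mul_le {ι : Type*} [Fintype ι] {b : ι → ℝ} {g : ι → ℂ} {B D : ℝ}
    (hB : ∀ i, |b i| ≤ B) (hD : ∀ i, ‖g i‖ ≤ D) (hB0 : 0 ≤ B) :
    ‖∑ i, (b i : ℂ) * g i‖ ≤ Fintype.card ι * (B * D) := by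
  refine (norm_sum_le _ _).trans ((Finset.sum_le_card_nsmul _ _ (B * D) fun i _ => ?_).trans
    (le_of_eq (by simp)))
  rw [norm_mul, Complex.norm_real]
  exact mul_le_mul (hB i) (hD i) (norm_nonneg _) hB0

lemma exists_coeff_bound (lo hi : ℝ) {ι : Type*} [Fintype ι] {c : ι → ℝ → ℝ}
    (hc : ∀ i, Continuous (c i)) : ∃ M : ℝ, 0 ≤ M ∧ ∀ l ∈ Icc lo hi, ∀ i, |c i l| ≤ M := by
  choose B hB using fun i => (isCompact_Icc (a := lo) (b := hi)).exists_bound_of_continuousOn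
    (hc i).continuousOn
  refine ⟨∑ i, |B i|, by positivity, fun l hl i => ?_⟩
  exact ((hB i l hl).trans (le_abs_self _)).trans
    (Finset.single_le_sum (fun i _ => abs_nonneg (B i)) (Finset.mem_univ i))

lemma exists_cutoff_bound (hρ : ContDiff ℝ 1 ρ) (hρI : tsupport ρ ⊆ Icc lo hi) :
    ∃ Mρ Lρ : ℝ, 0 ≤ Mρ ∧ 0 ≤ Lρ ∧ (∀ l, |ρ l| ≤ Mρ) ∧ ∀ l l', |ρ l - ρ l'| ≤ Lρ * |l - l'| := by
  have hc : HasCompactSupport ρ := isCompact_Icc.of_isClosed_subset (isClosed_tsupport _) hρI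
  obtain ⟨M, hM⟩ := hc.exists_bound_of_continuous hρ.continuous
  obtain ⟨L, hL⟩ := hρ.lipschitzWith_of_hasCompactSupport hc (by simp)
  refine ⟨M, L, (norm_nonneg _).trans (hM 0), L.2, hM, fun l l' => ?_⟩
  have := hL.dist_le_mul l l'
  rwa [Real.dist_eq, Real.dist_eq] at this

variable {f : ℝ → EuclideanSpace ℝ (Fin d)} {a σ : ℝ → Matrix (Fin d) (Fin d) ℝ}

/-- Let V denote the synthesised family. The kinetic estimate is applied to Re(cρφV); by Leibniz its
image under the operator is φ times the operator applied to V, plus a commutator with φ that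
contains at most one derivative of V. Hence the three quantities `A₀`, `A₁`, `Λ`. -/
lemma IsKineticSolution.exists_norm_pairing_opSymbol_le (hK : IsKineticSolution lo hi f a σ H)
    (hφ : ContDiff ℝ ∞ φ) (hφc : HasCompactSupport φ) (hρ : ContDiff ℝ 1 ρ)
    (hρI : tsupport ρ ⊆ Icc lo hi) :
    ∃ C : ℝ, 0 ≤ C ∧ ∀ (μ : EuclideanSpace ℝ (Fin d) → ℂ) (R : ℝ)
      (m : ℝ → EuclideanSpace ℝ (Fin d) → ℂ) (A₀ A₁ Λ : ℝ), Integrable μ →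
      (∀ ξ, R < ‖ξ‖ → μ ξ = 0) → Continuous (Function.uncurry m) → 0 ≤ A₀ → 0 ≤ A₁ → 0 ≤ Λ →
      (∀ l ∈ Icc lo hi, ∀ x, ‖synthFamily m μ (x, l)‖ ≤ A₀) →
      (∀ l ∈ Icc lo hi, ∀ x j, ‖synthFamily (derivSymbol j m) μ (x, l)‖ ≤ A₁) →
      (∀ l ∈ Icc lo hi, ∀ l' ∈ Icc lo hi, ∀ x,
        ‖synthFamily m μ (x, l) - synthFamily m μ (x, l')‖ ≤ Λ * |l - l'|) →
      ‖pairing H ρ φ fun p => synth (fun ξ => opSymbol (f p.2) (a p.2) ξ * (m p.2 ξ * μ ξ)) p.1‖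
        ≤ C * (A₀ + A₁ + Λ) := by
  obtain ⟨M, hM0, hM, hM1, hM2⟩ := exists_abs_le hφ hφc
  obtain ⟨Mρ, Lρ, hMρ, hLρ, hρ0, hρL⟩ := exists_cutoff_bound hρ hρI
  obtain ⟨Mf, hMf0, hMf⟩ := exists_coeff_bound lo hi (c := fun j l => f l j)
    (fun j => by have := hK.f_cont; fun_prop)
  obtain ⟨Ma, hMa0, hMa⟩ := exists_coeff_bound lo hi (ι := Fin d × Fin d)
    (c := fun i l => a l i.1 i.2) (fun i => hK.a_cont _ _)
  set S : Set (EuclideanSpace ℝ (Fin d) × ℝ) := tsupport φ ×ˢ Icc lo hi with hSdef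
  have hS : IsCompact S := hφc.isCompact.prod isCompact_Icc
  obtain ⟨C, hC0, hC⟩ := hK.kinetic S hS
  set n : ℝ := (Fintype.card (Fin d) : ℝ)
  set n2 : ℝ := (Fintype.card (Fin d × Fin d) : ℝ)
  set K := C * M * (Lρ + Mρ) + volume.real S * Mρ * (n * Mf * M + 3 * (n2 * Ma * M)) with hKdef
  have hn : 0 ≤ n := Nat.cast_nonneg _
  have hn2 : 0 ≤ n2 := Nat.cast_nonneg _
  have hvol : 0 ≤ volume.real S := measureReal_nonneg
  refine ⟨K, by positivity, fun μ R m A₀ A₁ Λ hμ hR hm hA₀ hA₁ hΛ0 h0 h1 hΛ => ?_⟩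
  have cV := continuous_synthFamily hμ hR hm
  have cV1 := fun j => continuous_synthFamily hμ hR (continuous_derivSymbol hm j)
  have cV2 := fun k j => continuous_synthFamily hμ hR
    (continuous_derivSymbol (continuous_derivSymbol hm j) k)
  have cf : ∀ j, Continuous fun p : EuclideanSpace ℝ (Fin d) × ℝ => (f p.2 j : ℂ) := fun j => by
    have := hK.f_cont; fun_prop
  have ca : ∀ k j, Continuous fun p : EuclideanSpace ℝ (Fin d) × ℝ => (a p.2 k j : ℂ) := fun k j =>
    Complex.continuous_ofReal.comp ((hK.a_cont k j).comp continuous_snd)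
  have eG : (fun p : EuclideanSpace ℝ (Fin d) × ℝ =>
      synth (fun ξ => opSymbol (f p.2) (a p.2) ξ * (m p.2 ξ * μ ξ)) p.1)
      = fun p => ∑ j, (f p.2 j : ℂ) * synthFamily (derivSymbol j m) μ p
        + ∑ k, ∑ j, (a p.2 k j : ℂ) * synthFamily (derivSymbol k (derivSymbol j m)) μ p := by
    ext p
    rw [synthFamily_opSymbol hμ hR hm]
    simp only [derivSymbol_comm m]
  rw [eG]
  obtain ⟨c, hc, hnorm⟩ := exists_norm_pairing_eq hK.meas hK.bdd hφ.continuous hφc hρ.continuous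
    hρI (G := fun p => ∑ j, (f p.2 j : ℂ) * synthFamily (derivSymbol j m) μ p
        + ∑ k, ∑ j, (a p.2 k j : ℂ) * synthFamily (derivSymbol k (derivSymbol j m)) μ p)
    ((continuous_finsetSum _ fun j _ => (cf j).mul (cV1 j)).add
      (continuous_finsetSum _ fun k _ => continuous_finsetSum _ fun j _ => (ca k j).mul (cV2 k j)))
  rw [hnorm]
  have hT := isKineticTest_re hμ hR hm hφ hρ.continuous hρI c
  have hb := (hC _ _ _ hT (M * (Lρ * A₀ + Mρ * Λ)) (by positivity)
    (abs_test_sub_le hρ0 hρL hρI hM hA₀ hΛ0 h0 hΛ hc)).1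
  -- `E` collects the terms in which at least one derivative falls on φ.
  set E : EuclideanSpace ℝ (Fin d) × ℝ → ℂ := fun p =>
    (∑ j, (f p.2 j : ℂ) * (partialSpace j φ p.1 * synthFamily m μ p))
    + (∑ i : Fin d × Fin d, (a p.2 i.1 i.2 : ℂ) *
      (partialSpace i.1 (partialSpace i.2 φ) p.1 * synthFamily m μ p
        + (partialSpace i.2 φ p.1 * synthFamily (derivSymbol i.1 m) μ p
        + partialSpace i.1 φ p.1 * synthFamily (derivSymbol i.2 m) μ p))) with hE
  have cE : Continuous E := by
    have h1 := fun j => (contDiff_partialSpace hφ j).continuous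
    have h2 := fun k j => (contDiff_partialSpace (contDiff_partialSpace hφ j) k).continuous
    have cmul : ∀ {g : EuclideanSpace ℝ (Fin d) → ℝ} {F : EuclideanSpace ℝ (Fin d) × ℝ → ℂ},
        Continuous g → Continuous F → Continuous fun p => (g p.1 : ℂ) * F p := fun hg hF =>
      (Complex.continuous_ofReal.comp (hg.comp continuous_fst)).mul hF
    exact (continuous_finsetSum _ fun j _ => (cf j).mul (cmul (h1 j) cV)).add
      (continuous_finsetSum _ fun i _ => (ca _ _).mul ((cmul (h2 _ _) cV).add
        ((cmul (h1 _) (cV1 _)).add (cmul (h1 _) (cV1 _)))))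
  have zE : ∀ p, p ∉ S → (c * ρ p.2 * E p).re = 0 := by
    intro p hp
    by_cases hx : p.1 ∈ tsupport φ
    · rw [image_eq_zero_of_notMem_tsupport (f := ρ) fun h => hp ⟨hx, hρI h⟩]; simp
    · have z1 : ∀ j, partialSpace j φ p.1 = 0 := fun j =>
        image_eq_zero_of_notMem_tsupport fun h => hx (tsupport_partialSpace_subset j h)
      have z2 : ∀ k j, partialSpace k (partialSpace j φ) p.1 = 0 := fun k j =>
        image_eq_zero_of_notMem_tsupport fun h =>
          hx (tsupport_partialSpace_subset j (tsupport_partialSpace_subset k h))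
      simp [hE, z1, z2]
  have bE : ∀ p ∈ S, |(c * ρ p.2 * E p).re| ≤ Mρ * (n * (Mf * (M * A₀))
      + n2 * (Ma * (M * A₀ + (M * A₁ + M * A₁)))) := by
    intro p hp
    refine (Complex.abs_re_le_norm _).trans ?_
    rw [norm_mul, norm_mul, hc, one_mul, Complex.norm_real]
    have v0 : ‖synthFamily m μ p‖ ≤ A₀ := h0 p.2 hp.2 p.1
    have v1 : ∀ j, ‖synthFamily (derivSymbol j m) μ p‖ ≤ A₁ := fun j => h1 p.2 hp.2 p.1 j
    have b1 : ∀ j, ‖(partialSpace j φ p.1 : ℂ) * synthFamily m μ p‖ ≤ M * A₀ := fun j => by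
      rw [norm_mul, Complex.norm_real]
      exact mul_le_mul (hM1 j _) v0 (norm_nonneg _) hM0
    have b2 : ∀ k j, ‖(partialSpace k (partialSpace j φ) p.1 : ℂ) * synthFamily m μ p‖ ≤ M * A₀ :=
      fun k j => by
        rw [norm_mul, Complex.norm_real]
        exact mul_le_mul (hM2 k j _) v0 (norm_nonneg _) hM0
    have b3 : ∀ k j, ‖(partialSpace k φ p.1 : ℂ) * synthFamily (derivSymbol j m) μ p‖ ≤ M * A₁ :=
      fun k j => by
        rw [norm_mul, Complex.norm_real]
        exact mul_le_mul (hM1 k _) (v1 j) (norm_nonneg _) hM0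
    refine mul_le_mul (hρ0 _) ((norm_add_le _ _).trans (add_le_add ?_ ?_)) (norm_nonneg _) hMρ
    · exact norm_sum_mul_le (fun j => hMf p.2 hp.2 j) b1 hMf0
    · exact norm_sum_mul_le (fun i => hMa p.2 hp.2 i) (fun i => (norm_add_le _ _).trans
        (add_le_add (b2 _ _) ((norm_add_le _ _).trans (add_le_add (b3 _ _) (b3 _ _))))) hMa0
  have hE2 := abs_integral_bdd_mul_le hK.bdd hS zE bE
  have iE : Integrable fun p => H p * (c * ρ p.2 * E p).re := by
    refine integrable_bdd_mul_of_zero hK.meas hK.bdd hS ?_ zE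
    have := hρ.continuous
    fun_prop
  have iT : Integrable fun p => H p * (∑ j, f p.2 j * (c * ρ p.2 * (partialSpace j φ p.1 *
      synthFamily m μ p + φ p.1 * synthFamily (derivSymbol j m) μ p)).re
      + ∑ k, ∑ j, a p.2 k j * (c * ρ p.2 * ((partialSpace k (partialSpace j φ) p.1 *
        synthFamily m μ p + partialSpace j φ p.1 * synthFamily (derivSymbol k m) μ p)
        + (partialSpace k φ p.1 * synthFamily (derivSymbol j m) μ p
        + φ p.1 * synthFamily (derivSymbol k (derivSymbol j m)) μ p))).re) := by
    refine integrable_bdd_mul_of_zero hK.meas hK.bdd hS ?_ fun p hp => ?_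
    · refine (continuous_finsetSum _ fun j _ => ?_).add (continuous_finsetSum _ fun k _ =>
        continuous_finsetSum _ fun j _ => ?_)
      · exact (by have := hK.f_cont; fun_prop : Continuous fun p : EuclideanSpace ℝ (Fin d) × ℝ =>
          f p.2 j).mul (hT.cont₁ j)
      · exact ((hK.a_cont k j).comp continuous_snd).mul (hT.cont₂ k j)
    · simp only [hT.zero₁ _ p hp, hT.zero₂ _ _ p hp, mul_zero, Finset.sum_const_zero, add_zero]
  have split : ∀ p, H p * (c * ρ p.2 * (φ p.1 * (∑ j, (f p.2 j : ℂ) *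
        synthFamily (derivSymbol j m) μ p
        + ∑ k, ∑ j, (a p.2 k j : ℂ) * synthFamily (derivSymbol k (derivSymbol j m)) μ p))).re
      = H p * (∑ j, f p.2 j * (c * ρ p.2 * (partialSpace j φ p.1 *
      synthFamily m μ p + φ p.1 * synthFamily (derivSymbol j m) μ p)).re
      + ∑ k, ∑ j, a p.2 k j * (c * ρ p.2 * ((partialSpace k (partialSpace j φ) p.1 *
        synthFamily m μ p + partialSpace j φ p.1 * synthFamily (derivSymbol k m) μ p)
        + (partialSpace k φ p.1 * synthFamily (derivSymbol j m) μ p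
        + φ p.1 * synthFamily (derivSymbol k (derivSymbol j m)) μ p))).re)
        - H p * (c * ρ p.2 * E p).re := by
    intro p
    rw [← mul_sub]
    congr 1
    simp only [hE, ← Complex.re_ofReal_mul, Fintype.sum_prod_type, ← Complex.re_sum,
      ← Complex.add_re, ← Complex.sub_re]
    congr 1
    simp only [mul_add, Finset.mul_sum, Finset.sum_add_distrib]
    rw [← sub_eq_zero]
    have e1 : ∀ F : Fin d → ℂ, ∑ j, c * ρ p.2 * (φ p.1 * ((f p.2 j : ℂ) * F j))
        = ∑ j, (f p.2 j : ℂ) * (c * ρ p.2 * (φ p.1 * F j)) := fun F =>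
      Finset.sum_congr rfl fun j _ => by ring
    have e2 : ∀ F : Fin d → Fin d → ℂ, ∑ k, ∑ j, c * ρ p.2 * (φ p.1 * ((a p.2 k j : ℂ) * F k j))
        = ∑ k, ∑ j, (a p.2 k j : ℂ) * (c * ρ p.2 * (φ p.1 * F k j)) := fun F =>
      Finset.sum_congr rfl fun k _ => Finset.sum_congr rfl fun j _ => by ring
    have e3 : ∀ F : Fin d → ℂ, ∑ j, c * ρ p.2 * ((f p.2 j : ℂ) * F j)
        = ∑ j, (f p.2 j : ℂ) * (c * ρ p.2 * F j) := fun F =>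
      Finset.sum_congr rfl fun j _ => by ring
    have e4 : ∀ F : Fin d → Fin d → ℂ, ∑ k, ∑ j, c * ρ p.2 * ((a p.2 k j : ℂ) * F k j)
        = ∑ k, ∑ j, (a p.2 k j : ℂ) * (c * ρ p.2 * F k j) := fun F =>
      Finset.sum_congr rfl fun k _ => Finset.sum_congr rfl fun j _ => by ring
    simp only [e1, e2, e3, e4]
    ring
  simp only [split]
  rw [integral_sub iT iE]
  refine (le_abs_self _).trans ((abs_sub _ _).trans ((add_le_add hb hE2).trans ?_))
  have q0 : 0 ≤ volume.real S * Mρ * (n2 * Ma * M) := by positivity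
  have q1 : 0 ≤ volume.real S * Mρ * (n * Mf * M) := by positivity
  have q2 : 0 ≤ C * M * Lρ := by positivity
  have q3 : 0 ≤ C * M * Mρ := by positivity
  have := mul_nonneg q0 hA₀
  have := mul_nonneg q0 hA₁
  have := mul_nonneg q0 hΛ0
  have := mul_nonneg q1 hA₁
  have := mul_nonneg q1 hΛ0
  have := mul_nonneg q2 hA₁
  have := mul_nonneg q2 hΛ0
  have := mul_nonneg q3 hA₁
  have := mul_nonneg q3 hA₀
  rw [hKdef]
  linarith

end Pairing

/-! ### Bound for the transport operator alone -/

section Transport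

variable {d : ℕ} {H : EuclideanSpace ℝ (Fin d) × ℝ → ℝ} {φ : EuclideanSpace ℝ (Fin d) → ℝ}
  {ρ : ℝ → ℝ} {lo hi : ℝ}
  {f : ℝ → EuclideanSpace ℝ (Fin d)} {a σ : ℝ → Matrix (Fin d) (Fin d) ℝ}

lemma IsKineticSolution.exists_sigma_bound (hK : IsKineticSolution lo hi f a σ H) :
    ∃ M : ℝ, 0 ≤ M ∧ ∀ l ∈ Icc lo hi, ∀ k j, |σ l k j| ≤ M := by
  obtain ⟨Ma, hMa0, hMa⟩ := exists_coeff_bound lo hi (c := fun i l => a l i i)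
    (fun i => hK.a_cont i i)
  refine ⟨Real.sqrt Ma, Real.sqrt_nonneg _, fun l hl k j => Real.abs_le_sqrt ?_⟩
  refine le_trans ?_ ((le_abs_self _).trans (hMa l hl k))
  simp only [hK.sq, Matrix.mul_apply]
  have h0 : ∀ r, 0 ≤ σ l k r * σ l r k := fun r => by
    rw [(hK.symm l).apply k r]; exact mul_self_nonneg _
  refine le_trans (le_of_eq ?_) (Finset.single_le_sum (fun r _ => h0 r) (Finset.mem_univ j))
  rw [(hK.symm l).apply k j, pow_two]

/-- The second kinetic estimate, where the diffusion has been traded for the dissipation: the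
commutator of f·∇ with φ contains no derivative of V, but derivatives of V along the rows of σ must
be bounded, by `Q`. -/
lemma IsKineticSolution.exists_norm_pairing_inner_le (hK : IsKineticSolution lo hi f a σ H)
    (hφ : ContDiff ℝ ∞ φ) (hφc : HasCompactSupport φ) (hρ : ContDiff ℝ 1 ρ)
    (hρI : tsupport ρ ⊆ Icc lo hi) :
    ∃ C : ℝ, 0 ≤ C ∧ ∀ (μ : EuclideanSpace ℝ (Fin d) → ℂ) (R : ℝ)
      (m : ℝ → EuclideanSpace ℝ (Fin d) → ℂ) (A₀ Λ Q : ℝ), Integrable μ →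
      (∀ ξ, R < ‖ξ‖ → μ ξ = 0) → Continuous (Function.uncurry m) → 0 ≤ A₀ → 0 ≤ Λ → 0 ≤ Q →
      (∀ l ∈ Icc lo hi, ∀ x, ‖synthFamily m μ (x, l)‖ ≤ A₀) →
      (∀ l ∈ Icc lo hi, ∀ l' ∈ Icc lo hi, ∀ x,
        ‖synthFamily m μ (x, l) - synthFamily m μ (x, l')‖ ≤ Λ * |l - l'|) →
      (∀ l ∈ Icc lo hi, ∀ x k,
        ‖synth (fun ξ => ((inner ℝ (rowVec (σ l) k) ξ : ℝ) : ℂ) * (m l ξ * μ ξ)) x‖ ≤ Q) →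
      ‖pairing H ρ φ fun p => synth (fun ξ => ((inner ℝ (f p.2) ξ : ℝ) : ℂ) * (m p.2 ξ * μ ξ)) p.1‖
        ≤ C * (A₀ + Λ + Q) := by
  obtain ⟨M, hM0, hM, hM1, -⟩ := exists_abs_le hφ hφc
  obtain ⟨Mρ, Lρ, hMρ, hLρ, hρ0, hρL⟩ := exists_cutoff_bound hρ hρI
  obtain ⟨Mf, hMf0, hMf⟩ := exists_coeff_bound lo hi (c := fun j l => f l j)
    (fun j => by have := hK.f_cont; fun_prop)
  obtain ⟨Ms, hMs0, hMs⟩ := hK.exists_sigma_bound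
  set S : Set (EuclideanSpace ℝ (Fin d) × ℝ) := tsupport φ ×ˢ Icc lo hi with hSdef
  have hS : IsCompact S := hφc.isCompact.prod isCompact_Icc
  obtain ⟨C, hC0, hC⟩ := hK.kinetic S hS
  set n : ℝ := (Fintype.card (Fin d) : ℝ)
  have hn : 0 ≤ n := Nat.cast_nonneg _
  have hvol : 0 ≤ volume.real S := measureReal_nonneg
  have hpi : 0 < 2 * Real.pi := by positivity
  set K := C * (M * (Lρ + Mρ)) + C * (Mρ * (n * (Ms * M) + M * (2 * Real.pi)))
    + volume.real S * (Mρ * (n * (Mf * M))) with hKdef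
  have hK0 : 0 ≤ K := by positivity
  refine ⟨(2 * Real.pi)⁻¹ * K, by positivity,
    fun μ R m A₀ Λ Q hμ hR hm hA₀ hΛ0 hQ0 h0 hΛ hQ => ?_⟩
  have cV := continuous_synthFamily hμ hR hm
  have cV1 := fun j => continuous_synthFamily hμ hR (continuous_derivSymbol hm j)
  have cf : ∀ j, Continuous fun p : EuclideanSpace ℝ (Fin d) × ℝ => (f p.2 j : ℂ) := fun j => by
    have := hK.f_cont; fun_prop
  set G : EuclideanSpace ℝ (Fin d) × ℝ → ℂ := fun p =>
    ∑ j, (f p.2 j : ℂ) * synthFamily (derivSymbol j m) μ p with hG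
  have cG : Continuous G := continuous_finsetSum _ fun j _ => (cf j).mul (cV1 j)
  have eG : pairing H ρ φ (fun p => synth (fun ξ => ((inner ℝ (f p.2) ξ : ℝ) : ℂ) *
      (m p.2 ξ * μ ξ)) p.1) = (2 * Real.pi * Complex.I)⁻¹ * pairing H ρ φ G := by
    simp only [pairing]
    rw [← integral_const_mul]
    congr 1; ext p
    have hne : (2 * Real.pi * Complex.I : ℂ) ≠ 0 := by simp [Real.pi_ne_zero]
    simp only [hG]
    rw [synthFamily_inner hμ hR hm]
    field_simp
  have ninv : ‖(2 * Real.pi * Complex.I : ℂ)⁻¹‖ = (2 * Real.pi)⁻¹ := by simp [Real.pi_pos.le]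
  rw [eG, norm_mul, ninv, mul_assoc]
  refine mul_le_mul_of_nonneg_left ?_ (by positivity)
  obtain ⟨c, hc, hnorm⟩ := exists_norm_pairing_eq hK.meas hK.bdd hφ.continuous hφc hρ.continuous
    hρI cG
  rw [hnorm]
  have hT := isKineticTest_re hμ hR hm hφ hρ.continuous hρI c
  have bφ : ∀ j p, ‖synthFamily m μ p‖ ≤ A₀ →
      ‖(partialSpace j φ p.1 : ℂ) * synthFamily m μ p‖ ≤ M * A₀ := fun j p v0 => by
    rw [norm_mul, Complex.norm_real]
    exact mul_le_mul (hM1 j _) v0 (norm_nonneg _) hM0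
  -- In σ∇(φV) the derivative falls either on φ, giving the part with `A₀`, or on V, giving 2πi⟨row
  -- of σ, ξ⟩ in the symbol and hence the part with `Q`.
  have hb := (hC _ _ _ hT (M * (Lρ * A₀ + Mρ * Λ)) (by positivity)
    (abs_test_sub_le hρ0 hρL hρI hM hA₀ hΛ0 h0 hΛ hc)).2
    (Mρ * (n * (Ms * (M * A₀)) + M * (2 * Real.pi * Q))) (by positivity) (fun x l k => by
      have e : ∑ j, σ l k j * (c * ρ l * (partialSpace j φ x * synthFamily m μ (x, l)
          + φ x * synthFamily (derivSymbol j m) μ (x, l))).re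
          = (c * ρ l * ((∑ j, (σ l k j : ℂ) * (partialSpace j φ x * synthFamily m μ (x, l)))
            + φ x * ∑ j, (rowVec (σ l) k j : ℂ) * synthFamily (derivSymbol j m) μ (x, l))).re := by
        simp only [← Complex.re_ofReal_mul, ← Complex.re_sum, mul_add, Finset.mul_sum,
          Finset.sum_add_distrib, rowVec]
        congr 2
        · exact Finset.sum_congr rfl fun j _ => by ring
        · exact Finset.sum_congr rfl fun j _ => by ring
      rw [e]
      refine (Complex.abs_re_le_norm _).trans ?_
      rw [norm_mul, norm_mul, hc, one_mul, Complex.norm_real]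
      by_cases hl : l ∈ Icc lo hi
      · refine mul_le_mul (hρ0 _) ((norm_add_le _ _).trans (add_le_add ?_ ?_)) (norm_nonneg _) hMρ
        · exact norm_sum_mul_le (fun j => hMs l hl k j) (fun j => bφ j (x, l) (h0 l hl x)) hMs0
        · rw [synthFamily_inner hμ hR hm, norm_mul, norm_mul, Complex.norm_real]
          have n2 : ‖(2 * Real.pi * Complex.I : ℂ)‖ = 2 * Real.pi := by simp [Real.pi_pos.le]
          rw [n2]
          exact mul_le_mul (hM x) (mul_le_mul_of_nonneg_left (hQ l hl x k) hpi.le)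
            (by positivity) hM0
      · rw [image_eq_zero_of_notMem_tsupport (f := ρ) fun h => hl (hρI h), norm_zero, zero_mul]
        positivity)
  set E : EuclideanSpace ℝ (Fin d) × ℝ → ℂ := fun p =>
    ∑ j, (f p.2 j : ℂ) * (partialSpace j φ p.1 * synthFamily m μ p) with hE
  have cE : Continuous E := continuous_finsetSum _ fun j _ => (cf j).mul
    ((Complex.continuous_ofReal.comp
      ((contDiff_partialSpace hφ j).continuous.comp continuous_fst)).mul cV)
  have zE : ∀ p, p ∉ S → (c * ρ p.2 * E p).re = 0 := by
    intro p hp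
    by_cases hx : p.1 ∈ tsupport φ
    · rw [image_eq_zero_of_notMem_tsupport (f := ρ) fun h => hp ⟨hx, hρI h⟩]; simp
    · have z1 : ∀ j, partialSpace j φ p.1 = 0 := fun j =>
        image_eq_zero_of_notMem_tsupport fun h => hx (tsupport_partialSpace_subset j h)
      simp [hE, z1]
  have bE : ∀ p ∈ S, |(c * ρ p.2 * E p).re| ≤ Mρ * (n * (Mf * (M * A₀))) := by
    intro p hp
    refine (Complex.abs_re_le_norm _).trans ?_
    rw [norm_mul, norm_mul, hc, one_mul, Complex.norm_real]
    exact mul_le_mul (hρ0 _) (norm_sum_mul_le (fun j => hMf p.2 hp.2 j)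
      (fun j => bφ j p (h0 p.2 hp.2 p.1)) hMf0) (norm_nonneg _) hMρ
  have hE2 := abs_integral_bdd_mul_le hK.bdd hS zE bE
  have iE : Integrable fun p => H p * (c * ρ p.2 * E p).re := by
    refine integrable_bdd_mul_of_zero hK.meas hK.bdd hS ?_ zE
    have := hρ.continuous
    fun_prop
  have iT : Integrable fun p => H p * ∑ j, f p.2 j * (c * ρ p.2 * (partialSpace j φ p.1 *
      synthFamily m μ p + φ p.1 * synthFamily (derivSymbol j m) μ p)).re := by
    refine integrable_bdd_mul_of_zero hK.meas hK.bdd hS (continuous_finsetSum _ fun j _ => ?_)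
      fun p hp => ?_
    · exact (by have := hK.f_cont; fun_prop : Continuous fun p : EuclideanSpace ℝ (Fin d) × ℝ =>
          f p.2 j).mul (hT.cont₁ j)
    · simp only [hT.zero₁ _ p hp, mul_zero, Finset.sum_const_zero]
  have split : ∀ p, H p * (c * ρ p.2 * (φ p.1 * G p)).re
      = H p * (∑ j, f p.2 j * (c * ρ p.2 * (partialSpace j φ p.1 *
        synthFamily m μ p + φ p.1 * synthFamily (derivSymbol j m) μ p)).re)
        - H p * (c * ρ p.2 * E p).re := by
    intro p
    rw [← mul_sub]
    congr 1
    simp only [hE, hG, ← Complex.re_ofReal_mul, ← Complex.re_sum, ← Complex.sub_re]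
    congr 1
    simp only [mul_add, Finset.mul_sum, Finset.sum_add_distrib]
    rw [eq_sub_iff_add_eq, add_comm]
    congr 1
    · exact Finset.sum_congr rfl fun j _ => by ring
    · exact Finset.sum_congr rfl fun j _ => by ring
  simp only [split]
  rw [integral_sub iT iE]
  refine (le_abs_self _).trans ((abs_sub _ _).trans ((add_le_add hb hE2).trans ?_))
  have q0 : 0 ≤ volume.real S * (Mρ * (n * (Mf * M))) := by positivity
  have q1 : 0 ≤ C * (M * Lρ) := by positivity
  have q2 : 0 ≤ C * (M * Mρ) := by positivity
  have q3 : 0 ≤ C * (Mρ * (n * (Ms * M))) := by positivity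
  have q4 : 0 ≤ C * (Mρ * (M * (2 * Real.pi))) := by positivity
  have := mul_nonneg q0 hΛ0
  have := mul_nonneg q0 hQ0
  have := mul_nonneg q1 hΛ0
  have := mul_nonneg q1 hQ0
  have := mul_nonneg q2 hA₀
  have := mul_nonneg q2 hQ0
  have := mul_nonneg q3 hΛ0
  have := mul_nonneg q3 hQ0
  have := mul_nonneg q4 hA₀
  have := mul_nonneg q4 hΛ0
  rw [hKdef]
  linarith

end Transport

/-! ### Errors made by inserting the semigroup and the transport Gaussian -/

section Smoothing

variable {d : ℕ} {H : EuclideanSpace ℝ (Fin d) × ℝ → ℝ} {φ : EuclideanSpace ℝ (Fin d) → ℝ}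
  {ρ : ℝ → ℝ} {lo hi : ℝ}
  {f : ℝ → EuclideanSpace ℝ (Fin d)} {a σ : ℝ → Matrix (Fin d) (Fin d) ℝ}

/-- Differentiation of a pairing along a family of symbols, followed by the mean value
inequality. -/
lemma norm_pairing_synth_sub_le (hH : AEStronglyMeasurable H) (hH1 : ∀ p, |H p| ≤ 1)
    (hφ : Continuous φ) (hφc : HasCompactSupport φ) (hρ : Continuous ρ)
    (hρI : tsupport ρ ⊆ Icc lo hi) {μ : EuclideanSpace ℝ (Fin d) → ℂ} (hμ : Integrable μ) {R : ℝ}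
    (hR : ∀ ξ, R < ‖ξ‖ → μ ξ = 0) {m m' : ℝ → ℝ → EuclideanSpace ℝ (Fin d) → ℂ}
    (hm : Continuous fun q : (ℝ × ℝ) × EuclideanSpace ℝ (Fin d) => m q.1.1 q.1.2 q.2)
    (hm' : Continuous fun q : (ℝ × ℝ) × EuclideanSpace ℝ (Fin d) => m' q.1.1 q.1.2 q.2)
    (hd : ∀ s l ξ, HasDerivAt (fun r => m r l ξ) (m' s l ξ) s) {t D : ℝ} (ht : 0 ≤ t)
    (hD : ∀ s ∈ Icc 0 t, ‖pairing H ρ φ (synthFamily (m' s) μ)‖ ≤ D) :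
    ‖pairing H ρ φ (synthFamily (m t) μ) - pairing H ρ φ (synthFamily (m 0) μ)‖ ≤ D * t := by
  have hS := hφc.isCompact.prod (isCompact_Icc (a := lo) (b := hi))
  have cg : ∀ M : ℝ → ℝ → EuclideanSpace ℝ (Fin d) → ℂ,
      (Continuous fun q : (ℝ × ℝ) × EuclideanSpace ℝ (Fin d) => M q.1.1 q.1.2 q.2) →
      Continuous (Function.uncurry fun (s : ℝ) (p : EuclideanSpace ℝ (Fin d) × ℝ) =>
        synthFamily (M s) μ p) := fun M hM =>
    continuous_synth_param hμ hR (Y := ℝ × (EuclideanSpace ℝ (Fin d) × ℝ))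
      (g := fun y => M y.1 y.2.2) (hM.comp (by fun_prop : Continuous
        fun q : (ℝ × (EuclideanSpace ℝ (Fin d) × ℝ)) × EuclideanSpace ℝ (Fin d) =>
          ((q.1.1, q.1.2.2), q.2))) (x := fun y => y.2.1) (by fun_prop)
  have key := hasDerivAt_integral_mul (integrable_weight hH hH1 hφ hφc hρ hρI) hS
    (fun p hp => by simp [weight_eq_zero hρI hp]) (cg m hm) (cg m' hm') (fun s p => by
      have cw : ∀ M : ℝ → ℝ → EuclideanSpace ℝ (Fin d) → ℂ,
          (Continuous fun q : (ℝ × ℝ) × EuclideanSpace ℝ (Fin d) => M q.1.1 q.1.2 q.2) →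
          Continuous (Function.uncurry fun (s : ℝ) (ξ : EuclideanSpace ℝ (Fin d)) =>
            M s p.2 ξ * wave p.1 ξ) := fun M hM =>
        (hM.comp (by fun_prop : Continuous fun q : ℝ × EuclideanSpace ℝ (Fin d) =>
          ((q.1, p.2), q.2))).mul (continuous_wave.comp (by fun_prop :
          Continuous fun q : ℝ × EuclideanSpace ℝ (Fin d) => (p.1, q.2)))
      have h := hasDerivAt_integral_mul hμ
        (isCompact_closedBall (0 : EuclideanSpace ℝ (Fin d)) R)
        (fun ξ hξ => hR ξ (by simpa using hξ)) (cw m hm) (cw m' hm')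
        (fun r ξ => (hd r p.2 ξ).mul_const _) s
      have e : ∀ M : ℝ → EuclideanSpace ℝ (Fin d) → ℂ, synthFamily M μ p
          = ∫ ξ, μ ξ * (M p.2 ξ * wave p.1 ξ) := fun M => by
        simp only [synthFamily, synth]; congr 1; ext ξ; ring
      simp only [e]
      exact h)
  have mv := Convex.norm_image_sub_le_of_norm_hasDerivWithin_le
    (s := Icc (0 : ℝ) t) (x := 0) (y := t) (C := D)
    (fun s _ => (key s).hasDerivWithinAt) hD (convex_Icc _ _) (by simp [ht]) (by simp [ht])
  simpa [pairing, abs_of_nonneg ht] using mv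

lemma IsKineticSolution.continuous_opSymbol (hK : IsKineticSolution lo hi f a σ H) {Y : Type*}
    [TopologicalSpace Y] {g : Y → ℝ} {x : Y → EuclideanSpace ℝ (Fin d)} (hg : Continuous g)
    (hx : Continuous x) : Continuous fun y => opSymbol (f (g y)) (a (g y)) (x y) := by
  have h1 : Continuous fun y => quadForm (a (g y)) (x y) :=
    continuous_finsetSum _ fun k _ => continuous_finsetSum _ fun j _ =>
      (((hK.a_cont k j).comp hg).mul (by fun_prop)).mul (by fun_prop)
  have h2 := hK.f_cont
  unfold opSymbol
  fun_prop

/-- The Lipschitz constant of the semigroup symbol on a frequency shell. -/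
lemma IsKineticSolution.exists_semigroup_lipschitz (hK : IsKineticSolution lo hi f a σ H) :
    ∃ C : ℝ, 0 ≤ C ∧ ∀ (μ : EuclideanSpace ℝ (Fin d) → ℂ) (J : ℝ), 1 ≤ J → IsBand μ J →
      ∀ s, 0 ≤ s → ∀ l ∈ Icc lo hi, ∀ l' ∈ Icc lo hi, ∀ x,
        ‖synth (fun ξ => (semigroupSymbol (f l) (a l) s ξ - semigroupSymbol (f l') (a l') s ξ)
          * μ ξ) x‖ ≤ s * (C * J ^ 2 * |l - l'|) := by
  obtain ⟨L₁, hL₁, hf⟩ := hK.f_lip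
  obtain ⟨L₂, hL₂, ha⟩ := hK.a_lip
  refine ⟨2 * Real.pi * (d * L₁) + 4 * Real.pi ^ 2 * (d * (d * L₂)), by positivity,
    fun μ J hJ hμ s hs l hl l' hl' x => ?_⟩
  simp only [hK.sq]
  refine norm_synth_semigroupSymbol_sub_le hμ.int hμ.supp (f l) (f l') (hK.symm l) (hK.symm l')
    hs (fun y => ?_) x
  refine (hμ.norm_synth_opSymbol_sub_le (f l) (f l') _ _ y).trans ?_
  rw [← hK.sq, ← hK.sq]
  have h1 : ∑ j, |f l j - f l' j| ≤ d * L₁ * |l - l'| := by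
    refine (Finset.sum_le_card_nsmul _ _ _ fun j _ => hf l hl l' hl' j).trans (le_of_eq ?_)
    simp [mul_assoc]
  have h2 : ∑ k, ∑ j, |a l k j - a l' k j| ≤ d * (d * L₂) * |l - l'| := by
    refine (Finset.sum_le_card_nsmul _ _ (d * (L₂ * |l - l'|)) fun k _ => ?_).trans (le_of_eq ?_)
    · refine (Finset.sum_le_card_nsmul _ _ _ fun j _ => ha l hl l' hl' k j).trans (le_of_eq ?_)
      simp
    · simp [mul_assoc]
  -- For J ≥ 1 the first-order contribution J is absorbed into the second-order one J².
  have hJ0 : 0 ≤ J := by linarith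
  have hJ2 : J ≤ J ^ 2 := by nlinarith
  have h3 : (∑ j, |f l j - f l' j|) * J ≤ d * L₁ * |l - l'| * J ^ 2 :=
    mul_le_mul h1 hJ2 hJ0 (by positivity)
  have h4 : (∑ k, ∑ j, |a l k j - a l' k j|) * J ^ 2 ≤ d * (d * L₂) * |l - l'| * J ^ 2 :=
    mul_le_mul_of_nonneg_right h2 (by positivity)
  have h5 := mul_le_mul_of_nonneg_left h3 (by positivity : (0 : ℝ) ≤ 2 * Real.pi)
  have h6 := mul_le_mul_of_nonneg_left h4 (by positivity : (0 : ℝ) ≤ 4 * Real.pi ^ 2)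
  refine (add_le_add h5 h6).trans (le_of_eq (by ring))

/-- Differentiating the semigroup in time produces its generator, and a pairing of h with the
generator applied to a test function is what the kinetic equation controls; integrate over [0, T].
-/
lemma IsKineticSolution.exists_semigroup_smoothing (hK : IsKineticSolution lo hi f a σ H)
    (hφ : ContDiff ℝ ∞ φ) (hφc : HasCompactSupport φ) (hρ : ContDiff ℝ 1 ρ)
    (hρI : tsupport ρ ⊆ Icc lo hi) :
    ∃ C : ℝ, 0 ≤ C ∧ ∀ (μ : EuclideanSpace ℝ (Fin d) → ℂ) (J : ℝ), 1 ≤ J → IsBand μ J →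
      ∀ T, 0 ≤ T → ‖pairing H ρ φ (synthFamily (fun l => semigroupSymbol (f l) (a l) T) μ)
        - pairing H ρ φ (fun p => synth μ p.1)‖ ≤ C * (J + T * J ^ 2) * T := by
  obtain ⟨C, hC0, hC⟩ := hK.exists_norm_pairing_opSymbol_le hφ hφc hρ hρI
  obtain ⟨L, hL0, hL⟩ := hK.exists_semigroup_lipschitz
  refine ⟨C * (1 + 2 * Real.pi + L), by positivity, fun μ J hJ hμ T hT => ?_⟩
  have cop : Continuous fun q : ℝ × EuclideanSpace ℝ (Fin d) => opSymbol (f q.1) (a q.1) q.2 :=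
    hK.continuous_opSymbol continuous_fst continuous_snd
  have cop' : Continuous fun q : (ℝ × ℝ) × EuclideanSpace ℝ (Fin d) =>
      opSymbol (f q.1.2) (a q.1.2) q.2 :=
    hK.continuous_opSymbol (by fun_prop) continuous_snd
  have key := norm_pairing_synth_sub_le hK.meas hK.bdd hφ.continuous hφc hρ.continuous hρI
    hμ.int hμ.supp (m := fun s l ξ => semigroupSymbol (f l) (a l) s ξ)
    (m' := fun s l ξ => opSymbol (f l) (a l) ξ * semigroupSymbol (f l) (a l) s ξ)
    (by unfold semigroupSymbol; fun_prop) (by unfold semigroupSymbol; fun_prop)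
    (fun s l ξ => by
      have h1 : HasDerivAt (fun r : ℝ => (r : ℂ) * opSymbol (f l) (a l) ξ)
          (opSymbol (f l) (a l) ξ) s := by
        simpa using ((hasDerivAt_id s).ofReal_comp).mul_const (opSymbol (f l) (a l) ξ)
      have := h1.cexp
      unfold semigroupSymbol
      rwa [mul_comm] at this) hT
    (D := C * (1 + 2 * Real.pi + L) * (J + T * J ^ 2)) (fun s hs => ?_)
  · have e : synthFamily (fun l ξ => semigroupSymbol (f l) (a l) 0 ξ) μ = fun p => synth μ p.1 := by
      ext p; simp [synthFamily, semigroupSymbol]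
    rw [e] at key
    exact key
  · have hsm : ∀ l, SupMult (semigroupSymbol (f l) (a l) s) 1 := fun l => by
      rw [hK.sq]; exact supMult_semigroupSymbol _ (hK.symm l) hs.1
    -- The semigroup is a contraction, so the sup norm stays at most 1 and first derivatives at most
    -- 2πJ; its Lipschitz constant in λ grows like s J².
    have h := hC μ (4 * J) (fun l => semigroupSymbol (f l) (a l) s) 1 (2 * Real.pi * J)
      (s * (L * J ^ 2)) hμ.int hμ.supp (by
        unfold semigroupSymbol Function.uncurry; fun_prop) zero_le_one (by positivity)
      (by have := hs.1; positivity)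
      (fun l _ x => by
        have := (hsm l).bound μ hμ.int 1 hμ.sup_le x
        rw [mul_one] at this
        exact this)
      (fun l _ x j => by
        rw [norm_synthFamily_derivSymbol]
        refine mul_le_mul_of_nonneg_left ?_ (by positivity)
        have := (hsm l).bound _ (hμ.integrable_mul (g := fun ξ => (ξ j : ℂ)) (by fun_prop)) J
          (hμ.sup_one_le j) x
        rw [one_mul] at this
        refine le_trans (le_of_eq ?_) this
        congr 2; ext ξ; ring)
      (fun l hl l' hl' x => by
        have hi : ∀ l, Integrable fun ξ => semigroupSymbol (f l) (a l) s ξ * μ ξ := fun l =>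
          (hsm l).integrable_mul hμ.int
        have := hL μ J hJ hμ s hs.1 l hl l' hl' x
        simp only [sub_mul] at this
        rw [synth_sub (hi l) (hi l')] at this
        refine this.trans (le_of_eq (by ring)))
    have e : pairing H ρ φ (synthFamily (fun l ξ => opSymbol (f l) (a l) ξ *
        semigroupSymbol (f l) (a l) s ξ) μ) = pairing H ρ φ fun p => synth (fun ξ =>
          opSymbol (f p.2) (a p.2) ξ * (semigroupSymbol (f p.2) (a p.2) s ξ * μ ξ)) p.1 := by
      congr 1; ext p; simp only [synthFamily, mul_assoc]
    rw [e]
    refine h.trans ?_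
    rw [mul_assoc C]
    refine mul_le_mul_of_nonneg_left ?_ hC0
    have h1 : s * (L * J ^ 2) ≤ L * (T * J ^ 2) := by
      have := mul_le_mul_of_nonneg_right hs.2 (by positivity : 0 ≤ L * J ^ 2)
      linarith
    have h2 : 0 ≤ T * J ^ 2 := by positivity
    have h3 : 0 ≤ L * J := by positivity
    nlinarith [Real.pi_pos]

/-- The s-derivative of exp(-πs²⟨f,ξ⟩²) is -2π⟨f,ξ⟩ times `oddGauss (s • f)`: one transport
derivative of a uniformly bounded multiplier. The semigroup factor is already present, and it
supplies the bound T^(-1/2) for derivatives along the rows of σ. -/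
lemma IsKineticSolution.exists_transport_smoothing (hK : IsKineticSolution lo hi f a σ H)
    (hφ : ContDiff ℝ ∞ φ) (hφc : HasCompactSupport φ) (hρ : ContDiff ℝ 1 ρ)
    (hρI : tsupport ρ ⊆ Icc lo hi) :
    ∃ C : ℝ, 0 ≤ C ∧ ∀ (μ : EuclideanSpace ℝ (Fin d) → ℂ) (J : ℝ), 1 ≤ J → IsBand μ J →
      ∀ T, 0 < T → ∀ t, 0 ≤ t →
      ‖pairing H ρ φ (synthFamily (fun l ξ =>
          Complex.exp (-Real.pi * ((t * inner ℝ (f l) ξ : ℝ) : ℂ) ^ 2)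
          * semigroupSymbol (f l) (a l) T ξ) μ)
        - pairing H ρ φ (synthFamily (fun l => semigroupSymbol (f l) (a l) T) μ)‖
        ≤ C * (1 + t * J + T * J ^ 2 + (Real.sqrt T)⁻¹) * t := by
  obtain ⟨C, hC0, hC⟩ := hK.exists_norm_pairing_inner_le hφ hφc hρ hρI
  obtain ⟨L, hL0, hL⟩ := hK.exists_semigroup_lipschitz
  obtain ⟨G, hG0, hG⟩ := exists_supMult_oddGauss d
  obtain ⟨L₁, hL₁, hf⟩ := hK.f_lip
  set P : ℝ := 1 + 4 * Real.pi * (G * G) with hP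
  have hP0 : 0 ≤ P := by positivity
  set K := 2 * Real.pi * (G + P * (d * L₁) + G * L + G * G) with hKdef
  have hK0 : 0 ≤ K := by positivity
  refine ⟨C * K, by positivity, fun μ J hJ hμ T hT t ht => ?_⟩
  have hJ0 : 0 ≤ J := by linarith
  have cop : Continuous fun q : ℝ × EuclideanSpace ℝ (Fin d) => opSymbol (f q.1) (a q.1) q.2 :=
    hK.continuous_opSymbol continuous_fst continuous_snd
  have cf := hK.f_cont
  have cop' : Continuous fun q : (ℝ × ℝ) × EuclideanSpace ℝ (Fin d) =>
      opSymbol (f q.1.2) (a q.1.2) q.2 :=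
    hK.continuous_opSymbol (by fun_prop) continuous_snd
  have key := norm_pairing_synth_sub_le hK.meas hK.bdd hφ.continuous hφc hρ.continuous hρI
    hμ.int hμ.supp (m := fun s l ξ => Complex.exp (-Real.pi * ((s * inner ℝ (f l) ξ : ℝ) : ℂ) ^ 2)
          * semigroupSymbol (f l) (a l) T ξ)
    (m' := fun s l ξ => ((inner ℝ (f l) ξ : ℝ) : ℂ) * ((-2 * Real.pi : ℂ) *
      (oddGauss (s • f l) ξ * semigroupSymbol (f l) (a l) T ξ)))
    (by unfold semigroupSymbol; fun_prop) (by unfold semigroupSymbol oddGauss; fun_prop)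
    (fun s l ξ => by
      have h1 : HasDerivAt (fun r : ℝ => ((r * inner ℝ (f l) ξ : ℝ) : ℂ))
          ((inner ℝ (f l) ξ : ℝ) : ℂ) s := by
        have := ((hasDerivAt_id s).mul_const (inner ℝ (f l) ξ)).ofReal_comp
        simpa using this
      have := (((h1.pow 2).const_mul (-Real.pi : ℂ)).cexp).mul_const
        (semigroupSymbol (f l) (a l) T ξ)
      refine this.congr_deriv ?_
      simp only [oddGauss, real_inner_smul_left, Pi.pow_apply]
      push_cast
      ring) ht
    (D := C * K * (1 + t * J + T * J ^ 2 + (Real.sqrt T)⁻¹)) (fun s hs => ?_)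
  · simpa using key
  · have hsm : ∀ l, SupMult (semigroupSymbol (f l) (a l) T) 1 := fun l => by
      rw [hK.sq]; exact supMult_semigroupSymbol _ (hK.symm l) hT.le
    set m : ℝ → EuclideanSpace ℝ (Fin d) → ℂ := fun l ξ => (-2 * Real.pi : ℂ) *
      (oddGauss (s • f l) ξ * semigroupSymbol (f l) (a l) T ξ) with hm
    have npi : ‖(-2 * Real.pi : ℂ)‖ = 2 * Real.pi := by simp [Real.pi_pos.le]
    -- The Lipschitz constant in λ has two sources, the Gaussian factor (of order sJ) and the
    -- semigroup (of order TJ²). The last argument is the smoothing bound of order T^(-1/2).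
    have h := hC μ (4 * J) m (2 * Real.pi * G)
      (2 * Real.pi * (P * (s * (d * L₁ * J)) + G * (T * (L * J ^ 2))))
      (2 * Real.pi * (G * ((Real.sqrt (4 * Real.pi * T))⁻¹ * G)))
      hμ.int hμ.supp (by
        unfold semigroupSymbol oddGauss at hm
        rw [hm]; unfold Function.uncurry; fun_prop) (by positivity)
      (by have := hs.1; positivity) (by positivity)
      (fun l _ x => by
        have := (((hG (s • f l)).mul (hsm l)).const_mul (-2 * Real.pi : ℂ)).bound μ hμ.int 1
          hμ.sup_le x
        rw [npi, mul_one, mul_one] at this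
        exact this)
      (fun l hl l' hl' x => by
        have hi : ∀ l, Integrable fun ξ => m l ξ * μ ξ := fun l =>
          (((hG (s • f l)).mul (hsm l)).const_mul (-2 * Real.pi : ℂ)).integrable_mul hμ.int
        have i1 : Integrable fun ξ => (oddGauss (s • f l) ξ - oddGauss (s • f l') ξ) * μ ξ :=
          hμ.integrable_mul ((hG _).cont.sub (hG _).cont)
        have i2 : Integrable fun ξ => (semigroupSymbol (f l) (a l) T ξ
            - semigroupSymbol (f l') (a l') T ξ) * μ ξ :=
          hμ.integrable_mul ((hsm _).cont.sub (hsm _).cont)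
        have e : synthFamily m μ (x, l) - synthFamily m μ (x, l')
            = (-2 * Real.pi : ℂ) * (synth (fun ξ => semigroupSymbol (f l) (a l) T ξ *
              ((oddGauss (s • f l) ξ - oddGauss (s • f l') ξ) * μ ξ)) x
              + synth (fun ξ => oddGauss (s • f l') ξ * ((semigroupSymbol (f l) (a l) T ξ
            - semigroupSymbol (f l') (a l') T ξ) * μ ξ)) x) := by
          rw [← synth_add ((hsm l).integrable_mul i1) ((hG _).integrable_mul i2),
            ← synth_const_mul]
          simp only [synthFamily]
          rw [← synth_sub (hi l) (hi l')]
          congr 1; ext ξ; simp only [hm]; ring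
        rw [e, norm_mul, npi, mul_assoc (2 * Real.pi)]
        refine mul_le_mul_of_nonneg_left ?_ (by positivity)
        refine (norm_add_le _ _).trans ?_
        rw [add_mul]
        refine add_le_add ?_ ?_
        · have h1 := norm_synth_oddGauss_sub_le hG hμ.int hμ.supp (s • f l) (s • f l')
            (D := s * (d * L₁ * J) * |l - l'|) (fun y => by
              refine (hμ.norm_synth_inner_le _ y).trans ?_
              have : ∑ j, |(s • f l - s • f l') j| ≤ s * (d * L₁ * |l - l'|) := by
                refine (Finset.sum_le_card_nsmul _ _ (s * (L₁ * |l - l'|)) fun j _ => ?_).trans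
                  (le_of_eq ?_)
                · simp only [PiLp.sub_apply, PiLp.smul_apply, smul_eq_mul, ← mul_sub]
                  rw [abs_mul, abs_of_nonneg hs.1]
                  exact mul_le_mul_of_nonneg_left (hf l hl l' hl' j) hs.1
                · simp; ring
              refine (mul_le_mul_of_nonneg_right this hJ0).trans (le_of_eq (by ring)))
          have h2 := (hsm l).bound _ i1 _ h1 x
          rw [one_mul] at h2
          refine h2.trans (le_of_eq (by ring))
        · have h2 := (hG (s • f l')).bound _ i2 _ (hL μ J hJ hμ T hT.le l hl l' hl') x
          refine h2.trans (le_of_eq (by ring)))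
      (fun l _ x k => by
        have h1 := ((hG (s • f l)).mul (supMult_inner_mul_semigroupSymbol hG (f l) (hK.symm l) hT
          k)).const_mul (-2 * Real.pi : ℂ)
        have h2 := h1.bound μ hμ.int 1 hμ.sup_le x
        rw [npi, mul_one] at h2
        refine le_trans (le_of_eq ?_) h2
        congr 2; ext ξ; simp only [hm, hK.sq l]; ring)
    have e : pairing H ρ φ (synthFamily (fun l ξ => ((inner ℝ (f l) ξ : ℝ) : ℂ) * m l ξ) μ)
        = pairing H ρ φ fun p => synth (fun ξ =>
          ((inner ℝ (f p.2) ξ : ℝ) : ℂ) * (m p.2 ξ * μ ξ)) p.1 := by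
      congr 1; ext p; simp only [synthFamily, mul_assoc]
    rw [e]
    refine h.trans ?_
    rw [mul_assoc C]
    refine mul_le_mul_of_nonneg_left ?_ hC0
    have h1 : s * (d * L₁ * J) ≤ d * L₁ * (t * J) := by
      have := mul_le_mul_of_nonneg_right hs.2 (by positivity : 0 ≤ d * L₁ * J)
      linarith
    have h2 : (Real.sqrt (4 * Real.pi * T))⁻¹ ≤ (Real.sqrt T)⁻¹ := by
      refine inv_anti₀ (Real.sqrt_pos.2 hT) (Real.sqrt_le_sqrt ?_)
      nlinarith [Real.pi_gt_three]
    set r := (Real.sqrt T)⁻¹ with hr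
    have hr0 : 0 ≤ r := by positivity
    have h1' := mul_le_mul_of_nonneg_left h1 hP0
    have h2' := mul_le_mul_of_nonneg_left (mul_le_mul_of_nonneg_right h2 hG0) hG0
    have u1 : 0 ≤ t * J := by positivity
    have u2 : 0 ≤ T * J ^ 2 := by positivity
    have hsum : G + (P * (s * (d * L₁ * J)) + G * (T * (L * J ^ 2)))
        + G * ((Real.sqrt (4 * Real.pi * T))⁻¹ * G)
        ≤ (G + P * (d * L₁) + G * L + G * G) * (1 + t * J + T * J ^ 2 + r) := by
      have v1 : 0 ≤ P * (d * L₁) := by positivity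
      have v2 : 0 ≤ G * L := by positivity
      have v3 : 0 ≤ G * G := by positivity
      have w1 : 0 ≤ G * (t * J + T * J ^ 2 + r) := by positivity
      have w2 : 0 ≤ P * (d * L₁) * (1 + T * J ^ 2 + r) := by positivity
      have w3 : 0 ≤ G * L * (1 + t * J + r) := by positivity
      have w4 : 0 ≤ G * G * (1 + t * J + T * J ^ 2) := by positivity
      linarith
    have := mul_le_mul_of_nonneg_left hsum (by positivity : (0 : ℝ) ≤ 2 * Real.pi)
    refine le_trans (le_of_eq (by ring)) (this.trans (le_of_eq (by rw [hKdef]; ring)))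

end Smoothing

/-! ### Plancherel and Parseval for integrable, square-integrable amplitudes -/

section Plancherel

open scoped FourierTransform SchwartzMap

variable {V : Type*} [NormedAddCommGroup V] [InnerProductSpace ℝ V]
  [MeasurableSpace V] [BorelSpace V] [FiniteDimensional ℝ V]

omit [MeasurableSpace V] [BorelSpace V] [FiniteDimensional ℝ V] in
lemma wave_comm (x ξ : V) : wave x ξ = wave ξ x := by
  simp only [wave, real_inner_comm]

lemma continuous_synth {μ : V → ℂ} (hμ : Integrable μ) : Continuous (synth μ) :=
  continuous_of_dominated (bound := fun ξ => ‖μ ξ‖)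
    (fun x => (integrable_mul_wave hμ x).1)
    (fun x => ae_of_all _ fun ξ => by rw [norm_mul, norm_wave, mul_one]) hμ.norm
    (ae_of_all _ fun ξ => continuous_const.mul
      (continuous_wave.comp (Continuous.prodMk_left ξ)))

lemma norm_synth_le {μ : V → ℂ} (x : V) : ‖synth μ x‖ ≤ ∫ ξ, ‖μ ξ‖ := by
  refine (norm_integral_le_integral_norm _).trans (le_of_eq ?_)
  simp [norm_wave]

lemma integrable_mul_mul_wave {f g : V → ℂ} (hf : Integrable f) (hg : Integrable g) :
    Integrable fun p : V × V => f p.1 * g p.2 * wave p.1 p.2 := by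
  have := hf.mul_prod hg
  refine this.norm.mono' (this.1.mul continuous_wave.aestronglyMeasurable)
    (ae_of_all _ fun p => ?_)
  rw [norm_mul (f p.1 * g p.2), norm_wave, mul_one]

lemma integral_mul_synth {f g : V → ℂ} (hf : Integrable f) (hg : Integrable g) :
    ∫ x, f x * synth g x = ∫ x, g x * synth f x := by
  have h := integrable_mul_mul_wave hf hg
  simp only [synth, ← integral_const_mul]
  rw [integral_integral_swap (by
    refine h.congr (ae_of_all _ fun p => ?_); simp only [Function.uncurry]; ring)]
  refine integral_congr_ae (ae_of_all _ fun y => integral_congr_ae (ae_of_all _ fun x => ?_))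
  simp only [wave_comm x y]; ring

/-- The abstract L² transform and the integral formula have the same integrals against smooth
compactly supported functions: on both sides the transform can be moved onto the test function. -/
lemma fourierInv_toLp_ae_eq {g : V → ℂ} (hg : Integrable g) (hg2 : MemLp g 2) :
    (𝓕⁻ (hg2.toLp g) : Lp ℂ 2 (volume : Measure V)) =ᵐ[volume] synth g := by
  refine ae_eq_of_integral_contDiff_smul_eq
    ((Lp.memLp _).locallyIntegrable (by norm_num)) (continuous_synth hg).locallyIntegrable ?_
  intro φ hφ hφc
  have hc : HasCompactSupport fun x => (φ x : ℂ) :=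
    hφc.comp_left (g := fun t : ℝ => (t : ℂ)) Complex.ofReal_zero
  have hs : ContDiff ℝ ∞ fun x => (φ x : ℂ) := Complex.ofRealCLM.contDiff.comp hφ
  set ψ : 𝓢(V, ℂ) := hc.toSchwartzMap hs with hψ
  have hψ1 : ∀ x, ψ x = (φ x : ℂ) := fun x => rfl
  have e1 := congrArg (fun T : 𝓢'(V, ℂ) => T ψ)
    (Lp.fourierInv_toTemperedDistribution_eq (hg2.toLp g))
  simp only [TemperedDistribution.fourierInv_apply, Lp.toTemperedDistribution_apply] at e1
  have e2 : ∀ x, (𝓕⁻ ψ : 𝓢(V, ℂ)) x = synth (fun x => (φ x : ℂ)) x := fun x => by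
    rw [synth_eq_fourierInv, SchwartzMap.fourierInv_coe]; rfl
  have hi : Integrable fun x => (φ x : ℂ) := hs.continuous.integrable_of_hasCompactSupport hc
  calc ∫ x, φ x • (𝓕⁻ (hg2.toLp g) : Lp ℂ 2 (volume : Measure V)) x
      = ∫ x, ψ x • (𝓕⁻ (hg2.toLp g) : Lp ℂ 2 (volume : Measure V)) x := by
        simp only [hψ1, Complex.real_smul, smul_eq_mul]
    _ = ∫ x, (𝓕⁻ ψ : 𝓢(V, ℂ)) x • (hg2.toLp g : V → ℂ) x := e1.symm
    _ = ∫ x, g x * synth (fun x => (φ x : ℂ)) x := by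
        refine integral_congr_ae ?_
        filter_upwards [hg2.coeFn_toLp] with x hx
        rw [hx, e2, smul_eq_mul, mul_comm]
    _ = ∫ x, φ x • synth g x := by
        rw [integral_mul_synth hg hi]
        simp only [Complex.real_smul]

lemma memLp_synth {g : V → ℂ} (hg : Integrable g) (hg2 : MemLp g 2) : MemLp (synth g) 2 :=
  (memLp_congr_ae (fourierInv_toLp_ae_eq hg hg2)).1 (Lp.memLp _)

lemma lintegral_sq_eq_eLpNorm (g : V → ℂ) : ∫⁻ x, ‖g x‖ₑ ^ 2 = eLpNorm g 2 volume ^ 2 := by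
  rw [eLpNorm_eq_lintegral_rpow_enorm_toReal (by norm_num) (by norm_num)]
  simp only [ENNReal.toReal_ofNat, one_div]
  rw [← ENNReal.rpow_natCast, ← ENNReal.rpow_mul]
  norm_num

/-- Plancherel's theorem for integrable functions. -/
lemma lintegral_sq_synth {g : V → ℂ} (hg : Integrable g) (hg2 : MemLp g 2) :
    ∫⁻ x, ‖synth g x‖ₑ ^ 2 = ∫⁻ x, ‖g x‖ₑ ^ 2 := by
  rw [lintegral_sq_eq_eLpNorm, lintegral_sq_eq_eLpNorm,
    ← eLpNorm_congr_ae (fourierInv_toLp_ae_eq hg hg2), ← eLpNorm_congr_ae hg2.coeFn_toLp]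
  congr 1
  have h := Lp.norm_fourier_eq (𝓕⁻ (hg2.toLp g))
  rw [FourierTransform.fourier_fourierInv_eq] at h
  rw [← Lp.enorm_def, ← Lp.enorm_def, ← ofReal_norm, ← ofReal_norm, h]

/-- Parseval's identity. -/
lemma integral_synth_mul_synth_neg {f g : V → ℂ} (hf : Integrable f) (hf2 : MemLp f 2)
    (hg : Integrable g) (hg2 : MemLp g 2) :
    ∫ ξ, synth f ξ * synth g (-ξ) = ∫ x, f x * g x := by
  set g' : V → ℂ := fun x => (starRingEnd ℂ) (g x) with hg'
  have hi : Integrable g' := by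
    have := (Complex.conjLIE.toContinuousLinearEquiv : ℂ →L[ℝ] ℂ).integrable_comp hg
    exact this
  have hi2 : MemLp g' 2 := hg2.star
  have hneg : ∀ ξ, synth g (-ξ) = (starRingEnd ℂ) (synth g' ξ) := fun ξ => by
    rw [synth, synth, ← integral_conj]
    refine integral_congr_ae (ae_of_all _ fun x => ?_)
    simp only [hg', map_mul, Complex.conj_conj, wave, ← Complex.exp_conj, Complex.conj_ofReal,
      Complex.conj_I, inner_neg_left]
    congr 2; push_cast; ring
  have key : inner ℂ (𝓕⁻ (hi2.toLp g') : Lp ℂ 2 (volume : Measure V)) (𝓕⁻ (hf2.toLp f))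
      = inner ℂ (hi2.toLp g') (hf2.toLp f) := by
    rw [← Lp.inner_fourier_eq, FourierTransform.fourier_fourierInv_eq,
      FourierTransform.fourier_fourierInv_eq]
  rw [L2.inner_def, L2.inner_def] at key
  calc _ = _ := ?_
    _ = _ := key
    _ = _ := ?_
  · refine integral_congr_ae ?_
    filter_upwards [fourierInv_toLp_ae_eq hi hi2, fourierInv_toLp_ae_eq hf hf2] with ξ h1 h2
    rw [h1, h2, hneg, RCLike.inner_apply]
  · refine integral_congr_ae ?_
    filter_upwards [hi2.coeFn_toLp, hf2.coeFn_toLp] with ξ h1 h2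
    rw [h1, h2, RCLike.inner_apply]
    simp [hg']

end Plancherel

/-! ### The L² averaging estimate -/

section SquareFunction

variable {d : ℕ} {H : EuclideanSpace ℝ (Fin d) × ℝ → ℝ} {φ : EuclideanSpace ℝ (Fin d) → ℝ}
  {ρ : ℝ → ℝ} {lo hi : ℝ}

lemma enorm_mul_enorm_le {y : ℝ} (hy : 0 < y) (z w : ℂ) :
    ‖z‖ₑ * ‖w‖ₑ ≤ ENNReal.ofReal y⁻¹ * ‖z‖ₑ ^ 2 + ENNReal.ofReal y * ‖w‖ₑ ^ 2 := by
  rw [← ofReal_norm, ← ofReal_norm, ← ENNReal.ofReal_pow (norm_nonneg _),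
    ← ENNReal.ofReal_pow (norm_nonneg _), ← ENNReal.ofReal_mul (norm_nonneg _),
    ← ENNReal.ofReal_mul (by positivity), ← ENNReal.ofReal_mul (by positivity),
    ← ENNReal.ofReal_add (by positivity) (by positivity)]
  refine ENNReal.ofReal_le_ofReal ?_
  have e : y⁻¹ * ‖z‖ ^ 2 + y * ‖w‖ ^ 2 - ‖z‖ * ‖w‖
      = y⁻¹ * ((‖z‖ - y * ‖w‖ / 2) ^ 2 + 3 / 4 * (y * ‖w‖) ^ 2) := by field_simp; ring
  have : 0 ≤ y⁻¹ * ((‖z‖ - y * ‖w‖ / 2) ^ 2 + 3 / 4 * (y * ‖w‖) ^ 2) := by positivity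
  linarith

lemma memLp_two_of_bounded {w : EuclideanSpace ℝ (Fin d) → ℂ} (hw : Integrable w) {B : ℝ}
    (hB : ∀ x, ‖w x‖ ≤ B) : MemLp w 2 := by
  refine (memLp_two_iff_integrable_sq_norm hw.1).2 ((hw.norm.const_mul B).mono'
    (hw.1.norm.pow 2) (ae_of_all _ fun x => ?_))
  rw [Real.norm_of_nonneg (by positivity), pow_two]
  exact mul_le_mul_of_nonneg_right (hB x) (norm_nonneg _)

/-- Integrating in λ first works because `μ` does not depend on λ: the square integral of `M` over
the interval is bounded at each frequency of the band, and `μ` has L² norm at most 1. -/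
lemma lintegral_sq_mul_le {M : ℝ → EuclideanSpace ℝ (Fin d) → ℂ}
    (hM : Continuous (Function.uncurry M)) {μ : EuclideanSpace ℝ (Fin d) → ℂ} {J : ℝ}
    (h : IsBand μ J) {Y : ℝ≥0∞} (hY : ∀ ξ, J ≤ ‖ξ‖ → ‖ξ‖ ≤ 4 * J →
      ∫⁻ l in Icc lo hi, ‖M l ξ‖ₑ ^ 2 ≤ Y) :
    ∫⁻ l in Icc lo hi, ∫⁻ ξ, ‖M l ξ * μ ξ‖ₑ ^ 2 ≤ Y := by
  rw [lintegral_lintegral_swap]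
  · calc ∫⁻ ξ, ∫⁻ l in Icc lo hi, ‖M l ξ * μ ξ‖ₑ ^ 2
        ≤ ∫⁻ ξ, Y * ‖μ ξ‖ₑ ^ 2 := by
          refine lintegral_mono fun ξ => ?_
          simp only [enorm_mul, mul_pow]
          rw [lintegral_mul_const' _ _ (by simp)]
          by_cases h1 : ‖ξ‖ < J
          · simp [h.low ξ h1]
          by_cases h2 : 4 * J < ‖ξ‖
          · simp [h.supp ξ h2]
          · gcongr
            exact hY ξ (not_lt.1 h1) (not_lt.1 h2)
      _ ≤ Y * 1 := by
          rw [lintegral_const_mul'' _ (h.int.1.enorm.pow_const 2)]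
          gcongr
          exact h.sq_le
      _ = Y := mul_one _
  · refine (AEStronglyMeasurable.enorm ?_).pow_const 2
    exact hM.aestronglyMeasurable.mul h.int.1.comp_snd

/-- Velocity averaging: for fixed λ the pairing moves to the frequency side, where Plancherel
controls the weight h ρ φ, and Cauchy–Schwarz in (λ, ξ) leaves the square integral of the symbol
over λ. -/
lemma exists_norm_pairing_le_of_sq (hH : AEStronglyMeasurable H) (hH1 : ∀ p, |H p| ≤ 1)
    (hφ : Continuous φ) (hφc : HasCompactSupport φ) (hρ : ContDiff ℝ 1 ρ)
    (hρI : tsupport ρ ⊆ Icc lo hi) :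
    ∃ C : ℝ, 0 ≤ C ∧ ∀ M : ℝ → EuclideanSpace ℝ (Fin d) → ℂ, Continuous (Function.uncurry M) →
      ∀ μ J, IsBand μ J → ∀ y : ℝ, 0 < y → (∀ ξ, J ≤ ‖ξ‖ → ‖ξ‖ ≤ 4 * J →
        ∫⁻ l in Icc lo hi, ‖M l ξ‖ₑ ^ 2 ≤ ENNReal.ofReal (y ^ 2)) →
      ‖pairing H ρ φ (synthFamily M μ)‖ ≤ C * y := by
  obtain ⟨Mρ, -, hMρ, -, hρ0, -⟩ := exists_cutoff_bound hρ hρI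
  obtain ⟨Mφ, hφM⟩ := hφc.exists_bound_of_continuous hφ
  have hMφ : 0 ≤ Mφ := (norm_nonneg _).trans (hφM 0)
  set K : ℝ := (Mρ * Mφ) ^ 2 * volume.real (tsupport φ) with hK
  have hK0 : 0 ≤ K := by positivity
  set w : EuclideanSpace ℝ (Fin d) × ℝ → ℂ := fun p => ((H p * (ρ p.2 * φ p.1) : ℝ) : ℂ) with hw
  have wint : Integrable w := integrable_weight hH hH1 hφ hφc hρ.continuous hρI
  have wB : ∀ p, ‖w p‖ ≤ Mρ * Mφ := fun p => by
    rw [hw, Complex.norm_real, norm_mul, norm_mul]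
    have h1 := mul_le_mul (hρ0 p.2) (hφM p.1) (norm_nonneg _) hMρ
    exact (mul_le_mul (hH1 p) h1 (by positivity) zero_le_one).trans (by rw [one_mul])
  have w0 : ∀ p, p ∉ tsupport φ ×ˢ Icc lo hi → w p = 0 := fun p hp => by
    simp only [hw, weight_eq_zero hρI hp, mul_zero, Complex.ofReal_zero]
  have wsq : ∀ l, ∫⁻ x, ‖w (x, l)‖ₑ ^ 2 ≤ ENNReal.ofReal K := fun l => by
    calc ∫⁻ x, ‖w (x, l)‖ₑ ^ 2
        ≤ ∫⁻ x, (tsupport φ).indicator (fun _ => ENNReal.ofReal ((Mρ * Mφ) ^ 2)) x := by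
          refine lintegral_mono fun x => ?_
          by_cases hx : x ∈ tsupport φ
          · rw [indicator_of_mem hx, ENNReal.ofReal_pow (by positivity), ← ofReal_norm]
            gcongr
            exact wB _
          · simp [w0 (x, l) fun h => hx h.1]
      _ = ENNReal.ofReal K := by
          rw [lintegral_indicator (isClosed_tsupport φ).measurableSet, setLIntegral_const, hK,
            ENNReal.ofReal_mul (by positivity), measureReal_def,
            ENNReal.ofReal_toReal hφc.isCompact.measure_lt_top.ne]
  refine ⟨1 + K * volume.real (Icc lo hi), by positivity, fun M hM μ J h y hy hY => ?_⟩
  have hG : Continuous (synthFamily M μ) := continuous_synthFamily h.int h.supp hM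
  have hMμ : ∀ l, Integrable fun ξ => M l ξ * μ ξ := fun l =>
    integrable_symbol_mul h.int h.supp (hM.comp (Continuous.prodMk_right l))
  have hprod : Integrable (fun p => w p * synthFamily M μ p)
      ((volume : Measure (EuclideanSpace ℝ (Fin d))).prod (volume : Measure ℝ)) :=
    integrable_pairing hH hH1 hφ hφc hρ.continuous hρI hG
  have e1 : pairing H ρ φ (synthFamily M μ)
      = ∫ l, ∫ x, w (x, l) * synth (fun ξ => M l ξ * μ ξ) x := by
    rw [pairing, Measure.volume_eq_prod]
    exact integral_prod_symm _ hprod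
  have hwl : ∀ᵐ l : ℝ, Integrable fun x => w (x, l) :=
    Integrable.prod_left_ae (μ := (volume : Measure (EuclideanSpace ℝ (Fin d))))
      (ν := (volume : Measure ℝ)) wint
  -- Cauchy–Schwarz in its Young form: with weight `y` both halves are of order `y` after
  -- integration, since y⁻¹ · y² = y.
  have key : ∀ᵐ l : ℝ, ‖∫ x, w (x, l) * synth (fun ξ => M l ξ * μ ξ) x‖ₑ
      ≤ (Icc lo hi).indicator (fun l => ENNReal.ofReal y⁻¹ * (∫⁻ ξ, ‖M l ξ * μ ξ‖ₑ ^ 2)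
        + ENNReal.ofReal y * ENNReal.ofReal K) l := by
    filter_upwards [hwl] with l hl
    by_cases hI : l ∈ Icc lo hi
    · rw [indicator_of_mem hI, integral_mul_synth hl (hMμ l)]
      refine (enorm_integral_le_lintegral_enorm _).trans ?_
      calc ∫⁻ ξ, ‖M l ξ * μ ξ * synth (fun x => w (x, l)) ξ‖ₑ
          ≤ ∫⁻ ξ, (ENNReal.ofReal y⁻¹ * ‖M l ξ * μ ξ‖ₑ ^ 2
            + ENNReal.ofReal y * ‖synth (fun x => w (x, l)) ξ‖ₑ ^ 2) :=
            lintegral_mono fun ξ => by rw [enorm_mul]; exact enorm_mul_enorm_le hy _ _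
        _ = ENNReal.ofReal y⁻¹ * (∫⁻ ξ, ‖M l ξ * μ ξ‖ₑ ^ 2)
            + ENNReal.ofReal y * ∫⁻ ξ, ‖synth (fun x => w (x, l)) ξ‖ₑ ^ 2 := by
            rw [lintegral_add_left' (((hMμ l).1.enorm.pow_const 2).const_mul _),
              lintegral_const_mul' _ _ ENNReal.ofReal_ne_top,
              lintegral_const_mul' _ _ ENNReal.ofReal_ne_top]
        _ ≤ _ := by
            rw [lintegral_sq_synth hl (memLp_two_of_bounded hl fun x => wB (x, l))]
            gcongr
            exact wsq l
    · have : ∀ x, w (x, l) = 0 := fun x => w0 _ fun hx => hI hx.2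
      simp [this]
  have fin : ‖pairing H ρ φ (synthFamily M μ)‖ₑ
      ≤ ENNReal.ofReal ((1 + K * volume.real (Icc lo hi)) * y) := by
    rw [e1]
    refine (enorm_integral_le_lintegral_enorm _).trans ((lintegral_mono_ae key).trans ?_)
    rw [lintegral_indicator measurableSet_Icc, lintegral_add_right _ measurable_const,
      lintegral_const_mul' _ _ ENNReal.ofReal_ne_top, setLIntegral_const]
    have hI : volume (Icc lo hi) = ENNReal.ofReal (volume.real (Icc lo hi)) := by
      rw [measureReal_def, ENNReal.ofReal_toReal isCompact_Icc.measure_lt_top.ne]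
    have h1 := lintegral_sq_mul_le hM h hY
    calc _ ≤ ENNReal.ofReal y⁻¹ * ENNReal.ofReal (y ^ 2)
          + ENNReal.ofReal y * ENNReal.ofReal K * volume (Icc lo hi) := by gcongr
      _ = _ := by
          rw [hI, ← ENNReal.ofReal_mul (by positivity), ← ENNReal.ofReal_mul (by positivity),
            ← ENNReal.ofReal_mul (by positivity), ← ENNReal.ofReal_add (by positivity)
            (by positivity)]
          congr 1; field_simp
  rw [← ofReal_norm] at fin
  exact (ENNReal.ofReal_le_ofReal_iff (by positivity)).1 fin

end SquareFunction

/-! ### Non-degeneracy and the decay of frequency-localised pairings -/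

section Decay

variable {d : ℕ} {H : EuclideanSpace ℝ (Fin d) × ℝ → ℝ} {φ : EuclideanSpace ℝ (Fin d) → ℝ}
  {ρ : ℝ → ℝ} {lo hi : ℝ}
  {f : ℝ → EuclideanSpace ℝ (Fin d)} {a σ : ℝ → Matrix (Fin d) (Fin d) ℝ}

/-- For δ ≥ δ₀ the trivial bound by the length of the interval is absorbed into the constant, so δ
can later be chosen freely in terms of J. -/
lemma NonDegenerate.exists_volume_le {𝔣 : ℝ → EuclideanSpace ℝ (Fin d)} {α δ₀ : ℝ}
    (hα : 0 < α) (hδ₀ : 0 < δ₀) (h : NonDegenerate 𝔣 a (Icc lo hi) α δ₀) :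
    ∃ C : ℝ, 0 ≤ C ∧ ∀ δ, 0 < δ → ∀ ξ : EuclideanSpace ℝ (Fin d), ‖ξ‖ = 1 →
      volume {l ∈ Icc lo hi | inner ℝ (deriv 𝔣 l) ξ ^ 2 + quadForm (a l) ξ ≤ δ}
        ≤ ENNReal.ofReal (C * δ ^ α) := by
  obtain ⟨C, hC⟩ := h
  have hδα : 0 < δ₀ ^ α := Real.rpow_pos_of_pos hδ₀ α
  refine ⟨|C| + volume.real (Icc lo hi) / δ₀ ^ α, by positivity, fun δ hδ ξ hξ => ?_⟩
  have hp : 0 < δ ^ α := Real.rpow_pos_of_pos hδ α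
  rcases lt_or_ge δ δ₀ with h1 | h1
  · have := hC δ ⟨hδ, h1⟩ ξ hξ
    simp only [inner_eq_sum, quadForm]
    refine this.trans (ENNReal.ofReal_le_ofReal ?_)
    refine mul_le_mul_of_nonneg_right ((le_abs_self C).trans ?_) hp.le
    have : 0 ≤ volume.real (Icc lo hi) / δ₀ ^ α := by positivity
    linarith
  · refine (measure_mono (sep_subset _ _)).trans ?_
    rw [← ENNReal.ofReal_toReal (isCompact_Icc (a := lo) (b := hi)).measure_lt_top.ne]
    refine ENNReal.ofReal_le_ofReal ?_
    rw [← measureReal_def]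
    have h2 : δ₀ ^ α ≤ δ ^ α := Real.rpow_le_rpow hδ₀.le h1 hα.le
    have h3 : volume.real (Icc lo hi) ≤ volume.real (Icc lo hi) / δ₀ ^ α * δ ^ α := by
      rw [div_mul_eq_mul_div, le_div_iff₀ hδα]
      exact mul_le_mul_of_nonneg_left h2 measureReal_nonneg
    have : 0 ≤ |C| * δ ^ α := by positivity
    rw [add_mul]; linarith

lemma quadForm_smul (A : Matrix (Fin d) (Fin d) ℝ) (r : ℝ) (ξ : EuclideanSpace ℝ (Fin d)) :
    quadForm A (r • ξ) = r ^ 2 * quadForm A ξ := by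
  simp only [quadForm, PiLp.smul_apply, smul_eq_mul, Finset.mul_sum]
  exact Finset.sum_congr rfl fun k _ => Finset.sum_congr rfl fun j _ => by ring

lemma norm_semigroupSymbol (v : EuclideanSpace ℝ (Fin d)) (A : Matrix (Fin d) (Fin d) ℝ)
    (T : ℝ) (ξ : EuclideanSpace ℝ (Fin d)) :
    ‖semigroupSymbol v A T ξ‖ = Real.exp (-(4 * Real.pi ^ 2 * T * quadForm A ξ)) := by
  rw [semigroupSymbol, Complex.norm_exp]
  congr 1
  have : (T : ℂ) * opSymbol v A ξ = ((-(4 * Real.pi ^ 2 * T * quadForm A ξ) : ℝ) : ℂ)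
      + ((2 * Real.pi * T * inner ℝ v ξ : ℝ) : ℂ) * Complex.I := by
    rw [opSymbol]; push_cast; ring
  rw [this, Complex.add_re, Complex.re_ofReal_mul, Complex.I_re, mul_zero, add_zero,
    Complex.ofReal_re]

lemma norm_cexp_neg_pi_sq (x : ℝ) :
    ‖Complex.exp (-Real.pi * (x : ℂ) ^ 2)‖ = Real.exp (-(Real.pi * x ^ 2)) := by
  rw [Complex.norm_exp]
  congr 1
  rw [show (-Real.pi * (x : ℂ) ^ 2 : ℂ) = ((-(Real.pi * x ^ 2) : ℝ) : ℂ) by push_cast; ring]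
  exact Complex.ofReal_re _

/-- Since t² ≤ T, transport and diffusion together damp at least like exp(-t²J²Q), with Q the
non-degeneracy quantity in the direction of ξ. Split the interval at Q = δ: the sublevel set is
small, and elsewhere the exponential is. -/
lemma IsKineticSolution.lintegral_sq_symbol_le (hK : IsKineticSolution lo hi f a σ H) {D α : ℝ}
    (hD : ∀ δ, 0 < δ → ∀ ξ : EuclideanSpace ℝ (Fin d), ‖ξ‖ = 1 →
      volume {l ∈ Icc lo hi | inner ℝ (f l) ξ ^ 2 + quadForm (a l) ξ ≤ δ}
        ≤ ENNReal.ofReal (D * δ ^ α)) (hD0 : 0 ≤ D)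
    {T t J δ : ℝ} (hJ : 0 < J) (hT : t ^ 2 ≤ T) (hδ : 0 < δ)
    {ξ : EuclideanSpace ℝ (Fin d)} (hξ : J ≤ ‖ξ‖) :
    ∫⁻ l in Icc lo hi, ‖Complex.exp (-Real.pi * ((t * inner ℝ (f l) ξ : ℝ) : ℂ) ^ 2)
        * semigroupSymbol (f l) (a l) T ξ‖ₑ ^ 2
      ≤ ENNReal.ofReal (D * δ ^ α + volume.real (Icc lo hi) * Real.exp (-(t ^ 2 * J ^ 2 * δ))) := by
  have hξ0 : 0 < ‖ξ‖ := hJ.trans_le hξ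
  set θ : EuclideanSpace ℝ (Fin d) := ‖ξ‖⁻¹ • ξ with hθ
  have hθ1 : ‖θ‖ = 1 := by rw [hθ, norm_smul, norm_inv, norm_norm, inv_mul_cancel₀ hξ0.ne']
  have hξθ : ξ = ‖ξ‖ • θ := by rw [hθ, smul_smul, mul_inv_cancel₀ hξ0.ne', one_smul]
  set Q : ℝ → ℝ := fun l => inner ℝ (f l) θ ^ 2 + quadForm (a l) θ with hQ
  have hqn : ∀ l, 0 ≤ quadForm (a l) θ := fun l => by
    rw [hK.sq l]; exact quadForm_sq_nonneg (hK.symm l) θ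
  have hQc : Continuous Q := by
    have h1 : Continuous fun l => quadForm (a l) θ :=
      continuous_finsetSum _ fun k _ => continuous_finsetSum _ fun j _ =>
        ((hK.a_cont k j).mul continuous_const).mul continuous_const
    exact ((hK.f_cont.inner continuous_const).pow 2).add h1
  set e : ℝ := Real.exp (-(t ^ 2 * J ^ 2 * δ)) with he
  have point : ∀ l, ‖Complex.exp (-Real.pi * ((t * inner ℝ (f l) ξ : ℝ) : ℂ) ^ 2)
        * semigroupSymbol (f l) (a l) T ξ‖ₑ ^ 2
      ≤ {l | Q l ≤ δ}.indicator 1 l + ENNReal.ofReal e := fun l => by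
    have hn : ‖Complex.exp (-Real.pi * ((t * inner ℝ (f l) ξ : ℝ) : ℂ) ^ 2)
        * semigroupSymbol (f l) (a l) T ξ‖ ^ 2 ≤ Real.exp (-(t ^ 2 * J ^ 2 * Q l)) := by
      rw [norm_mul, norm_cexp_neg_pi_sq, norm_semigroupSymbol, ← Real.exp_add, ← Real.exp_nat_mul,
        Real.exp_le_exp]
      have i1 : inner ℝ (f l) ξ = ‖ξ‖ * inner ℝ (f l) θ := by
        conv_lhs => rw [hξθ]
        rw [real_inner_smul_right]
      have i2 : quadForm (a l) ξ = ‖ξ‖ ^ 2 * quadForm (a l) θ := by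
        conv_lhs => rw [hξθ]
        rw [quadForm_smul]
      rw [i1, i2]
      have hp : 3 < Real.pi := Real.pi_gt_three
      have hJ2 : J ^ 2 ≤ ‖ξ‖ ^ 2 := by gcongr
      have a1 : t ^ 2 * J ^ 2 * quadForm (a l) θ ≤ T * ‖ξ‖ ^ 2 * quadForm (a l) θ :=
        mul_le_mul_of_nonneg_right (mul_le_mul hT hJ2 (by positivity) ((sq_nonneg t).trans hT))
          (hqn l)
      have a2 : t ^ 2 * J ^ 2 * inner ℝ (f l) θ ^ 2 ≤ t ^ 2 * ‖ξ‖ ^ 2 * inner ℝ (f l) θ ^ 2 := by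
        gcongr
      have hA : 0 ≤ T * ‖ξ‖ ^ 2 * quadForm (a l) θ :=
        mul_nonneg (mul_nonneg ((sq_nonneg t).trans hT) (sq_nonneg _)) (hqn l)
      have hB : 0 ≤ t ^ 2 * ‖ξ‖ ^ 2 * inner ℝ (f l) θ ^ 2 := by positivity
      have a3 : T * ‖ξ‖ ^ 2 * quadForm (a l) θ
          ≤ Real.pi ^ 2 * (T * ‖ξ‖ ^ 2 * quadForm (a l) θ) :=
        le_mul_of_one_le_left hA (by nlinarith)
      have a4 : t ^ 2 * ‖ξ‖ ^ 2 * inner ℝ (f l) θ ^ 2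
          ≤ Real.pi * (t ^ 2 * ‖ξ‖ ^ 2 * inner ℝ (f l) θ ^ 2) :=
        le_mul_of_one_le_left hB (by linarith)
      simp only [hQ]
      push_cast
      nlinarith
    have hx : ‖Complex.exp (-Real.pi * ((t * inner ℝ (f l) ξ : ℝ) : ℂ) ^ 2)
        * semigroupSymbol (f l) (a l) T ξ‖ₑ ^ 2 ≤ ENNReal.ofReal (Real.exp (-(t ^ 2 * J ^ 2 * Q l))) := by
      rw [← ofReal_norm, ← ENNReal.ofReal_pow (norm_nonneg _)]
      exact ENNReal.ofReal_le_ofReal hn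
    refine hx.trans ?_
    by_cases hl : Q l ≤ δ
    · rw [indicator_of_mem (by exact hl)]
      refine le_add_right ?_
      rw [Pi.one_apply, ← ENNReal.ofReal_one]
      refine ENNReal.ofReal_le_ofReal (Real.exp_le_one_iff.2 ?_)
      have : 0 ≤ Q l := add_nonneg (sq_nonneg _) (hqn l)
      have : 0 ≤ t ^ 2 * J ^ 2 * Q l := by positivity
      linarith
    · refine le_add_left (ENNReal.ofReal_le_ofReal (Real.exp_le_exp.2 (neg_le_neg ?_)))
      exact mul_le_mul_of_nonneg_left (not_le.1 hl).le (by positivity)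
  have hm : MeasurableSet {l | Q l ≤ δ} := measurableSet_le hQc.measurable measurable_const
  refine (lintegral_mono point).trans ?_
  have hI : volume (Icc lo hi) = ENNReal.ofReal (volume.real (Icc lo hi)) := by
    rw [measureReal_def, ENNReal.ofReal_toReal isCompact_Icc.measure_lt_top.ne]
  rw [lintegral_add_right _ measurable_const, lintegral_indicator_one hm, setLIntegral_const,
    Measure.restrict_apply hm, inter_comm, hI, ← ENNReal.ofReal_mul (Real.exp_nonneg _),
    ENNReal.ofReal_add (mul_nonneg hD0 (Real.rpow_nonneg hδ.le α)) (by positivity),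
    mul_comm e]
  gcongr
  exact hD δ hδ θ hθ1

/-- The k-th power of the inequality x/k ≤ exp(x/k). -/
lemma rpow_le_mul_exp {k x : ℝ} (hk : 0 < k) (hx : 0 < x) : x ^ k ≤ k ^ k * Real.exp x := by
  have h1 : x / k ≤ Real.exp (x / k) := by linarith [Real.add_one_le_exp (x / k)]
  have h2 := Real.rpow_le_rpow (by positivity) h1 hk.le
  rw [← Real.exp_mul, div_mul_cancel₀ _ hk.ne', Real.div_rpow hx.le hk.le,
    div_le_iff₀ (Real.rpow_pos_of_pos hk k)] at h2
  linarith

/-- Decay of the frequency-localised pairing with a kinetic solution. -/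
lemma IsKineticSolution.exists_pairing_decay (hK : IsKineticSolution lo hi f a σ H)
    (hφ : ContDiff ℝ ∞ φ) (hφc : HasCompactSupport φ) (hρ : ContDiff ℝ 1 ρ)
    (hρI : tsupport ρ ⊆ Icc lo hi) {D α : ℝ} (hα : 0 < α) (hD0 : 0 ≤ D)
    (hD : ∀ δ, 0 < δ → ∀ ξ : EuclideanSpace ℝ (Fin d), ‖ξ‖ = 1 →
      volume {l ∈ Icc lo hi | inner ℝ (f l) ξ ^ 2 + quadForm (a l) ξ ≤ δ}
        ≤ ENNReal.ofReal (D * δ ^ α)) {s : ℝ} (hs0 : 0 < s) (hs : s < α / (3 * (1 + α))) :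
    ∃ C : ℝ, 0 ≤ C ∧ ∀ μ J, 1 ≤ J → IsBand μ J →
      ‖pairing H ρ φ (fun p => synth μ p.1)‖ ≤ C * J ^ (-s) := by
  obtain ⟨C₁, hC₁, h₁⟩ := hK.exists_semigroup_smoothing hφ hφc hρ hρI
  obtain ⟨C₂, hC₂, h₂⟩ := hK.exists_transport_smoothing hφ hφc hρ hρI
  obtain ⟨C₃, hC₃, h₃⟩ := exists_norm_pairing_le_of_sq hK.meas hK.bdd hφ.continuous hφc hρ hρI
  -- The level is δ = J^(-p), so that δ^α = J^(-2s). The number `η` is the room left by s < α / (3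
  -- (1 + α)): it is positive exactly when 3s + 3s/α < 1.
  set p : ℝ := 2 * s / α with hp
  set η : ℝ := (1 - 3 * s - 3 * p / 2) / 3 with hη
  have hpα : p * α = 2 * s := by rw [hp]; field_simp
  have hp0 : 0 < p := by positivity
  have hη0 : 0 < η := by
    rw [lt_div_iff₀ (by positivity)] at hs
    have : 3 * s + 3 * p / 2 < 1 := by
      have : α * (3 * s + 3 * p / 2) < α * 1 := by nlinarith
      exact lt_of_mul_lt_mul_left this hα.le
    rw [hη]; linarith
  -- With ηk = s, exp(-J^(2η)) is at most k^k J^(-2ηk) = k^k J^(-2s).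
  set k : ℝ := s / η with hk
  have hk0 : 0 < k := by positivity
  have hkη : η * k = s := by rw [hk]; field_simp
  set Y : ℝ := 1 + D + volume.real (Icc lo hi) * k ^ k with hY
  have hY0 : 0 < Y := by positivity
  refine ⟨2 * C₁ + 4 * C₂ + C₃ * Real.sqrt Y, by positivity, fun μ J hJ hμ => ?_⟩
  have hJ0 : 0 < J := by linarith
  have hadd : ∀ x y : ℝ, J ^ x * J ^ y = J ^ (x + y) := fun x y => (Real.rpow_add hJ0 x y).symm
  have hmono : ∀ x y : ℝ, x ≤ y → J ^ x ≤ J ^ y := fun x y h =>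
    Real.rpow_le_rpow_of_exponent_le hJ h
  have hpos : ∀ x : ℝ, 0 < J ^ x := fun x => Real.rpow_pos_of_pos hJ0 x
  have hpow : ∀ (x : ℝ) (n : ℕ), (J ^ x) ^ n = J ^ (x * n) := fun x n => by
    rw [Real.rpow_mul hJ0.le, Real.rpow_natCast]
  have hJ1 : J ^ (1 : ℝ) = J := Real.rpow_one J
  have hJ2 : J ^ (2 : ℝ) = J ^ 2 := Real.rpow_two J
  -- The value of `η` makes e = 2/3, hence T = J^(-4/3) and t = J^(-2/3-s); moreover t²J²δ = J^(2η).
  set e : ℝ := 2 * s + p + 2 * η with he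
  set T : ℝ := J ^ (e - 2) with hT
  set t : ℝ := J ^ (-1 + p / 2 + η) with ht
  have hT0 : 0 < T := hpos _
  have ht0 : 0 < t := hpos _
  have hηeq : 3 * η = 1 - 3 * s - 3 * p / 2 := by rw [hη]; ring
  set g : ℝ → EuclideanSpace ℝ (Fin d) → ℂ := fun l ξ =>
    Complex.exp (-Real.pi * ((t * inner ℝ (f l) ξ : ℝ) : ℂ) ^ 2)
      * semigroupSymbol (f l) (a l) T ξ with hg
  have hgc : Continuous (Function.uncurry g) := by
    have c1 : Continuous fun q : ℝ × EuclideanSpace ℝ (Fin d) => opSymbol (f q.1) (a q.1) q.2 :=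
      hK.continuous_opSymbol continuous_fst continuous_snd
    have c2 : Continuous fun q : ℝ × EuclideanSpace ℝ (Fin d) => f q.1 :=
      hK.f_cont.comp continuous_fst
    have c3 : Continuous fun q : ℝ × EuclideanSpace ℝ (Fin d) => inner ℝ (f q.1) q.2 :=
      c2.inner continuous_snd
    have c4 : Continuous fun q : ℝ × EuclideanSpace ℝ (Fin d) =>
        Complex.exp (-Real.pi * ((t * inner ℝ (f q.1) q.2 : ℝ) : ℂ) ^ 2) := by fun_prop
    exact c4.mul (Complex.continuous_exp.comp (continuous_const.mul c1))
  have b1 := h₁ μ J hJ hμ T hT0.le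
  have b2 := h₂ μ J hJ hμ T hT0 t ht0.le
  have b3 : ‖pairing H ρ φ (synthFamily g μ)‖ ≤ C₃ * (Real.sqrt Y * J ^ (-s)) := by
    refine h₃ g hgc μ J hμ _ (mul_pos (Real.sqrt_pos.2 hY0) (hpos _)) fun ξ hξ _ => ?_
    refine (hK.lintegral_sq_symbol_le hD hD0 hJ0 (T := T) (t := t) ?_ (hpos (-p)) hξ).trans
      (ENNReal.ofReal_le_ofReal ?_)
    · rw [ht, hT, hpow]
      exact hmono _ _ (by push_cast; linarith)
    · have e1 : (J ^ (-p)) ^ α = J ^ (-(2 * s)) := by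
        rw [← Real.rpow_mul hJ0.le]; congr 1; linarith
      have e2 : t ^ 2 * J ^ 2 * J ^ (-p) = J ^ (2 * η) := by
        rw [ht, hpow, ← hJ2, hadd, hadd]; congr 1; push_cast; ring
      have e3 : Real.exp (-J ^ (2 * η)) ≤ k ^ k * J ^ (-(2 * s)) := by
        have := rpow_le_mul_exp hk0 (hpos (2 * η))
        rw [← Real.rpow_mul hJ0.le, mul_assoc, hkη] at this
        rw [Real.exp_neg, Real.rpow_neg hJ0.le, ← div_eq_mul_inv, inv_eq_one_div,
          div_le_div_iff₀ (Real.exp_pos _) (hpos _)]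
        linarith
      have e4 : (Real.sqrt Y * J ^ (-s)) ^ 2 = Y * J ^ (-(2 * s)) := by
        rw [mul_pow, Real.sq_sqrt hY0.le, hpow]; congr 2; push_cast; ring
      rw [e1, e2, e4, hY]
      have := mul_le_mul_of_nonneg_left e3 (measureReal_nonneg (μ := volume) (s := Icc lo hi))
      nlinarith [hpos (-(2 * s))]
  have r1 : (J + T * J ^ 2) * T ≤ 2 * J ^ (-s) := by
    have e1 : J * T = J ^ (1 + (e - 2)) := by rw [← hadd, hJ1]
    have e2 : T * J ^ 2 * T = J ^ (e - 2 + 2 + (e - 2)) := by rw [← hJ2, hadd, hadd]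
    rw [add_mul, e1, e2]
    have := hmono (1 + (e - 2)) (-s) (by linarith)
    have := hmono (e - 2 + 2 + (e - 2)) (-s) (by linarith)
    linarith
  -- The last two terms balance: TJ² and T^(-1/2) both equal J^(2/3), and J^(2/3) t = J^(-s). This
  -- fixes T and t.
  have r2 : (1 + t * J + T * J ^ 2 + (Real.sqrt T)⁻¹) * t ≤ 4 * J ^ (-s) := by
    have e0 : (Real.sqrt T)⁻¹ = J ^ (-((e - 2) / 2)) := by
      rw [Real.sqrt_eq_rpow, hT, ← Real.rpow_mul hJ0.le, Real.rpow_neg hJ0.le]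
      congr 2; ring
    have e1 : t * J * t = J ^ (-1 + p / 2 + η + 1 + (-1 + p / 2 + η)) := by
      conv_lhs => rw [← hJ1, hadd, hadd]
    have e2 : T * J ^ 2 * t = J ^ (e - 2 + 2 + (-1 + p / 2 + η)) := by rw [← hJ2, hadd, hadd]
    rw [add_mul, add_mul, add_mul, one_mul, e1, e2, e0, ht, hadd]
    have := hmono (-1 + p / 2 + η) (-s) (by linarith)
    have := hmono (-1 + p / 2 + η + 1 + (-1 + p / 2 + η)) (-s) (by linarith)
    have := hmono (e - 2 + 2 + (-1 + p / 2 + η)) (-s) (by linarith)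
    have := hmono (-((e - 2) / 2) + (-1 + p / 2 + η)) (-s) (by linarith)
    linarith
  have tri : ‖pairing H ρ φ (fun p => synth μ p.1)‖
      ≤ C₁ * (J + T * J ^ 2) * T + C₂ * (1 + t * J + T * J ^ 2 + (Real.sqrt T)⁻¹) * t
        + C₃ * (Real.sqrt Y * J ^ (-s)) := by
    have q1 := norm_le_norm_add_norm_sub
      (pairing H ρ φ (synthFamily (fun l => semigroupSymbol (f l) (a l) T) μ))
      (pairing H ρ φ (fun p => synth μ p.1))
    have q2 := norm_le_norm_add_norm_sub (pairing H ρ φ (synthFamily g μ))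
      (pairing H ρ φ (synthFamily (fun l => semigroupSymbol (f l) (a l) T) μ))
    linarith
  have s1 := mul_le_mul_of_nonneg_left r1 hC₁
  have s2 := mul_le_mul_of_nonneg_left r2 hC₂
  nlinarith

end Decay

/-! ### Fourier amplitudes of bounded functions and frequency cut-offs -/

section Amplitude

open scoped FourierTransform SchwartzMap

variable {V : Type*} [NormedAddCommGroup V] [InnerProductSpace ℝ V]
  [MeasurableSpace V] [BorelSpace V] [FiniteDimensional ℝ V]

/-- The amplitude of the plane waves whose superposition is `b`, i.e. its Fourier transform. -/
noncomputable def amplitude (b : V → ℂ) (ξ : V) : ℂ := synth b (-ξ)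

omit [MeasurableSpace V] [BorelSpace V] [FiniteDimensional ℝ V] in
lemma wave_neg_right (x ξ : V) : wave x (-ξ) = wave (-x) ξ := by
  simp [wave, inner_neg_left, inner_neg_right]

lemma continuous_amplitude {b : V → ℂ} (hb : Integrable b) : Continuous (amplitude b) :=
  (continuous_synth hb).comp continuous_neg

lemma integrable_amplitude_mul {b w : V → ℂ} (hb : Integrable b) (hw : Integrable w) :
    Integrable fun ξ => amplitude b ξ * w ξ :=
  hw.bdd_mul (continuous_amplitude hb).aestronglyMeasurable
    (ae_of_all _ fun ξ => norm_synth_le (-ξ))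

/-- Translation becomes multiplication by a plane wave, so differences of `b` can be studied shell
by shell. -/
lemma amplitude_translate_sub {b : V → ℂ} (hb : Integrable b) (z ξ : V) :
    amplitude (fun x => b (x - z) - b x) ξ = (wave (-z) ξ - 1) * amplitude b ξ := by
  rw [amplitude, synth_sub (hb.comp_sub_right z) hb, sub_mul, one_mul]
  congr 1
  have h := integral_sub_right_eq_self (fun x => b x * wave (-ξ) (x + z)) (μ := volume) z
  simp only [sub_add_cancel] at h
  rw [synth]
  simp only [wave_comm (-ξ)] at h ⊢
  rw [h, amplitude, synth, ← integral_const_mul]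
  refine integral_congr_ae (ae_of_all _ fun x => ?_)
  simp only
  rw [wave_neg_right, neg_add, wave_add, wave_comm (-ξ) x, wave_neg_right]
  ring

lemma synth_amplitude_mul {b w : V → ℂ} (hb : Integrable b) (hw : Integrable w) (x : V) :
    synth (fun ξ => amplitude b ξ * w ξ) x = ∫ y, b y * synth w (x - y) := by
  have hg : Integrable fun ξ => w (-ξ) * wave x (-ξ) := (integrable_mul_wave hw x).comp_neg
  calc synth (fun ξ => amplitude b ξ * w ξ) x
      = ∫ ξ, (fun ξ => w (-ξ) * wave x (-ξ) * synth b ξ) (-ξ) := by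
        rw [synth]
        refine integral_congr_ae (ae_of_all _ fun ξ => ?_)
        simp only [amplitude, neg_neg]; ring
    _ = ∫ ξ, w (-ξ) * wave x (-ξ) * synth b ξ :=
        integral_neg_eq_self (fun ξ => w (-ξ) * wave x (-ξ) * synth b ξ) volume
    _ = ∫ y, b y * synth (fun ξ => w (-ξ) * wave x (-ξ)) y := integral_mul_synth hg hb
    _ = ∫ y, b y * synth w (x - y) := by
        refine integral_congr_ae (ae_of_all _ fun y => ?_)
        simp only
        congr 1
        rw [synth, ← integral_neg_eq_self, synth]
        refine integral_congr_ae (ae_of_all _ fun ξ => ?_)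
        simp only [neg_neg, wave_neg_right, sub_eq_add_neg, wave_add]
        ring

lemma norm_synth_amplitude_mul_le {b w : V → ℂ} (hb : Integrable b) (hb1 : ∀ x, ‖b x‖ ≤ 1)
    (hw : Integrable w) (hws : Integrable (synth w)) (x : V) :
    ‖synth (fun ξ => amplitude b ξ * w ξ) x‖ ≤ ∫ y, ‖synth w y‖ := by
  rw [synth_amplitude_mul hb hw, ← integral_sub_left_eq_self (fun y => ‖synth w y‖) volume x]
  refine norm_integral_le_of_norm_le (hws.norm.comp_sub_left x) (ae_of_all _ fun y => ?_)
  rw [norm_mul]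
  exact mul_le_of_le_one_left (norm_nonneg _) (hb1 y)

lemma integrable_synth_of_contDiff {w : V → ℂ} (hw : ContDiff ℝ ∞ w) (hwc : HasCompactSupport w) :
    Integrable (synth w) := by
  have h := (𝓕⁻ (hwc.toSchwartzMap hw) : 𝓢(V, ℂ)).integrable (μ := volume)
  rw [SchwartzMap.fourierInv_coe] at h
  rw [synth_eq_fourierInv]
  exact h

lemma synth_comp_inv_smul (w : V → ℂ) {J : ℝ} (hJ : 0 < J) (x : V) :
    synth (fun ξ => w (J⁻¹ • ξ)) x = (J ^ Module.finrank ℝ V : ℝ) • synth w (J • x) := by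
  have h := Measure.integral_comp_inv_smul_of_nonneg (volume : Measure V)
    (fun ξ => w ξ * wave (J • x) ξ) hJ.le
  rw [synth, synth, ← h]
  refine integral_congr_ae (ae_of_all _ fun ξ => ?_)
  simp only [wave, real_inner_smul_left, real_inner_smul_right, inv_mul_cancel_left₀ hJ.ne']

lemma integral_norm_synth_comp_inv_smul (w : V → ℂ) {J : ℝ} (hJ : 0 < J) :
    ∫ x, ‖synth (fun ξ => w (J⁻¹ • ξ)) x‖ = ∫ x, ‖synth w x‖ := by
  have h := Measure.integral_comp_smul_of_nonneg (volume : Measure V) (fun x => ‖synth w x‖) J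
    (hR := hJ.le)
  have hp : 0 < J ^ Module.finrank ℝ V := by positivity
  simp only [synth_comp_inv_smul w hJ, norm_smul, Real.norm_of_nonneg hp.le]
  rw [integral_const_mul, h, smul_eq_mul, mul_inv_cancel_left₀ hp.ne']

lemma integrable_synth_comp_inv_smul {w : V → ℂ} (hw : Integrable (synth w)) {J : ℝ} (hJ : 0 < J) :
    Integrable (synth fun ξ => w (J⁻¹ • ξ)) := by
  have : synth (fun ξ => w (J⁻¹ • ξ)) = fun x => (J ^ Module.finrank ℝ V : ℝ) • synth w (J • x) :=
    funext fun x => synth_comp_inv_smul w hJ x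
  rw [this]
  exact (hw.comp_smul hJ.ne').smul (J ^ Module.finrank ℝ V : ℝ)

lemma integrable_comp_inv_smul {w : V → ℂ} (hw : ContDiff ℝ ∞ w) (hwc : HasCompactSupport w) {J : ℝ}
    (hJ : 0 < J) : Integrable fun ξ => w (J⁻¹ • ξ) :=
  (hw.continuous.integrable_of_hasCompactSupport hwc).comp_smul (inv_ne_zero hJ.ne')

/-- The cut-off at scale J is a convolution with a dilated kernel; dilation preserves its L¹ norm,
so the constant is independent of J. -/
lemma exists_norm_synth_amplitude_le {w : V → ℂ} (hw : ContDiff ℝ ∞ w)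
    (hwc : HasCompactSupport w) : ∃ C : ℝ, 0 ≤ C ∧ ∀ J : ℝ, 0 < J → ∀ b : V → ℂ, Integrable b →
      (∀ x, ‖b x‖ ≤ 1) → ∀ x, ‖synth (fun ξ => amplitude b ξ * w (J⁻¹ • ξ)) x‖ ≤ C := by
  refine ⟨∫ y, ‖synth w y‖, integral_nonneg fun _ => norm_nonneg _, fun J hJ b hb hb1 x => ?_⟩
  rw [← integral_norm_synth_comp_inv_smul w hJ]
  exact norm_synth_amplitude_mul_le hb hb1 (integrable_comp_inv_smul hw hwc hJ)
    (integrable_synth_comp_inv_smul (integrable_synth_of_contDiff hw hwc) hJ) x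

end Amplitude

/-! ### Translation differences of frequency-localised functions -/

section Differences

variable {d : ℕ}

lemma min_one_le_rpow {x r : ℝ} (hx : 0 ≤ x) (hr0 : 0 ≤ r) (hr1 : r ≤ 1) : min 1 x ≤ x ^ r := by
  rcases le_or_gt 1 x with h | h
  · exact (min_le_left _ _).trans (Real.one_le_rpow h hr0)
  · refine (min_le_right _ _).trans ?_
    rcases hx.eq_or_lt with h0 | h0
    · rw [← h0]; exact Real.rpow_nonneg le_rfl r
    · simpa using Real.rpow_le_rpow_of_exponent_ge h0 h.le hr1

/-- Interpolates, by min(1, x) ≤ x^r, between the trivial bound on a difference and the mean value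
bound, where a derivative costs J and the displacement is ‖z‖. -/
lemma exists_norm_synth_difference_le {w : EuclideanSpace ℝ (Fin d) → ℂ} (hw : ContDiff ℝ ∞ w)
    (hwc : HasCompactSupport w) {r : ℝ} (hr0 : 0 ≤ r) (hr1 : r ≤ 1) :
    ∃ C : ℝ, 0 ≤ C ∧ ∀ J : ℝ, 0 < J → ∀ b : EuclideanSpace ℝ (Fin d) → ℂ, Integrable b →
      (∀ x, ‖b x‖ ≤ 1) → ∀ z x,
      ‖synth (fun ξ => (wave z ξ - 1) * (amplitude b ξ * w (J⁻¹ • ξ))) x‖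
        ≤ C * (J * ‖z‖) ^ r := by
  obtain ⟨C, hC, h⟩ := exists_norm_synth_amplitude_le hw hwc
  have hwj : ∀ j : Fin d, ContDiff ℝ ∞ fun ξ : EuclideanSpace ℝ (Fin d) => (ξ j : ℂ) * w ξ :=
    fun j => (Complex.ofRealCLM.contDiff.comp (EuclideanSpace.proj j :
      EuclideanSpace ℝ (Fin d) →L[ℝ] ℝ).contDiff).mul hw
  choose D hD hD' using fun j => exists_norm_synth_amplitude_le (hwj j) hwc.mul_left
  obtain ⟨R, hR⟩ := hwc.isCompact.isBounded.subset_closedBall (0 : EuclideanSpace ℝ (Fin d))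
  refine ⟨2 * C + 2 * Real.pi * ∑ j, D j, by
    have := Finset.sum_nonneg fun j (_ : j ∈ Finset.univ) => hD j
    positivity, fun J hJ b hb hb1 z x => ?_⟩
  have hDs := Finset.sum_nonneg fun j (_ : j ∈ Finset.univ) => hD j
  set ν : EuclideanSpace ℝ (Fin d) → ℂ := fun ξ => amplitude b ξ * w (J⁻¹ • ξ) with hν
  have hνi : Integrable ν := integrable_amplitude_mul hb (integrable_comp_inv_smul hw hwc hJ)
  have hνR : ∀ ξ, J * R < ‖ξ‖ → ν ξ = 0 := fun ξ hξ => by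
    have : w (J⁻¹ • ξ) = 0 := by
      refine image_eq_zero_of_notMem_tsupport fun hm => ?_
      have := mem_closedBall_zero_iff.1 (hR hm)
      rw [norm_smul, norm_inv, Real.norm_of_nonneg hJ.le, inv_mul_le_iff₀ hJ] at this
      linarith
    simp [hν, this]
  have b1 : ‖synth (fun ξ => (wave z ξ - 1) * ν ξ) x‖ ≤ 2 * C := by
    have hwν := (supMult_wave z).integrable_mul hνi
    have e : synth (fun ξ => (wave z ξ - 1) * ν ξ) x
        = synth (fun ξ => wave z ξ * ν ξ) x - synth ν x := by
      rw [← synth_sub hwν hνi]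
      congr 1; ext ξ; ring
    rw [e]
    have h1 := (supMult_wave z).bound ν hνi C (h J hJ b hb hb1) x
    have h2 := h J hJ b hb hb1 x
    refine (norm_sub_le _ _).trans ?_
    linarith
  have b2 : ‖synth (fun ξ => (wave z ξ - 1) * ν ξ) x‖ ≤ 2 * Real.pi * (∑ j, D j) * (J * ‖z‖) := by
    have hlin : ∀ y, ‖synth (fun ξ => ((inner ℝ z ξ : ℝ) : ℂ) * ν ξ) y‖
        ≤ (∑ j, D j) * (J * ‖z‖) := fun y => by
      have e : (fun ξ => ((inner ℝ z ξ : ℝ) : ℂ) * ν ξ)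
          = fun ξ => ∑ j, ((z j * J : ℝ) : ℂ) * (amplitude b ξ
            * (fun ζ : EuclideanSpace ℝ (Fin d) => (ζ j : ℂ) * w ζ) (J⁻¹ • ξ)) := by
        ext ξ
        rw [inner_eq_sum]; push_cast; rw [Finset.sum_mul]
        refine Finset.sum_congr rfl fun j _ => ?_
        simp only [hν, PiLp.smul_apply, smul_eq_mul]
        have : (J : ℂ) ≠ 0 := by exact_mod_cast hJ.ne'
        push_cast
        field_simp
      rw [e, synth_finset_sum _ fun j _ => (integrable_amplitude_mul hb
        (integrable_comp_inv_smul (hwj j) hwc.mul_left hJ)).const_mul _, Finset.sum_mul]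
      refine (norm_sum_le _ _).trans (Finset.sum_le_sum fun j _ => ?_)
      rw [synth_const_mul, norm_mul, Complex.norm_real, mul_comm (D j)]
      refine mul_le_mul ?_ (hD' j J hJ b hb hb1 y) (norm_nonneg _) (by positivity)
      rw [norm_mul, Real.norm_of_nonneg hJ.le, mul_comm]
      exact mul_le_mul_of_nonneg_left (PiLp.norm_apply_le z j) hJ.le
    have cw : Continuous fun p : ℝ × EuclideanSpace ℝ (Fin d) => wave (p.1 • z) p.2 :=
      continuous_wave.comp ((continuous_fst.smul continuous_const).prodMk continuous_snd)
    have ci : Continuous fun p : ℝ × EuclideanSpace ℝ (Fin d) =>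
        (2 * Real.pi * Complex.I * ((inner ℝ z p.2 : ℝ) : ℂ) : ℂ) := by fun_prop
    have hli : Integrable fun ξ => ((inner ℝ z ξ : ℝ) : ℂ) * ν ξ :=
      integrable_symbol_mul hνi hνR (by fun_prop)
    have key := norm_synth_sub_le hνi hνR (m := fun s ξ => wave (s • z) ξ)
      (m' := fun s ξ => 2 * Real.pi * Complex.I * ((inner ℝ z ξ : ℝ) : ℂ) * wave (s • z) ξ)
      cw (ci.mul cw) (fun s ξ => by simpa using hasDerivAt_wave_smul 0 z ξ s)
      (D := 2 * Real.pi * (∑ j, D j) * (J * ‖z‖)) x (fun s _ => ?_)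
    · simpa [wave_zero] using key
    · have e : (fun ξ => 2 * Real.pi * Complex.I * ((inner ℝ z ξ : ℝ) : ℂ) * wave (s • z) ξ * ν ξ)
          = fun ξ => (2 * Real.pi * Complex.I) *
            (wave (s • z) ξ * (((inner ℝ z ξ : ℝ) : ℂ) * ν ξ)) := by ext ξ; ring
      rw [e, synth_const_mul, norm_mul, mul_assoc (2 * Real.pi)]
      have n1 : ‖(2 * Real.pi * Complex.I : ℂ)‖ = 2 * Real.pi := by simp [Real.pi_pos.le]
      rw [n1]
      refine mul_le_mul_of_nonneg_left ?_ (by positivity)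
      simpa using (supMult_wave (s • z)).bound _ hli _ hlin x
  have hmin := min_one_le_rpow (mul_nonneg hJ.le (norm_nonneg z)) hr0 hr1
  refine le_trans ?_ (mul_le_mul_of_nonneg_left hmin (by positivity))
  rcases le_total 1 (J * ‖z‖) with h1 | h1
  · rw [min_eq_left h1]
    have : 0 ≤ 2 * Real.pi * ∑ j, D j := by positivity
    linarith
  · rw [min_eq_right h1]
    have : 0 ≤ 2 * C * (J * ‖z‖) := by positivity
    linarith

end Differences

/-! ### Dyadic frequency shells -/

section Bands

variable {d : ℕ}

lemma isBand_const_mul {ν : EuclideanSpace ℝ (Fin d) → ℂ} {J D : ℝ} (hD : 0 < D)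
    (int : Integrable ν) (supp : ∀ ξ, 4 * J < ‖ξ‖ → ν ξ = 0) (low : ∀ ξ, ‖ξ‖ < J → ν ξ = 0)
    (h0 : ∀ x, ‖synth ν x‖ ≤ D) (h1 : ∀ j x, ‖synth (fun ξ => (ξ j : ℂ) * ν ξ) x‖ ≤ D * J)
    (h2 : ∀ i j x, ‖synth (fun ξ => (ξ i : ℂ) * ((ξ j : ℂ) * ν ξ)) x‖ ≤ D * J ^ 2)
    (hsq : ∫⁻ ξ, ‖ν ξ‖ₑ ^ 2 ≤ ENNReal.ofReal (D ^ 2)) :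
    IsBand (fun ξ => ((D⁻¹ : ℝ) : ℂ) * ν ξ) J := by
  have n : ‖((D⁻¹ : ℝ) : ℂ)‖ = D⁻¹ := by
    rw [Complex.norm_real, Real.norm_of_nonneg (by positivity)]
  refine ⟨int.const_mul _, fun ξ h => by simp [supp ξ h], fun ξ h => by simp [low ξ h],
    fun x => ?_, fun j x => ?_, fun i j x => ?_, ?_⟩
  · rw [synth_const_mul, norm_mul, n, inv_mul_le_iff₀ hD, mul_one]
    exact h0 x
  · simp only [mul_left_comm _ ((D⁻¹ : ℝ) : ℂ)]
    rw [synth_const_mul, norm_mul, n, inv_mul_le_iff₀ hD]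
    exact h1 j x
  · simp only [mul_left_comm _ ((D⁻¹ : ℝ) : ℂ)]
    rw [synth_const_mul, norm_mul, n, inv_mul_le_iff₀ hD]
    exact h2 i j x
  · have e : ‖((D⁻¹ : ℝ) : ℂ)‖ₑ = ENNReal.ofReal D⁻¹ := by rw [← ofReal_norm, n]
    simp only [enorm_mul, mul_pow, e]
    rw [lintegral_const_mul' _ _ (by simp)]
    calc _ ≤ ENNReal.ofReal D⁻¹ ^ 2 * ENNReal.ofReal (D ^ 2) := by gcongr
      _ = 1 := by
        rw [← ENNReal.ofReal_pow (by positivity), ← ENNReal.ofReal_mul (by positivity),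
          ← ENNReal.ofReal_one]
        congr 1; field_simp

/-- The difference of two dyadic dilates of a cut-off function. -/
noncomputable def dyadicDiff (χ : ContDiffBump (0 : EuclideanSpace ℝ (Fin d)))
    (ξ : EuclideanSpace ℝ (Fin d)) : ℂ := ((χ ((2 : ℝ)⁻¹ • ξ) : ℝ) : ℂ) - ((χ ξ : ℝ) : ℂ)

variable {χ : ContDiffBump (0 : EuclideanSpace ℝ (Fin d))}

lemma contDiff_bump : ContDiff ℝ ∞ fun ξ => ((χ ξ : ℝ) : ℂ) :=
  Complex.ofRealCLM.contDiff.comp χ.contDiff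

lemma hasCompactSupport_bump : HasCompactSupport fun ξ => ((χ ξ : ℝ) : ℂ) :=
  χ.hasCompactSupport.comp_left (g := fun t : ℝ => (t : ℂ)) Complex.ofReal_zero

lemma contDiff_dyadicDiff : ContDiff ℝ ∞ (dyadicDiff χ) :=
  (contDiff_bump.comp (contDiff_const_smul _)).sub contDiff_bump

/-- The radii 1 and 2 of the cut-off place the difference in the shell 1 ≤ ‖ξ‖ ≤ 4, the one fixed in
`IsBand`. -/
lemma dyadicDiff_eq_zero_of_lt (h1 : χ.rIn = 1) {ξ : EuclideanSpace ℝ (Fin d)} (hξ : ‖ξ‖ < 1) :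
    dyadicDiff χ ξ = 0 := by
  have a : χ ξ = 1 := χ.one_of_mem_closedBall (by simpa [h1] using hξ.le)
  have b : χ ((2 : ℝ)⁻¹ • ξ) = 1 := χ.one_of_mem_closedBall (by
    rw [mem_closedBall_zero_iff, norm_smul, h1, norm_inv, Real.norm_two]; linarith)
  simp [dyadicDiff, a, b]

lemma dyadicDiff_eq_zero_of_gt (h2 : χ.rOut = 2) {ξ : EuclideanSpace ℝ (Fin d)} (hξ : 4 < ‖ξ‖) :
    dyadicDiff χ ξ = 0 := by
  have a : χ ξ = 0 := χ.zero_of_le_dist (by rw [dist_zero_right, h2]; linarith)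
  have b : χ ((2 : ℝ)⁻¹ • ξ) = 0 := χ.zero_of_le_dist (by
    rw [dist_zero_right, norm_smul, h2, norm_inv, Real.norm_two]; linarith)
  simp [dyadicDiff, a, b]

lemma hasCompactSupport_dyadicDiff (h2 : χ.rOut = 2) : HasCompactSupport (dyadicDiff χ) :=
  HasCompactSupport.intro (isCompact_closedBall (0 : EuclideanSpace ℝ (Fin d)) 4) fun ξ hξ =>
    dyadicDiff_eq_zero_of_gt h2 (by simpa using hξ)

lemma norm_dyadicDiff_le (ξ : EuclideanSpace ℝ (Fin d)) : ‖dyadicDiff χ ξ‖ ≤ 1 := by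
  rw [dyadicDiff, ← Complex.ofReal_sub, Complex.norm_real, Real.norm_eq_abs, abs_le]
  have := χ.nonneg (x := ξ)
  have := χ.le_one (x := ξ)
  have := χ.nonneg (x := (2 : ℝ)⁻¹ • ξ)
  have := χ.le_one (x := (2 : ℝ)⁻¹ • ξ)
  constructor <;> linarith

lemma norm_wave_sub_one_le (z ξ : EuclideanSpace ℝ (Fin d)) :
    ‖wave z ξ - 1‖ ≤ min 2 (2 * Real.pi * (‖z‖ * ‖ξ‖)) := by
  refine le_min ((norm_sub_le _ _).trans (by rw [norm_wave, norm_one]; norm_num)) ?_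
  have h := Real.norm_exp_I_mul_ofReal_sub_one_le (x := 2 * Real.pi * inner ℝ z ξ)
  rw [mul_comm Complex.I] at h
  refine h.trans ?_
  rw [norm_mul, Real.norm_of_nonneg (by positivity)]
  exact mul_le_mul_of_nonneg_left (norm_inner_le_norm z ξ) (by positivity)

lemma integrable_wave_sub_mul {z : EuclideanSpace ℝ (Fin d)} {ν : EuclideanSpace ℝ (Fin d) → ℂ}
    (hν : Integrable ν) : Integrable fun ξ => (wave z ξ - 1) * ν ξ := by
  have := ((supMult_wave z).integrable_mul hν).sub hν
  refine this.congr (ae_of_all _ fun ξ => ?_)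
  simp only [Pi.sub_apply]; ring

lemma lintegral_sq_amplitude {b : EuclideanSpace ℝ (Fin d) → ℂ} (hb : Integrable b)
    (hb2 : MemLp b 2) : ∫⁻ ξ, ‖amplitude b ξ‖ₑ ^ 2 = ∫⁻ x, ‖b x‖ₑ ^ 2 := by
  rw [← lintegral_sq_synth hb hb2]
  exact lintegral_neg_eq_self (μ := volume) fun ξ => ‖synth b ξ‖ₑ ^ 2

/-- The dyadic pieces of a translation difference of a bounded function are band-limited. -/
lemma exists_isBand_difference (h1 : χ.rIn = 1) (h2 : χ.rOut = 2) {r : ℝ} (hr0 : 0 ≤ r)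
    (hr1 : r ≤ 1) {A : ℝ} (hA : 0 ≤ A) :
    ∃ C : ℝ, 0 < C ∧ ∀ J : ℝ, 0 < J → ∀ b : EuclideanSpace ℝ (Fin d) → ℂ, Integrable b →
      (∀ x, ‖b x‖ ≤ 1) → ∫⁻ x, ‖b x‖ₑ ^ 2 ≤ ENNReal.ofReal (A ^ 2) → ∀ z, z ≠ 0 →
      IsBand (fun ξ => (((C * (J * ‖z‖) ^ r)⁻¹ : ℝ) : ℂ)
        * ((wave z ξ - 1) * (amplitude b ξ * dyadicDiff χ (J⁻¹ • ξ)))) J := by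
  have hκ := contDiff_dyadicDiff (χ := χ)
  have hκc := hasCompactSupport_dyadicDiff h2
  have cj : ∀ j : Fin d, ContDiff ℝ ∞ fun ξ : EuclideanSpace ℝ (Fin d) => (ξ j : ℂ) :=
    fun j => Complex.ofRealCLM.contDiff.comp (EuclideanSpace.proj j :
      EuclideanSpace ℝ (Fin d) →L[ℝ] ℝ).contDiff
  obtain ⟨C0, hC0, b0⟩ := exists_norm_synth_difference_le hκ hκc hr0 hr1
  choose C1 hC1 b1 using fun j => exists_norm_synth_difference_le ((cj j).mul hκ) hκc.mul_left
    hr0 hr1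
  choose C2 hC2 b2 using fun i j => exists_norm_synth_difference_le ((cj i).mul ((cj j).mul hκ))
    hκc.mul_left.mul_left hr0 hr1
  have s1 : 0 ≤ ∑ j, C1 j := Finset.sum_nonneg fun j _ => hC1 j
  have s2 : 0 ≤ ∑ i, ∑ j, C2 i j :=
    Finset.sum_nonneg fun i _ => Finset.sum_nonneg fun j _ => hC2 i j
  have l1 : ∀ j, C1 j ≤ ∑ j, C1 j := fun j =>
    Finset.single_le_sum (fun j _ => hC1 j) (Finset.mem_univ j)
  have l2 : ∀ i j, C2 i j ≤ ∑ i, ∑ j, C2 i j := fun i j =>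
    (Finset.single_le_sum (fun j _ => hC2 i j) (Finset.mem_univ j)).trans
      (Finset.single_le_sum (f := fun i => ∑ j, C2 i j)
        (fun i _ => Finset.sum_nonneg fun j _ => hC2 i j) (Finset.mem_univ i))
  have hπ := Real.pi_pos
  have hπA : 0 ≤ 8 * Real.pi * A := by positivity
  -- One constant dominates all normalisations of a band: sup norms of orders 0, 1, 2, and the L²
  -- norm through 8πA. The summand 1 makes it positive, hence invertible.
  set C : ℝ := 1 + C0 + ∑ j, C1 j + ∑ i, ∑ j, C2 i j + 8 * Real.pi * A with hC
  have hCpos : 0 < C := by linarith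
  refine ⟨C, hCpos, fun J hJ b hb hb1 hb2 z hz => ?_⟩
  have hx : 0 < (J * ‖z‖) ^ r := Real.rpow_pos_of_pos (mul_pos hJ (norm_pos_iff.2 hz)) r
  have hJc : (J : ℂ) ≠ 0 := by exact_mod_cast hJ.ne'
  have hn : ∀ ξ : EuclideanSpace ℝ (Fin d), ‖J⁻¹ • ξ‖ = J⁻¹ * ‖ξ‖ := fun ξ => by
    rw [norm_smul, norm_inv, Real.norm_of_nonneg hJ.le]
  have supp : ∀ ξ, 4 * J < ‖ξ‖ →
      (wave z ξ - 1) * (amplitude b ξ * dyadicDiff χ (J⁻¹ • ξ)) = 0 := fun ξ h => by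
    rw [dyadicDiff_eq_zero_of_gt h2, mul_zero, mul_zero]
    rw [hn, lt_inv_mul_iff₀ hJ]; linarith
  refine isBand_const_mul (mul_pos hCpos hx) (integrable_wave_sub_mul (integrable_amplitude_mul hb
    (integrable_comp_inv_smul hκ hκc hJ))) supp (fun ξ h => ?_) (fun x => ?_) (fun j x => ?_)
    (fun i j x => ?_) ?_
  · rw [dyadicDiff_eq_zero_of_lt h1, mul_zero, mul_zero]
    rw [hn, inv_mul_lt_iff₀ hJ]; linarith
  · refine (b0 J hJ b hb hb1 z x).trans (mul_le_mul_of_nonneg_right ?_ hx.le)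
    linarith
  · have e : (fun ξ : EuclideanSpace ℝ (Fin d) => (ξ j : ℂ) *
        ((wave z ξ - 1) * (amplitude b ξ * dyadicDiff χ (J⁻¹ • ξ))))
        = fun ξ => (J : ℂ) * ((wave z ξ - 1) * (amplitude b ξ *
          (fun η : EuclideanSpace ℝ (Fin d) => (η j : ℂ) * dyadicDiff χ η) (J⁻¹ • ξ))) := by
      ext ξ
      simp only [PiLp.smul_apply, smul_eq_mul]
      push_cast; field_simp
    rw [e, synth_const_mul, norm_mul, Complex.norm_real, Real.norm_of_nonneg hJ.le, mul_comm J]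
    refine mul_le_mul_of_nonneg_right ((b1 j J hJ b hb hb1 z x).trans
      (mul_le_mul_of_nonneg_right ?_ hx.le)) hJ.le
    linarith [l1 j]
  · have e : (fun ξ : EuclideanSpace ℝ (Fin d) => (ξ i : ℂ) * ((ξ j : ℂ) *
        ((wave z ξ - 1) * (amplitude b ξ * dyadicDiff χ (J⁻¹ • ξ)))))
        = fun ξ => ((J ^ 2 : ℝ) : ℂ) * ((wave z ξ - 1) * (amplitude b ξ *
          (fun η : EuclideanSpace ℝ (Fin d) => (η i : ℂ) * ((η j : ℂ) * dyadicDiff χ η))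
            (J⁻¹ • ξ))) := by
      ext ξ
      simp only [PiLp.smul_apply, smul_eq_mul]
      push_cast; field_simp
    rw [e, synth_const_mul, norm_mul, Complex.norm_real, Real.norm_of_nonneg (sq_nonneg J),
      mul_comm (J ^ 2)]
    refine mul_le_mul_of_nonneg_right ((b2 i j J hJ b hb hb1 z x).trans
      (mul_le_mul_of_nonneg_right ?_ hx.le)) (sq_nonneg J)
    linarith [l2 i j]
  · have hmin := min_one_le_rpow (mul_nonneg hJ.le (norm_nonneg z)) hr0 hr1
    have pt : ∀ ξ, ‖(wave z ξ - 1) * (amplitude b ξ * dyadicDiff χ (J⁻¹ • ξ))‖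
        ≤ 8 * Real.pi * (J * ‖z‖) ^ r * ‖amplitude b ξ‖ := fun ξ => by
      by_cases hξ : 4 * J < ‖ξ‖
      · rw [supp ξ hξ, norm_zero]; positivity
      · rw [norm_mul, norm_mul]
        have w1 := norm_wave_sub_one_le z ξ
        -- On the shell ‖ξ‖ ≤ 4J, which is where the factor 8π = 4 · 2π comes from.
        have w2 : min 2 (2 * Real.pi * (‖z‖ * ‖ξ‖)) ≤ 8 * Real.pi * min 1 (J * ‖z‖) := by
          rw [mul_min_of_nonneg _ _ (by positivity)]
          refine min_le_min (by linarith [Real.pi_gt_three]) ?_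
          have := mul_le_mul_of_nonneg_left (not_lt.1 hξ) (norm_nonneg z)
          nlinarith
        refine mul_le_mul (w1.trans (w2.trans (mul_le_mul_of_nonneg_left hmin (by positivity))))
          (mul_le_of_le_one_right (norm_nonneg _) (norm_dyadicDiff_le _)) (by positivity)
          (by positivity)
    set c : ℝ := 8 * Real.pi * (J * ‖z‖) ^ r with hc
    have hc0 : 0 ≤ c := by positivity
    calc ∫⁻ ξ, ‖(wave z ξ - 1) * (amplitude b ξ * dyadicDiff χ (J⁻¹ • ξ))‖ₑ ^ 2
        ≤ ∫⁻ ξ, ENNReal.ofReal (c ^ 2) * ‖amplitude b ξ‖ₑ ^ 2 := by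
          refine lintegral_mono fun ξ => ?_
          rw [ENNReal.ofReal_pow hc0, ← mul_pow, ← ofReal_norm, ← ofReal_norm,
            ← ENNReal.ofReal_mul hc0]
          gcongr
          exact pt ξ
      _ ≤ ENNReal.ofReal (c ^ 2) * ENNReal.ofReal (A ^ 2) := by
          rw [lintegral_const_mul' _ _ ENNReal.ofReal_ne_top,
            lintegral_sq_amplitude hb (memLp_two_of_bounded hb hb1)]
          gcongr
      _ ≤ ENNReal.ofReal ((C * (J * ‖z‖) ^ r) ^ 2) := by
          rw [← ENNReal.ofReal_mul (by positivity), ← mul_pow]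
          refine ENNReal.ofReal_le_ofReal (pow_le_pow_left₀ (by positivity) ?_ 2)
          rw [hc, mul_right_comm]
          refine mul_le_mul_of_nonneg_right ?_ hx.le
          linarith

end Bands

/-! ### From decay on dyadic shells to translation estimates in dual form -/

section Translation

variable {d : ℕ}

lemma integrable_mul_synth {F μ : EuclideanSpace ℝ (Fin d) → ℂ} (hF : Integrable F)
    (hμ : Integrable μ) : Integrable fun x => F x * synth μ x :=
  hF.mul_bdd (continuous_synth hμ).aestronglyMeasurable (ae_of_all _ fun x => norm_synth_le x)

/-- On the frequency side both factors are in L², so their product is an integrable majorant, and at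
each ξ the cut-off eventually equals 1. -/
lemma tendsto_integral_mul_synth_cutoff {F b : EuclideanSpace ℝ (Fin d) → ℂ} (hF : Integrable F)
    (hF2 : MemLp F 2) (hb : Integrable b) (hb2 : MemLp b 2) (z : EuclideanSpace ℝ (Fin d))
    {χ : ContDiffBump (0 : EuclideanSpace ℝ (Fin d))} (h1 : χ.rIn = 1) :
    Filter.Tendsto (fun N : ℕ => ∫ x, F x * synth (fun ξ => (wave (-z) ξ - 1) *
        (amplitude b ξ * ((χ (((2 : ℝ) ^ N)⁻¹ • ξ) : ℝ) : ℂ))) x)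
      Filter.atTop (nhds (∫ x, F x * (b (x - z) - b x))) := by
  set b' : EuclideanSpace ℝ (Fin d) → ℂ := fun x => b (x - z) - b x with hb'
  have hi : Integrable b' := (hb.comp_sub_right z).sub hb
  have hi2 : MemLp b' 2 :=
    (hb2.comp_measurePreserving (measurePreserving_sub_right volume z)).sub hb2
  have hpos : ∀ N : ℕ, (0 : ℝ) < 2 ^ N := fun N => by positivity
  have hχ : ∀ N : ℕ, Integrable fun ξ => ((χ (((2 : ℝ) ^ N)⁻¹ • ξ) : ℝ) : ℂ) := fun N =>
    integrable_comp_inv_smul contDiff_bump hasCompactSupport_bump (hpos N)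
  have e : ∀ N : ℕ, ∫ x, F x * synth (fun ξ => (wave (-z) ξ - 1) *
        (amplitude b ξ * ((χ (((2 : ℝ) ^ N)⁻¹ • ξ) : ℝ) : ℂ))) x
      = ∫ ξ, amplitude b' ξ * ((χ (((2 : ℝ) ^ N)⁻¹ • ξ) : ℝ) : ℂ) * synth F ξ := fun N => by
    rw [← integral_mul_synth hF (integrable_amplitude_mul hi (hχ N))]
    simp only [hb', amplitude_translate_sub hb, mul_assoc]
  have e2 : ∫ x, F x * b' x = ∫ ξ, amplitude b' ξ * synth F ξ := by
    rw [← integral_synth_mul_synth_neg hF hF2 hi hi2]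
    simp only [amplitude, mul_comm]
  rw [e2]
  simp only [e]
  have am : MemLp (amplitude b') 2 :=
    (memLp_synth hi hi2).comp_measurePreserving (Measure.measurePreserving_neg volume)
  have dom : Integrable fun ξ => amplitude b' ξ * synth F ξ :=
    am.integrable_mul (memLp_synth hF hF2)
  refine tendsto_integral_of_dominated_convergence (fun ξ => ‖amplitude b' ξ * synth F ξ‖)
    (fun N => ((continuous_amplitude hi).aestronglyMeasurable.mul (hχ N).1).mul
      (continuous_synth hF).aestronglyMeasurable) dom.norm
    (fun N => ae_of_all _ fun ξ => ?_) (ae_of_all _ fun ξ => ?_)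
  · rw [norm_mul, norm_mul, norm_mul, Complex.norm_real, Real.norm_of_nonneg χ.nonneg]
    refine mul_le_mul_of_nonneg_right ?_ (norm_nonneg _)
    exact mul_le_of_le_one_right (norm_nonneg _) χ.le_one
  · refine tendsto_const_nhds.congr' ?_
    obtain ⟨N₀, hN₀⟩ := pow_unbounded_of_one_lt ‖ξ‖ (one_lt_two (α := ℝ))
    filter_upwards [Filter.eventually_ge_atTop N₀] with N hN
    have h2 : ‖ξ‖ ≤ 2 ^ N := hN₀.le.trans (pow_le_pow_right₀ one_le_two hN)
    rw [χ.one_of_mem_closedBall, Complex.ofReal_one, mul_one]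
    rw [mem_closedBall_zero_iff, norm_smul, norm_inv, Real.norm_of_nonneg (hpos N).le, h1,
      inv_mul_le_iff₀ (hpos N), mul_one]
    exact h2

/-- Littlewood–Paley summation: the shell at J = 2^k contributes (J‖z‖)^r from the normalisation of
the band and J^(-s) from the decay, a geometric series because r < s. The low frequencies are
estimated directly. -/
lemma exists_translation_duality {F : EuclideanSpace ℝ (Fin d) → ℂ} (hF : Integrable F)
    (hF2 : MemLp F 2) {C₀ s : ℝ} (hC₀ : 0 ≤ C₀)
    (hdec : ∀ μ J, 1 ≤ J → IsBand μ J → ‖∫ x, F x * synth μ x‖ ≤ C₀ * J ^ (-s))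
    {r : ℝ} (hr0 : 0 ≤ r) (hr1 : r ≤ 1) (hrs : r < s) {A : ℝ} (hA : 0 ≤ A) :
    ∃ C : ℝ, 0 ≤ C ∧ ∀ b : EuclideanSpace ℝ (Fin d) → ℂ, Integrable b → (∀ x, ‖b x‖ ≤ 1) →
      ∫⁻ x, ‖b x‖ₑ ^ 2 ≤ ENNReal.ofReal (A ^ 2) → ∀ z,
      ‖∫ x, F x * (b (x - z) - b x)‖ ≤ C * ‖z‖ ^ r := by
  set χ : ContDiffBump (0 : EuclideanSpace ℝ (Fin d)) := ⟨1, 2, one_pos, one_lt_two⟩ with hχ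
  obtain ⟨C₁, hC₁, h₁⟩ := exists_isBand_difference (χ := χ) rfl rfl hr0 hr1 hA
  obtain ⟨C₂, hC₂, h₂⟩ := exists_norm_synth_difference_le
    (contDiff_bump (χ := χ)) hasCompactSupport_bump hr0 hr1
  set q : ℝ := 2 ^ (r - s) with hq
  have hq0 : 0 ≤ q := by positivity
  have hq1 : q < 1 := Real.rpow_lt_one_of_one_lt_of_neg one_lt_two (by linarith)
  have hq2 : 0 ≤ (1 - q)⁻¹ := inv_nonneg.2 (by linarith)
  refine ⟨(∫ x, ‖F x‖) * C₂ + C₁ * C₀ * (1 - q)⁻¹, by positivity, fun b hb hb1 hbA z => ?_⟩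
  rcases eq_or_ne z 0 with rfl | hz
  · simp only [sub_zero, sub_self, mul_zero, integral_zero, norm_zero]
    positivity
  have hz' : -z ≠ 0 := neg_ne_zero.2 hz
  set ν : ℕ → EuclideanSpace ℝ (Fin d) → ℂ := fun N ξ => (wave (-z) ξ - 1) *
    (amplitude b ξ * ((χ (((2 : ℝ) ^ N)⁻¹ • ξ) : ℝ) : ℂ)) with hν
  have hpos : ∀ N : ℕ, (0 : ℝ) < 2 ^ N := fun N => by positivity
  have hνi : ∀ N, Integrable (ν N) := fun N => integrable_wave_sub_mul
    (integrable_amplitude_mul hb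
      (integrable_comp_inv_smul contDiff_bump hasCompactSupport_bump (hpos N)))
  set S : ℕ → ℂ := fun N => ∫ x, F x * synth (ν N) x with hS
  have hlim : Filter.Tendsto S Filter.atTop (nhds (∫ x, F x * (b (x - z) - b x))) :=
    tendsto_integral_mul_synth_cutoff hF hF2 hb (memLp_two_of_bounded hb hb1) z rfl
  have start : ‖S 0‖ ≤ (∫ x, ‖F x‖) * C₂ * ‖z‖ ^ r := by
    rw [mul_assoc, ← integral_mul_const]
    refine norm_integral_le_of_norm_le (hF.norm.mul_const _) (ae_of_all _ fun x => ?_)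
    rw [norm_mul]
    refine mul_le_mul_of_nonneg_left ?_ (norm_nonneg _)
    have := h₂ (2 ^ 0) (hpos 0) b hb hb1 (-z) x
    rwa [pow_zero, one_mul, norm_neg] at this
  have step : ∀ k, ‖S (k + 1) - S k‖ ≤ C₁ * C₀ * ‖z‖ ^ r * q ^ k := fun k => by
    set J : ℝ := 2 ^ k with hJ
    have hJ1 : 1 ≤ J := one_le_pow₀ one_le_two
    have hJ0 : 0 < J := hpos k
    set D : ℝ := C₁ * (J * ‖-z‖) ^ r with hD
    have hD0 : 0 < D := mul_pos hC₁ (Real.rpow_pos_of_pos (mul_pos hJ0 (norm_pos_iff.2 hz')) r)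
    have hband := h₁ J hJ0 b hb hb1 hbA (-z) hz'
    have hest := hdec _ J hJ1 hband
    have e : ∀ x, synth (ν (k + 1)) x - synth (ν k) x = (D : ℂ) * synth (fun ξ =>
        ((D⁻¹ : ℝ) : ℂ) * ((wave (-z) ξ - 1) * (amplitude b ξ * dyadicDiff χ (J⁻¹ • ξ)))) x := by
      intro x
      rw [← synth_sub (hνi _) (hνi _), ← synth_const_mul]
      congr 1; ext ξ
      have hDc : (D : ℂ) ≠ 0 := by exact_mod_cast hD0.ne'
      have e1 : ((2 : ℝ) ^ (k + 1))⁻¹ • ξ = (2 : ℝ)⁻¹ • (J⁻¹ • ξ) := by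
        rw [smul_smul, hJ, pow_succ, mul_inv, mul_comm]
      simp only [hν, e1, dyadicDiff, ← hJ]
      push_cast
      rw [mul_inv_cancel_left₀ hDc]
      ring
    have e2 : S (k + 1) - S k = (D : ℂ) * ∫ x, F x * synth (fun ξ =>
        ((D⁻¹ : ℝ) : ℂ) * ((wave (-z) ξ - 1) * (amplitude b ξ * dyadicDiff χ (J⁻¹ • ξ)))) x := by
      rw [hS, ← integral_sub (integrable_mul_synth hF (hνi _)) (integrable_mul_synth hF (hνi _)),
        ← integral_const_mul]
      refine integral_congr_ae (ae_of_all _ fun x => ?_)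
      simp only
      rw [← mul_sub, e]; ring
    rw [e2, norm_mul, Complex.norm_real, Real.norm_of_nonneg hD0.le]
    refine (mul_le_mul_of_nonneg_left hest hD0.le).trans (le_of_eq ?_)
    have e3 : J ^ r * J ^ (-s) = q ^ k := by
      rw [← Real.rpow_add hJ0, hJ, hq, ← Real.rpow_natCast, ← Real.rpow_natCast,
        ← Real.rpow_mul (by norm_num), ← Real.rpow_mul (by norm_num), mul_comm, sub_eq_add_neg]
    rw [hD, norm_neg, Real.mul_rpow hJ0.le (norm_nonneg _), ← e3]
    ring
  refine le_of_tendsto hlim.norm (Filter.Eventually.of_forall fun N => ?_)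
  have tel : S N = S 0 + ∑ k ∈ Finset.range N, (S (k + 1) - S k) := by
    rw [Finset.sum_range_sub]; ring
  have hsum : ∑ k ∈ Finset.range N, q ^ k ≤ (1 - q)⁻¹ := by
    rw [← tsum_geometric_of_lt_one hq0 hq1]
    exact (summable_geometric_of_lt_one hq0 hq1).sum_le_tsum _ fun k _ => pow_nonneg hq0 k
  rw [tel]
  calc _ ≤ ‖S 0‖ + ∑ k ∈ Finset.range N, ‖S (k + 1) - S k‖ :=
        (norm_add_le _ _).trans (by gcongr; exact norm_sum_le _ _)
    _ ≤ (∫ x, ‖F x‖) * C₂ * ‖z‖ ^ r + ∑ k ∈ Finset.range N, C₁ * C₀ * ‖z‖ ^ r * q ^ k := by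
        gcongr with k; exact step k
    _ ≤ (∫ x, ‖F x‖) * C₂ * ‖z‖ ^ r + C₁ * C₀ * ‖z‖ ^ r * (1 - q)⁻¹ := by
        rw [← Finset.mul_sum]; gcongr
    _ = _ := by ring

end Translation

/-! ### L¹ modulus of continuity and Gagliardo seminorms -/

section Gagliardo

variable {d : ℕ}

lemma abs_sign_le_one (t : ℝ) : |Real.sign t| ≤ 1 := by
  rcases Real.sign_apply_eq t with h | h | h <;> simp [h]

lemma sign_mul_self_eq_abs (t : ℝ) : Real.sign t * t = |t| := by
  rcases lt_trichotomy t 0 with h | rfl | h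
  · rw [Real.sign_of_neg h, abs_of_neg h, neg_one_mul]
  · simp
  · rw [Real.sign_of_pos h, abs_of_pos h, one_mul]

/-- Duality between L¹ and bounded functions: the dual estimate is tested with the sign of F(·+z) -
F. -/
lemma exists_lintegral_translation_le {F : EuclideanSpace ℝ (Fin d) → ℝ}
    (hFm : AEStronglyMeasurable F) {M R : ℝ} (hM : ∀ x, |F x| ≤ M) (hR : ∀ x, R < ‖x‖ → F x = 0)
    {C₀ s : ℝ} (hC₀ : 0 ≤ C₀)
    (hdec : ∀ μ J, 1 ≤ J → IsBand μ J → ‖∫ x, (F x : ℂ) * synth μ x‖ ≤ C₀ * J ^ (-s))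
    {r : ℝ} (hr0 : 0 ≤ r) (hr1 : r ≤ 1) (hrs : r < s) :
    ∃ C : ℝ, 0 ≤ C ∧ ∀ z, ∫⁻ x, ‖F (x + z) - F x‖ₑ ≤ ENNReal.ofReal (C * ‖z‖ ^ r) := by
  set B := Metric.closedBall (0 : EuclideanSpace ℝ (Fin d)) R with hB
  have hBm : MeasurableSet B := measurableSet_closedBall
  have hBv : volume B < ⊤ := measure_closedBall_lt_top
  have hFB : ∀ x, x ∉ B → F x = 0 := fun x hx => hR x (by simpa [hB] using hx)
  have bdd : ∀ {g : EuclideanSpace ℝ (Fin d) → ℝ} {S : Set (EuclideanSpace ℝ (Fin d))} {c : ℝ},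
      AEStronglyMeasurable g → MeasurableSet S → volume S < ⊤ → (∀ x, |g x| ≤ c) →
      (∀ x, x ∉ S → g x = 0) → Integrable g := fun {g S c} hg hS hv hc h0 => by
    refine Integrable.mono' ((integrable_indicator_iff hS).2 (integrableOn_const (C := c) hv.ne)) hg
      (ae_of_all _ fun x => ?_)
    by_cases hx : x ∈ S
    · rw [indicator_of_mem hx]; exact hc x
    · rw [indicator_of_notMem hx, h0 x hx, norm_zero]
  have hFi : Integrable F := bdd hFm hBm hBv hM hFB
  have hFc : Integrable fun x => (F x : ℂ) := hFi.ofReal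
  have hF2 : MemLp (fun x => (F x : ℂ)) 2 :=
    memLp_two_of_bounded hFc (B := M) fun x => by rw [Complex.norm_real]; exact hM x
  -- The sign function lives on two balls of equal volume, so its L² norm is bounded independently
  -- of z.
  set A : ℝ := Real.sqrt (2 * volume.real B) with hA
  obtain ⟨C, hC, h⟩ := exists_translation_duality hFc hF2 hC₀ hdec hr0 hr1 hrs (Real.sqrt_nonneg
    (2 * volume.real B))
  refine ⟨C, hC, fun z => ?_⟩
  have hFz : Integrable fun x => F (x + z) := hFi.comp_add_right z
  have hFzc : Integrable fun x => (F (x + z) : ℂ) := hFz.ofReal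
  set b : EuclideanSpace ℝ (Fin d) → ℝ := fun x => Real.sign (F (x + z) - F x) with hb
  have hbm : AEStronglyMeasurable b :=
    (measurable_sign.comp_aemeasurable (hFz.sub hFi).1.aemeasurable).aestronglyMeasurable
  set S := B ∪ Metric.closedBall (-z) R with hS
  have hSm : MeasurableSet S := hBm.union measurableSet_closedBall
  have hSv : volume S ≤ ENNReal.ofReal (A ^ 2) := by
    refine (measure_union_le _ _).trans (le_of_eq ?_)
    rw [Measure.addHaar_closedBall_center volume (-z), ← hB, ← two_mul, hA, Real.sq_sqrt (by positivity),
      ENNReal.ofReal_mul (by norm_num), measureReal_def, ENNReal.ofReal_toReal hBv.ne]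
    norm_num
  have hb0 : ∀ x, x ∉ S → b x = 0 := fun x hx => by
    have h1 : F x = 0 := hFB x fun h => hx (Or.inl h)
    have h2 : F (x + z) = 0 := hFB _ fun h => hx (Or.inr (by
      simpa [hB, dist_eq_norm, sub_neg_eq_add] using h))
    simp [hb, h1, h2]
  have hb1 : ∀ x, |b x| ≤ 1 := fun x => abs_sign_le_one _
  have hbi : Integrable b := bdd hbm hSm (hSv.trans_lt ENNReal.ofReal_lt_top) hb1 hb0
  have hbc : Integrable fun x => (b x : ℂ) := hbi.ofReal
  have hbn : ∀ x, ‖(b x : ℂ)‖ ≤ 1 := fun x => by rw [Complex.norm_real]; exact hb1 x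
  have hbsq : ∫⁻ x, ‖(b x : ℂ)‖ₑ ^ 2 ≤ ENNReal.ofReal (A ^ 2) := by
    refine le_trans ?_ hSv
    rw [← lintegral_indicator_one hSm]
    refine lintegral_mono fun x => ?_
    by_cases hx : x ∈ S
    · rw [indicator_of_mem hx, Pi.one_apply, ← ofReal_norm]
      exact pow_le_one₀ (by positivity) (ENNReal.ofReal_le_one.2 (hbn x))
    · simp [hb0 x hx]
  have key := h _ hbc hbn hbsq z
  have hprod : ∀ {g : EuclideanSpace ℝ (Fin d) → ℂ}, Integrable g →
      ∀ y, Integrable fun x => g x * (b (x - y) : ℂ) := fun hg y =>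
    hg.mul_bdd (hbc.comp_sub_right y).1 (ae_of_all _ fun x => hbn (x - y))
  -- A change of variables moves the translation from `b` to F, where `b` reproduces the absolute
  -- value.
  have e : ∫ x, (F x : ℂ) * ((b (x - z) : ℂ) - b x) = ((∫ x, |F (x + z) - F x| : ℝ) : ℂ) := by
    have h2 := integral_sub_right_eq_self (fun x => (F (x + z) : ℂ) * b x) (μ := volume) z
    simp only [sub_add_cancel] at h2
    have i1 := hprod hFc z
    have i2 := hprod hFc 0
    have i3 := hprod hFzc 0
    simp only [sub_zero] at i2 i3
    simp only [mul_sub]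
    rw [integral_sub i1 i2, h2, ← integral_sub i3 i2, ← integral_complex_ofReal]
    refine integral_congr_ae (ae_of_all _ fun x => ?_)
    simp only
    rw [← sub_mul, ← Complex.ofReal_sub, ← Complex.ofReal_mul]
    congr 1
    rw [hb, mul_comm]
    exact sign_mul_self_eq_abs _
  rw [e, Complex.norm_real, Real.norm_of_nonneg (integral_nonneg fun x => abs_nonneg _)] at key
  exact (ofReal_integral_norm_eq_lintegral_enorm (hFz.sub hFi)).symm.le.trans
    (ENNReal.ofReal_le_ofReal key)

/-- An `L¹` modulus of continuity of a bounded function controls its Gagliardo seminorms. -/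
lemma lintegral_gagliardo_lt_top (hd : 1 ≤ d) {F : EuclideanSpace ℝ (Fin d) → ℝ}
    (hFm : AEStronglyMeasurable F) {M : ℝ} (hM : ∀ x, |F x| ≤ M) {C r : ℝ}
    (hC : ∀ z, ∫⁻ x, ‖F (x + z) - F x‖ₑ ≤ ENNReal.ofReal (C * ‖z‖ ^ r)) (hC0 : 0 ≤ C)
    {s q : ℝ} (hq : 1 ≤ q) (hsq : s * q < r)
    {K : Set (EuclideanSpace ℝ (Fin d))} (hK : IsCompact K) :
    ∫⁻ x in K, ∫⁻ y in K, ‖F x - F y‖ₑ ^ q / edist x y ^ ((d : ℝ) + s * q) < ⊤ := by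
  have hM0 : 0 ≤ M := (abs_nonneg _).trans (hM 0)
  have hKm := hK.isClosed.measurableSet
  obtain ⟨R, hR⟩ := hK.isBounded.subset_closedBall (0 : EuclideanSpace ℝ (Fin d))
  set G : EuclideanSpace ℝ (Fin d) × EuclideanSpace ℝ (Fin d) → ℝ≥0∞ :=
    (K ×ˢ K).indicator fun p => ‖F p.1 - F p.2‖ₑ ^ q / edist p.1 p.2 ^ ((d : ℝ) + s * q) with hG
  have hGm : AEMeasurable G (volume.prod volume) := by
    refine AEMeasurable.indicator ?_ (hKm.prod hKm)
    have h1 : AEMeasurable (fun p : EuclideanSpace ℝ (Fin d) × EuclideanSpace ℝ (Fin d) =>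
        ‖F p.1 - F p.2‖ₑ) (volume.prod volume) := (hFm.comp_fst.sub hFm.comp_snd).enorm
    exact (h1.pow_const q).div
      ((measurable_fst.edist measurable_snd).pow_const _).aemeasurable
  have e1 : ∫⁻ x in K, ∫⁻ y in K, ‖F x - F y‖ₑ ^ q / edist x y ^ ((d : ℝ) + s * q)
      = ∫⁻ x, ∫⁻ y, G (x, y) := by
    rw [← lintegral_indicator hKm]
    refine lintegral_congr fun x => ?_
    by_cases hx : x ∈ K
    · rw [indicator_of_mem hx, ← lintegral_indicator hKm]
      refine lintegral_congr fun y => ?_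
      by_cases hy : y ∈ K
      · rw [indicator_of_mem hy, hG, indicator_of_mem (mk_mem_prod hx hy)]
      · rw [indicator_of_notMem hy, hG, indicator_of_notMem fun h => hy h.2]
    · rw [indicator_of_notMem hx]
      have : ∀ y, G (x, y) = 0 := fun y => indicator_of_notMem (fun h => hx h.1) _
      simp [this]
  have e2 : ∫⁻ x, ∫⁻ y, G (x, y) = ∫⁻ z, ∫⁻ x, G (x, x + z) := by
    have h1 : ∀ x, ∫⁻ y, G (x, y) = ∫⁻ z, G (x, x + z) := fun x =>
      (lintegral_add_left_eq_self (fun y => G (x, y)) x).symm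
    simp only [h1]
    exact lintegral_lintegral_swap
      (hGm.comp_quasiMeasurePreserving (measurePreserving_prod_add volume
        volume).quasiMeasurePreserving)
  -- Boundedness lowers the power: D^q ≤ (2M)^(q-1) D for 0 ≤ D ≤ 2M, so an L¹ modulus suffices.
  set c : ℝ := (2 * M) ^ (q - 1) with hc
  have hc0 : 0 ≤ c := Real.rpow_nonneg (by positivity) _
  -- The remaining kernel is ‖z‖^(-β), locally integrable because sq < r means β < d.
  set β : ℝ := (d : ℝ) + s * q - r with hβ
  have pt : ∀ z, z ≠ 0 → ∫⁻ x, G (x, x + z)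
      ≤ (Metric.closedBall 0 (2 * R)).indicator (fun z => ENNReal.ofReal (c * C * ‖z‖ ^ (-β))) z := by
    intro z hz
    have hz0 : 0 < ‖z‖ := norm_pos_iff.2 hz
    by_cases hzR : z ∈ Metric.closedBall (0 : EuclideanSpace ℝ (Fin d)) (2 * R)
    · rw [indicator_of_mem hzR]
      calc ∫⁻ x, G (x, x + z)
          ≤ ∫⁻ x, ENNReal.ofReal (c * ‖z‖ ^ (-((d : ℝ) + s * q))) * ‖F (x + z) - F x‖ₑ := by
            refine lintegral_mono fun x => (indicator_le_self _ _ _).trans ?_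
            have a1 : edist x (x + z) = ENNReal.ofReal ‖z‖ := by
              rw [edist_comm, edist_eq_enorm_sub, add_sub_cancel_left, ofReal_norm]
            have a2 : ‖F x - F (x + z)‖ₑ = ENNReal.ofReal |F (x + z) - F x| := by
              rw [← ofReal_norm, Real.norm_eq_abs, abs_sub_comm]
            have a3 : ‖F (x + z) - F x‖ₑ = ENNReal.ofReal |F (x + z) - F x| := by
              rw [← ofReal_norm, Real.norm_eq_abs]
            simp only [a1, a2, a3]
            rw [ENNReal.ofReal_rpow_of_nonneg (abs_nonneg _) (by linarith),
              ENNReal.ofReal_rpow_of_pos hz0, ← ENNReal.ofReal_div_of_pos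
              (Real.rpow_pos_of_pos hz0 _), ← ENNReal.ofReal_mul (by positivity)]
            refine ENNReal.ofReal_le_ofReal ?_
            rw [Real.rpow_neg hz0.le, ← div_eq_mul_inv, div_mul_eq_mul_div]
            refine div_le_div_of_nonneg_right ?_ (by positivity)
            set D := |F (x + z) - F x| with hD
            have hD0 : 0 ≤ D := abs_nonneg _
            have hD2 : D ≤ 2 * M := (abs_sub _ _).trans (by linarith [hM (x + z), hM x])
            calc D ^ q = D ^ (q - 1) * D := by
                  rcases hD0.eq_or_lt with h0 | h0
                  · rw [← h0, mul_zero, Real.zero_rpow (by linarith)]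
                  · rw [← Real.rpow_add_one h0.ne', sub_add_cancel]
              _ ≤ c * D := mul_le_mul_of_nonneg_right
                  (Real.rpow_le_rpow hD0 hD2 (by linarith)) hD0
        _ ≤ ENNReal.ofReal (c * ‖z‖ ^ (-((d : ℝ) + s * q))) * ENNReal.ofReal (C * ‖z‖ ^ r) := by
            rw [lintegral_const_mul' _ _ ENNReal.ofReal_ne_top]
            gcongr
            exact hC z
        _ = ENNReal.ofReal (c * C * ‖z‖ ^ (-β)) := by
            rw [← ENNReal.ofReal_mul (by positivity)]
            congr 1
            have : ‖z‖ ^ (-β) = ‖z‖ ^ (-((d : ℝ) + s * q)) * ‖z‖ ^ r := by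
              rw [← Real.rpow_add hz0]; congr 1; rw [hβ]; ring
            rw [this]; ring
    · rw [indicator_of_notMem hzR]
      have : ∀ x, G (x, x + z) = 0 := fun x => indicator_of_notMem (fun h => hzR (by
        have h1 := mem_closedBall_zero_iff.1 (hR h.1)
        have h2 := mem_closedBall_zero_iff.1 (hR h.2)
        rw [mem_closedBall_zero_iff]
        have h3 : z = (x + z) - x := by abel
        rw [h3]
        exact (norm_sub_le _ _).trans (by simp only at h1 h2; linarith))) _
      simp [this]
  have : Nontrivial (EuclideanSpace ℝ (Fin d)) := by
    have : Nonempty (Fin d) := ⟨⟨0, hd⟩⟩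
    infer_instance
  have hfin : Module.finrank ℝ (EuclideanSpace ℝ (Fin d)) = d := by simp
  have hint : LocallyIntegrable
      (fun z : EuclideanSpace ℝ (Fin d) => c * C * ‖z‖ ^ (-β)) volume := by
    refine locallyIntegrable_of_norm_le_rpow (α := β) (C := c * C) (by rw [hfin]; exact hd)
      (by rw [hfin, hβ]; linarith) (ae_of_all _ fun z => ?_) ?_
    · rw [Real.norm_of_nonneg (by positivity)]
    · exact ((measurable_norm.pow_const _).const_mul _).aestronglyMeasurable
  rw [e1, e2]
  have hne : ∀ᵐ z : EuclideanSpace ℝ (Fin d), z ≠ 0 := by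
    rw [ae_iff]; simp
  refine (lintegral_mono_ae (hne.mono pt)).trans_lt ?_
  rw [lintegral_indicator measurableSet_closedBall]
  exact (hint.integrableOn_isCompact (isCompact_closedBall 0 (2 * R))).lintegral_lt_top

end Gagliardo

/-! ### Sobolev regularity of the velocity averages -/

section VelocityAverages

variable {d : ℕ} {H : EuclideanSpace ℝ (Fin d) × ℝ → ℝ} {ρ : ℝ → ℝ} {lo hi : ℝ}

lemma aestronglyMeasurable_average (hH : AEStronglyMeasurable H) (hρ : Continuous ρ) :
    AEStronglyMeasurable fun x => ∫ l in Icc lo hi, H (x, l) * ρ l := by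
  have h1 : AEStronglyMeasurable (fun p : EuclideanSpace ℝ (Fin d) × ℝ => H p * ρ p.2)
      (volume.prod (volume.restrict (Icc lo hi))) :=
    (hH.mul (hρ.comp continuous_snd).aestronglyMeasurable).mono_measure
      (Measure.prod_mono le_rfl Measure.restrict_le_self)
  exact h1.integral_prod_right'

lemma exists_abs_average_le (hH1 : ∀ p, |H p| ≤ 1) (hρ : ContDiff ℝ 1 ρ)
    (hρI : tsupport ρ ⊆ Icc lo hi) :
    ∃ M : ℝ, 0 ≤ M ∧ ∀ x, |∫ l in Icc lo hi, H (x, l) * ρ l| ≤ M := by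
  obtain ⟨Mρ, -, hMρ, -, hρ0, -⟩ := exists_cutoff_bound hρ hρI
  refine ⟨Mρ * volume.real (Icc lo hi), by positivity, fun x => ?_⟩
  have h := norm_setIntegral_le_of_norm_le_const (μ := volume) (s := Icc lo hi)
    (f := fun l => H (x, l) * ρ l) (C := Mρ) isCompact_Icc.measure_lt_top fun l _ => by
      rw [norm_mul]
      exact (mul_le_mul (hH1 _) (hρ0 l) (abs_nonneg _) zero_le_one).trans (one_mul _).le
  exact h

lemma pairing_eq_integral_average {φ : EuclideanSpace ℝ (Fin d) → ℝ}
    (hH : AEStronglyMeasurable H) (hH1 : ∀ p, |H p| ≤ 1) (hφ : Continuous φ)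
    (hφc : HasCompactSupport φ) (hρ : Continuous ρ) (hρI : tsupport ρ ⊆ Icc lo hi)
    {g : EuclideanSpace ℝ (Fin d) → ℂ} (hg : Continuous g) :
    pairing H ρ φ (fun p => g p.1)
      = ∫ x, ((φ x * ∫ l in Icc lo hi, H (x, l) * ρ l : ℝ) : ℂ) * g x := by
  have hint : Integrable (fun p => ((H p * (ρ p.2 * φ p.1) : ℝ) : ℂ) * g p.1)
      ((volume : Measure (EuclideanSpace ℝ (Fin d))).prod (volume : Measure ℝ)) :=
    integrable_pairing hH hH1 hφ hφc hρ hρI (hg.comp continuous_fst)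
  rw [pairing, Measure.volume_eq_prod, integral_prod _ hint]
  refine integral_congr_ae (ae_of_all _ fun x => ?_)
  simp only
  have h0 : ∫ l in Icc lo hi, H (x, l) * ρ l = ∫ l, H (x, l) * ρ l :=
    setIntegral_eq_integral_of_forall_compl_eq_zero fun l hl => by
      rw [image_eq_zero_of_notMem_tsupport fun h => hl (hρI h), mul_zero]
  rw [integral_mul_const, h0, ← integral_const_mul, ← integral_complex_ofReal]
  congr 1
  refine integral_congr_ae (ae_of_all _ fun l => ?_)
  simp only
  congr 1; ring

/-- Only the product sq is constrained: the L¹ estimate of order close to α / (3 (1 + α)) is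
interpolated with the boundedness of the average. -/
lemma IsKineticSolution.memSobolevLoc (hd : 1 ≤ d)
    {f : ℝ → EuclideanSpace ℝ (Fin d)} {a σ : ℝ → Matrix (Fin d) (Fin d) ℝ}
    (hK : IsKineticSolution lo hi f a σ H) (hρ : ContDiff ℝ 1 ρ) (hρI : tsupport ρ ⊆ Icc lo hi)
    {D α : ℝ} (hα : 0 < α) (hD0 : 0 ≤ D)
    (hD : ∀ δ, 0 < δ → ∀ ξ : EuclideanSpace ℝ (Fin d), ‖ξ‖ = 1 →
      volume {l ∈ Icc lo hi | inner ℝ (f l) ξ ^ 2 + quadForm (a l) ξ ≤ δ}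
        ≤ ENNReal.ofReal (D * δ ^ α)) {s q : ℝ} (hs : 0 < s) (hq : 1 ≤ q)
    (hsq : s * q < α / (3 * (1 + α))) :
    MemSobolevLoc s q fun x => ∫ l in Icc lo hi, H (x, l) * ρ l := by
  intro K hKc
  set g : EuclideanSpace ℝ (Fin d) → ℝ := fun x => ∫ l in Icc lo hi, H (x, l) * ρ l with hg
  have hgm : AEStronglyMeasurable g := aestronglyMeasurable_average hK.meas hρ.continuous
  obtain ⟨M, hM0, hM⟩ := exists_abs_average_le hK.bdd hρ hρI
  have hfin : IsFiniteMeasure (volume.restrict K) := ⟨by simpa using hKc.measure_lt_top⟩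
  refine ⟨MemLp.of_bound hgm.restrict M (ae_of_all _ hM), ?_⟩
  obtain ⟨R, hR⟩ := hKc.isBounded.subset_closedBall (0 : EuclideanSpace ℝ (Fin d))
  have hR1 : 0 < max R 0 + 1 := by positivity
  -- The cut-off is 1 on K, so the average and its localisation have the same Gagliardo integral
  -- over K.
  set φ : ContDiffBump (0 : EuclideanSpace ℝ (Fin d)) :=
    ⟨max R 0 + 1, max R 0 + 2, hR1, by linarith⟩ with hφ
  have hφK : ∀ x ∈ K, φ x = 1 := fun x hx => φ.one_of_mem_closedBall
    (Metric.closedBall_subset_closedBall (by simp only [hφ]; linarith [le_max_left R 0]) (hR hx))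
  set F : EuclideanSpace ℝ (Fin d) → ℝ := fun x => φ x * g x with hF
  have hFm : AEStronglyMeasurable F := φ.continuous.aestronglyMeasurable.mul hgm
  have hFM : ∀ x, |F x| ≤ M := fun x => by
    rw [hF, abs_mul, abs_of_nonneg φ.nonneg]
    exact (mul_le_of_le_one_left (abs_nonneg _) φ.le_one).trans (hM x)
  have hF0 : ∀ x, max R 0 + 2 < ‖x‖ → F x = 0 := fun x hx => by
    rw [hF]
    simp only
    rw [φ.zero_of_le_dist (by rw [dist_zero_right]; exact hx.le), zero_mul]
  have hs1 : α / (3 * (1 + α)) ≤ 1 := by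
    rw [div_le_one (by positivity)]; linarith
  -- Exponents sq < r < s' < α / (3 (1 + α)): decay at rate s', translation modulus of order r, and
  -- strict gaps for the two summations.
  obtain ⟨s', hs'1, hs'2⟩ := exists_between hsq
  obtain ⟨r, hr1, hr2⟩ := exists_between hs'1
  have hsq0 : 0 < s * q := by positivity
  obtain ⟨C₀, hC₀, hdec⟩ := hK.exists_pairing_decay φ.contDiff φ.hasCompactSupport hρ hρI hα hD0 hD
    (s := s') (by linarith) hs'2
  obtain ⟨C, hC, htr⟩ := exists_lintegral_translation_le hFm hFM hF0 hC₀ (s := s')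
    (fun μ J hJ hμ => by
      rw [← pairing_eq_integral_average hK.meas hK.bdd φ.continuous φ.hasCompactSupport
        hρ.continuous hρI (continuous_synth hμ.int)]
      exact hdec μ J hJ hμ) (r := r) (by linarith) (by linarith) hr2
  have key := lintegral_gagliardo_lt_top hd hFm hFM htr hC hq hr1 hKc
  have hKm := hKc.isClosed.measurableSet
  refine lt_of_le_of_lt (le_of_eq ?_) key
  refine setLIntegral_congr_fun hKm fun x hx => setLIntegral_congr_fun hKm fun y hy => ?_
  simp only [hF, hφK x hx, hφK y hy, one_mul]

end VelocityAverages

/-! ### Comparison of the exponents -/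

section Exponents

/-- After writing d = n + 2 and clearing denominators, the difference is a polynomial in α and n
without negative coefficients. -/
lemma sStar_mul_qStar_le {α : ℝ} (hα : 0 < α) {d : ℕ} (hd : 2 ≤ d) :
    sStar α d * qStar α d ≤ α / (3 * (1 + α)) := by
  obtain ⟨n, rfl⟩ := Nat.exists_eq_add_of_le hd
  rw [sStar, qStar, div_mul_div_comm]
  push_cast
  have hn : (0 : ℝ) ≤ n := Nat.cast_nonneg n
  rw [div_le_div_iff₀ (by positivity) (by positivity)]
  rw [← sub_nonneg]
  ring_nf
  positivity

end Exponents

theorem theorem5p3 {d : ℕ} (hd : 2 ≤ d) (lo hi : ℝ)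
    (𝔣 : ℝ → EuclideanSpace ℝ (Fin d)) (a σ : ℝ → Matrix (Fin d) (Fin d) ℝ)
    (h𝔣 : ContDiff ℝ 1 𝔣)
    (h𝔣I : ∃ L, LipschitzOnWith L (deriv 𝔣) (Icc lo hi))
    (ha : ∀ i j, Continuous fun l => a l i j)
    (haI : ∀ i j, ∃ L, LipschitzOnWith L (fun l => a l i j) (Icc lo hi))
    (hσ : ∀ i j, Measurable fun l => σ l i j)
    (hσsymm : ∀ l, (σ l).IsSymm)
    (haσ : ∀ l, a l = σ l * σ l)
    (α δ₀ : ℝ) (hα : 0 < α) (hδ₀ : 0 < δ₀)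
    (hnd : NonDegenerate 𝔣 a (Icc lo hi) α δ₀)
    (u : EuclideanSpace ℝ (Fin d) → ℝ) (hu : IsEntropySolution 𝔣 a σ u)
    (ρ : ℝ → ℝ) (hρ : ContDiff ℝ 1 ρ) (hρI : tsupport ρ ⊆ Icc lo hi)
    (q s : ℝ) (hq : q ∈ Ioo 1 (qStar α d)) (hs : s ∈ Ioo 0 (sStar α d)) :
    MemSobolevLoc s q (fun x => ∫ l in Icc lo hi, kineticFun u (x, l) * ρ l) := by
  obtain ⟨D, hD0, hD⟩ := hnd.exists_volume_le hα hδ₀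
  have hsq : s * q < sStar α d * qStar α d :=
    mul_lt_mul hs.2 hq.2.le (by linarith [hq.1]) (hs.1.trans hs.2).le
  exact (hu.isKineticSolution h𝔣 h𝔣I ha haI hσ hσsymm haσ).memSobolevLoc (by omega) hρ hρI hα hD0 hD
    hs.1 hq.1.le (hsq.trans_le (sStar_mul_qStar_le hα hd))
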